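/- Let $p$ be a prime, $K/\mathbb{Q}_p$ a finite extension with ring of integers $\mathcal{O}_K$, residue field of size $p^f$, a fixed uniformizer $\pi$, normalized valuation $v_K$ ($v_K(\pi)=1$) and $|x|_K=p^{-fv_K(x)}$, $|0|_K=0$. Let $dx$ be the Haar measure on $K$ giving $\mathcal{O}_K$ volume $1$. For an integer $m\ge 1$ let $E=\bigcup_{s=0}^{m-1}\pi^s\mathcal{O}_K^\times$ (a fundamental domain of the Tate curve $K^\times/\pi^{m\mathbb{Z}}$), $V=\int_E dx/|x|_K$, and $$D\phi(x)=\int_E\frac{\phi(z)-\phi(x)}{|z-x|_K^2}\,|x|_K\,dz\qquad(x\in E).$$ For functions of two variables $D$ acts on the first one. For $x,y\in E$ put $$d(x,y)=\frac{|x-y|_K}{\max\{|x|_K,|y|_K\}},\qquad U_K(y)=p^{-fv_K(y)}+p^{-f(m-1-v_K(y))},$$ $$\Lambda_q=1+p^{-f}-p^{-f(q+1)}-p^{-f(m-q)}.$$ A symmetric Green's function is a function $G(x,y)$ on $\{(x,y)\in E\times E: x\neq y\}$ with $G(x,y)=G(y,x)$ such that for each $y\in E$ the function $G(\cdot,y)$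 is continuous on $E\setminus\{y\}$, integrable on $E$ for $dx/|x|_K$, and satisfies $DG(\cdot,y)=\delta_y-\frac1V$ as a distribution, i.e. $\int_E G(x,y)\,D\phi(x)\frac{dx}{|x|_K}=\phi(y)-\frac1V\int_E\phi(x)\frac{dx}{|x|_K}$ for all locally constant $\phi:E\to\mathbb{R}$. Then the following hold. 1. Let $\lambda_0\in\mathbb{R}$, let $A,\lambda_n:E\to\mathbb{R}$ ($n\ge1$) be functions with $\sum_{n\ge1}|\lambda_n(y)|<\infty$ for all $y\in E$, and put $F(x,y)=A(y)+\lambda_0\log_{p^f}d(x,y)+\sum_{n\ge1}\lambda_n(y)d(x,y)^n$. Then $DF(x,y)$, for $x\ne y$ in $E$, depends only on $v_K(x)$ and $v_K(y)$ if and only if, for all $y\in E$ and $n\ge1$, $$\lambda_n(y)=U_K(y)^n\,\frac{p^{f(n+1)}-1}{(p^f-1)(p^f+1)^n(p^{fn}-1)}\,\lambda_0.$$ 2. For every $\lambda_0\in\mathbb{R}$, let $\lambda_n$ be given by the formula in 1. Then $\sum_{n\ge 1}|\lambda_n(y)|<\infty$. Let $$B_{K,m}(x,y)=-\sum_{n\ge1}\lambda_n(y)+\lambda_0\log_{p^f}d(x,y)+\sum_{n\ge1}\lambda_n(y)d(x,y)^n.$$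 For all $x\neq y$ in $E$ the integral defining $DB_{K,m}(x,y)$ converges absolutely and $$DB_{K,m}(x,y)=-\lambda_0\,\frac{p^{-f|v_K(x)-v_K(y)|}}{p^f-1}\,\frac{p^f+1}{p^f+1-U_K(y)}.$$ 3. For $\lambda_0\in\mathbb{R}$ there is a real array $C=(C(q,r))_{0\le q,r\le m-1}$ with $D\big(B_{K,m}+C(v_K(\cdot),v_K(\cdot))\big)(x,y)=-\frac1V$ for all $x\ne y$ in $E$ if and only if $$\lambda_0=\frac{p^f(p^f-1)}{p^f+1}.$$ 4. Fix this value of $\lambda_0$. A real array $C=(C(q,r))_{0\le q,r\le m-1}$ is symmetric and satisfies the equation in 3 for all $x\neq y$ in $E$ if and only if $$C(q,r)=\begin{cases}C(m-1,0)-\dfrac{p^f}{m\Lambda_{m-2}}&q=m-2\ge 0,\ r=0\\[8pt]\dfrac{\Lambda_q+\Lambda_{q+2}}{\Lambda_q}C(q+1,0)-\dfrac{\Lambda_{q+2}}{\Lambda_q}C(q+2,0)-\dfrac{p^f-1}{m\Lambda_q}&0\le q<m-2,\ r=0\\[8pt]C(q,0)+C(m-1-r,0)-C(m-1,0)&q\ge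 r\\C(m-1-q,0)+C(r,0)-C(m-1,0)&q\le r\end{cases}$$ (all lines holding wherever they apply). Moreover $C(m-1,0)$ is arbitrary: for every $c\in\mathbb{R}$ there is such an array with $C(m-1,0)=c$. 5. With the value of $\lambda_0$ from 3, a function $G$ on $\{(x,y)\in E\times E:x\ne y\}$ is a symmetric Green's function if and only if $$G(x,y)=B_{K,m}(x,y)+C(v_K(x),v_K(y))\qquad(x\neq y)$$ for some array $C$ as in 4. -/

import Mathlib

open MeasureTheory

noncomputable section

namespace TateGreen

/-- A normed field extension of `ℚ_[p]` is nonarchimedean. -/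
theorem isUltrametricDist (p : ℕ) [Fact p.Prime] (K : Type*) [NormedField K]
    [NormedAlgebra ℚ_[p] K] : IsUltrametricDist K := by
  apply IsUltrametricDist.isUltrametricDist_of_forall_norm_natCast_le_one
  intro n
  have h : ((n : ℕ) : K) = algebraMap ℚ_[p] K (n : ℚ_[p]) := by simp
  rw [h, norm_algebraMap']
  simpa using Padic.norm_int_le_one (p := p) (n : ℤ)

/-- The ring of integers `𝒪_K = {x | ‖x‖ ≤ 1}` of a normed extension `K` of `ℚ_[p]`. -/
def ringOfIntegers (p : ℕ) [Fact p.Prime] (K : Type*) [NormedField K] [NormedAlgebra ℚ_[p] K] :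
    ValuationSubring K :=
  haveI := isUltrametricDist p K
  (NormedField.valuation (K := K)).valuationSubring

theorem mem_ringOfIntegers (p : ℕ) [Fact p.Prime] (K : Type*) [NormedField K]
    [NormedAlgebra ℚ_[p] K] (x : K) : x ∈ ringOfIntegers p K ↔ ‖x‖ ≤ 1 := by
  have := isUltrametricDist p K
  exact (Valuation.mem_valuationSubring_iff _ _)

section Curve

variable {K : Type*} [NormedField K]

open Classical in
/-- The normalized valuation `v_K` with respect to a uniformizer `π`: the integer `k` such that
`x = π ^ k * u` with `‖u‖ = 1` (and the value `0` at `x = 0`). -/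
def valK (π x : K) : ℤ :=
  if h : ∃ k : ℤ, ‖x‖ = ‖π‖ ^ k then h.choose else 0

open Classical in
/-- The normalized absolute value `|x|_K = p ^ (-f * v_K x)`, `|0|_K = 0`. -/
def absK (p f : ℕ) (π x : K) : ℝ :=
  if x = 0 then 0 else (p : ℝ) ^ (-((f : ℤ) * valK π x))

/-- The fundamental domain `E = ⋃_{s < m} π ^ s 𝒪_K^×` of the Tate curve `K^× / π^{mℤ}`. -/
def domainE (p : ℕ) [Fact p.Prime] [NormedAlgebra ℚ_[p] K] (π : K) (m : ℕ) : Set K :=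
  {x | ∃ s : ℕ, s < m ∧ ∃ u : (ringOfIntegers p K)ˣ, x = π ^ s * ((u : ringOfIntegers p K) : K)}

/-- `d(x,y) = |x - y|_K / max {|x|_K, |y|_K}`. -/
def dist01 (p f : ℕ) (π x y : K) : ℝ :=
  absK p f π (x - y) / max (absK p f π x) (absK p f π y)

/-- `U_K(y) = p^{-f v_K(y)} + p^{-f (m - 1 - v_K(y))}`. -/
def UK (p f : ℕ) (π : K) (m : ℕ) (y : K) : ℝ :=
  (p : ℝ) ^ (-((f : ℤ) * valK π y)) + (p : ℝ) ^ (-((f : ℤ) * ((m : ℤ) - 1 - valK π y)))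

/-- The coefficient `λ_n(y)`, `n ≥ 1`, attached to the constant `λ₀ = lam0`. -/
def lambdaK (p f : ℕ) (π : K) (m : ℕ) (lam0 : ℝ) (n : ℕ) (y : K) : ℝ :=
  UK p f π m y ^ n *
    (((p : ℝ) ^ (f * (n + 1)) - 1) /
      (((p : ℝ) ^ f - 1) * ((p : ℝ) ^ f + 1) ^ n * ((p : ℝ) ^ (f * n) - 1))) * lam0

/-- `A(y) + λ₀ log_{p^f} d(x,y) + ∑_{n ≥ 1} λ_n(y) d(x,y)^n`. -/
def logSeries (p f : ℕ) (π : K) (lam0 : ℝ) (A : K → ℝ) (lam : ℕ → K → ℝ) (x y : K) : ℝ :=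
  A y + lam0 * Real.logb ((p : ℝ) ^ f) (dist01 p f π x y) +
    ∑' n : ℕ, lam (n + 1) y * dist01 p f π x y ^ (n + 1)

/-- `B_{K,m}` for a given `λ₀`: the logarithmic series with coefficients `λ_n = lambdaK` and
`A(y) = -∑_{n ≥ 1} λ_n(y)`. -/
def BKm (p f : ℕ) (π : K) (m : ℕ) (lam0 : ℝ) (x y : K) : ℝ :=
  logSeries p f π lam0 (fun y => -∑' n : ℕ, lambdaK p f π m lam0 (n + 1) y)
    (lambdaK p f π m lam0) x y

/-- The integrand `z ↦ (φ z - φ x) / |z - x|_K ^ 2 * |x|_K` in the definition of `D φ x`. -/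
def lapIntegrand (p f : ℕ) (π : K) (φ : K → ℝ) (x z : K) : ℝ :=
  (φ z - φ x) / absK p f π (z - x) ^ 2 * absK p f π x

/-- The Laplacian `D φ x = ∫_E (φ z - φ x) / |z - x|_K ^ 2 * |x|_K dz`. -/
def lap (p f : ℕ) [Fact p.Prime] [NormedAlgebra ℚ_[p] K] [MeasurableSpace K] (μ : Measure K)
    (π : K) (m : ℕ) (φ : K → ℝ) (x : K) : ℝ :=
  ∫ z in domainE p π m, lapIntegrand p f π φ x z ∂μ

/-- The multiplicative measure `dx / |x|_K`. -/
def mulMeasure (p f : ℕ) [MeasurableSpace K] (μ : Measure K) (π : K) : Measure K :=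
  μ.withDensity (fun x => ENNReal.ofReal (absK p f π x)⁻¹)

/-- The volume `V` of the Tate curve for `dx / |x|_K`. -/
def vol (p f : ℕ) [Fact p.Prime] [NormedAlgebra ℚ_[p] K] [MeasurableSpace K] (μ : Measure K)
    (π : K) (m : ℕ) : ℝ :=
  (mulMeasure p f μ π (domainE p π m)).toReal

/-- `G` is a symmetric Green's function of `D`: `D G(·,y) = δ_y - 1/V` in the sense of
distributions, tested against locally constant functions, for the pairing
`⟨g, h⟩ = ∫_E g h dx / |x|_K` (for which `D` is self-adjoint). The values of `G` on the diagonal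
are irrelevant. -/
structure IsSymmGreen (p f : ℕ) [Fact p.Prime] [NormedAlgebra ℚ_[p] K] [MeasurableSpace K]
    (μ : Measure K) (π : K) (m : ℕ) (G : K → K → ℝ) : Prop where
  symm : ∀ x ∈ domainE p π m, ∀ y ∈ domainE p π m, G x y = G y x
  continuousOn : ∀ y ∈ domainE p π m, ContinuousOn (fun x => G x y) (domainE p π m \ {y})
  integrableOn : ∀ y ∈ domainE p π m,
    IntegrableOn (fun x => G x y) (domainE p π m) (mulMeasure p f μ π)
  green : ∀ y ∈ domainE p π m, ∀ φ : K → ℝ,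
    IsLocallyConstant (fun x : domainE p π m => φ x) →
      ∫ x in domainE p π m, G x y * lap p f μ π m φ x ∂(mulMeasure p f μ π) =
        φ y - 1 / vol p f μ π m * ∫ x in domainE p π m, φ x ∂(mulMeasure p f μ π)

end Curve

/-- `Λ_q = 1 + p^{-f} - p^{-f (q+1)} - p^{-f (m-q)}`. -/
def Lam (p f m : ℕ) (q : ℤ) : ℝ :=
  1 + (p : ℝ) ^ (-(f : ℤ)) - (p : ℝ) ^ (-((f : ℤ) * (q + 1))) -
    (p : ℝ) ^ (-((f : ℤ) * ((m : ℤ) - q)))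

/-- The recurrence formulas for the array `C q r`, `0 ≤ q, r ≤ m - 1`. -/
structure IsRecurrent (p f m : ℕ) (C : ℤ → ℤ → ℝ) : Prop where
  step_last : 2 ≤ m →
    C ((m : ℤ) - 2) 0 = C ((m : ℤ) - 1) 0 - (p : ℝ) ^ f / (m * Lam p f m ((m : ℤ) - 2))
  step : ∀ q : ℤ, 0 ≤ q → q < (m : ℤ) - 2 →
    C q 0 = (Lam p f m q + Lam p f m (q + 2)) / Lam p f m q * C (q + 1) 0 -
      Lam p f m (q + 2) / Lam p f m q * C (q + 2) 0 - ((p : ℝ) ^ f - 1) / (m * Lam p f m q)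
  lower : ∀ q r : ℤ, 0 ≤ r → r ≤ q → q ≤ (m : ℤ) - 1 →
    C q r = C q 0 + C ((m : ℤ) - 1 - r) 0 - C ((m : ℤ) - 1) 0
  upper : ∀ q r : ℤ, 0 ≤ q → q ≤ r → r ≤ (m : ℤ) - 1 →
    C q r = C ((m : ℤ) - 1 - q) 0 + C r 0 - C ((m : ℤ) - 1) 0

end TateGreen

end

/-! Write q = p^f and d(x,y) = q^(-k). The ultrametric inequality turns every integral here into a
sum over spheres, so the analysis becomes algebra of sequences and of finite arrays. A point closer
to y than x is sees x at the fixed distance |x - y|. Hence D of a function of d(·,y) is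
q^(-|v(x)-v(y)|) times an explicit operator `seqLap` in k (`lap_eq_seqLap`). This operator is
triangular: up to additive constants it sends log d to (U/q) log d, and d^n to (U/q) d^n minus a
nonzero multiple of d^(n-1), with log d in place of d^0 when n = 1 (`monoLap_zero_sub`,
`monoLap_succ_sub`). So D F loses its dependence on d exactly when the λ_n obey a two-term
recursion, solved by `lamSeq`; necessity is a uniqueness statement for power series in q^(-k)
(`coeff_eq_zero_of_const`). Summability holds because q + 1 - U is q - 1 times a positive kernel sum
(`UK_eq_kerSum`). The constant value of `seqLap` is found at k = 0, where the series is geometric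
(`seqLap_lamSeq`). On functions of the valuation, D is, up to a factor, convolution with q^(-|j-a|)
minus multiplication by the row sums (`lap_comp_valK`). The kernel is symmetric, so the result sums
to zero over a column, which forces λ₀ (`lam0_eq`). The kernel is also a fundamental solution of a
second difference operator; applying that operator turns the nonlocal equation for a column into
three-term recurrences on either side of the diagonal. Conversely, these recurrences leave an error
proportional to q^(-|a-r|), and the zero sum kills it (`columnEq_iff`). The recurrences involve r
only through their range, so every column is assembled from the first one, and symmetry fixes the
additive constants (`symm_columnEq_iff`). For the distribution equation, a locally constant test
function allows the kernel to be truncated near the diagonal; the truncated kernel is bounded and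
symmetric, so Fubini moves D onto G (`integral_mul_lap`, `green_of_lap`). For uniqueness, averaging
B + C over a ball around its pole gives a test function whose Laplacian is the normalized indicator
of the ball minus 1/V (`exists_lap_eq_indicator`). Testing with it shows that the difference of two
Green's functions equals its mean (`sub_eq_mean`), and symmetry makes that mean independent of the
pole. -/

namespace TateGreen

/-! ### Discreteness of the norm and the Haar measure of balls -/

section Foundations

variable {p : ℕ} [Fact p.Prime] {K : Type*} [NormedField K] [NormedAlgebra ℚ_[p] K]

theorem isUnit_iff_norm_eq_one (x : ringOfIntegers p K) : IsUnit x ↔ ‖(x : K)‖ = 1 := by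
  constructor
  · rintro ⟨u, rfl⟩
    have h1 : ‖((u : ringOfIntegers p K) : K)‖ ≤ 1 := (mem_ringOfIntegers p K _).1 (Subtype.mem _)
    have h2 : ‖((u⁻¹ : (ringOfIntegers p K)ˣ) : K)‖ ≤ 1 :=
      (mem_ringOfIntegers p K _).1 (Subtype.mem _)
    have h3 : ((u : ringOfIntegers p K) : K) * ((u⁻¹ : (ringOfIntegers p K)ˣ) : K) = 1 := by
      rw [← MulMemClass.coe_mul, Units.mul_inv, OneMemClass.coe_one]
    have h4 := congrArg norm h3
    rw [norm_mul, norm_one] at h4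
    nlinarith [norm_nonneg ((u : ringOfIntegers p K) : K)]
  · intro h
    have hx : (x : K) ≠ 0 := by
      intro h0
      rw [h0, norm_zero] at h
      exact zero_ne_one h
    refine IsUnit.of_mul_eq_one (⟨(x : K)⁻¹, (mem_ringOfIntegers p K _).2 ?_⟩) ?_
    · rw [norm_inv, h, inv_one]
    · ext
      simp [hx]

theorem norm_pos_of_irreducible {ϖ : ringOfIntegers p K} (hϖ : Irreducible ϖ) :
    0 < ‖(ϖ : K)‖ := by
  rw [norm_pos_iff]
  exact fun h => hϖ.ne_zero (Subtype.ext h)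

theorem norm_lt_one_of_irreducible {ϖ : ringOfIntegers p K} (hϖ : Irreducible ϖ) :
    ‖(ϖ : K)‖ < 1 :=
  lt_of_le_of_ne ((mem_ringOfIntegers p K _).1 ϖ.2)
    fun h => hϖ.not_isUnit ((isUnit_iff_norm_eq_one _).2 h)

/-- An element with norm strictly between ‖ϖ‖ and 1 would factor ϖ as x * (ϖ / x) with neither
factor a unit. Irreducibility alone thus produces the gap in the value group. -/
theorem norm_le_of_irreducible {ϖ : ringOfIntegers p K} (hϖ : Irreducible ϖ) {x : K}
    (hx : ‖x‖ < 1) : ‖x‖ ≤ ‖(ϖ : K)‖ := by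
  by_contra! h
  have hx0 : x ≠ 0 := norm_pos_iff.1 ((norm_nonneg _).trans_lt h)
  have hq : ‖(ϖ : K) / x‖ < 1 := by
    rw [norm_div, div_lt_one (norm_pos_iff.2 hx0)]
    exact h
  have hmul : ϖ = (⟨x, (mem_ringOfIntegers p K _).2 hx.le⟩ : ringOfIntegers p K) *
      ⟨(ϖ : K) / x, (mem_ringOfIntegers p K _).2 hq.le⟩ := by
    ext
    simp [mul_div_cancel₀ _ hx0]
  rcases hϖ.isUnit_or_isUnit hmul with h1 | h1
  · exact hx.ne ((isUnit_iff_norm_eq_one _).1 h1)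
  · exact hq.ne ((isUnit_iff_norm_eq_one _).1 h1)

/-- Scaling by a power of ϖ brings the norm into [1, ‖ϖ‖⁻¹). The inverse then has norm in (‖ϖ‖, 1],
and the gap below 1 leaves only the value 1. -/
theorem exists_norm_eq_zpow {ϖ : ringOfIntegers p K} (hϖ : Irreducible ϖ) {x : K} (hx : x ≠ 0) :
    ∃ k : ℤ, ‖x‖ = ‖(ϖ : K)‖ ^ k := by
  have h0 := norm_pos_of_irreducible hϖ
  have h1 := norm_lt_one_of_irreducible hϖ
  obtain ⟨n, hn1, hn2⟩ := exists_mem_Ico_zpow (norm_pos_iff.2 hx) ((one_lt_inv₀ h0).2 h1)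
  refine ⟨-n, ?_⟩
  rw [inv_zpow'] at hn1 hn2
  have hpos : 0 < ‖(ϖ : K)‖ ^ (-n) := zpow_pos h0 _
  have hle : ‖x / (ϖ : K) ^ (-n)‖ ≥ 1 := by
    rw [norm_div, norm_zpow, ge_iff_le, one_le_div hpos]
    exact hn1
  have hgt : ‖(x / (ϖ : K) ^ (-n))⁻¹‖ > ‖(ϖ : K)‖ := by
    rw [norm_inv, norm_div, norm_zpow, inv_div, gt_iff_lt, lt_div_iff₀ (norm_pos_iff.2 hx)]
    calc ‖(ϖ : K)‖ * ‖x‖ < ‖(ϖ : K)‖ * ‖(ϖ : K)‖ ^ (-(n + 1)) := by gcongr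
      _ = ‖(ϖ : K)‖ ^ (-n) := by
        rw [← zpow_one_add₀ h0.ne']
        congr 1
        ring
  have hnot : ¬ ‖(x / (ϖ : K) ^ (-n))⁻¹‖ < 1 :=
    fun h => (norm_le_of_irreducible hϖ h).not_gt hgt
  rw [norm_inv, not_lt, one_le_inv₀ (by linarith)] at hnot
  have heq := le_antisymm hnot hle
  rw [norm_div, norm_zpow, div_eq_one_iff_eq hpos.ne'] at heq
  exact heq

theorem residue_eq_iff (x y : ringOfIntegers p K) :
    IsLocalRing.residue (ringOfIntegers p K) x = IsLocalRing.residue (ringOfIntegers p K) y ↔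
      ‖(x : K) - y‖ < 1 := by
  rw [← sub_eq_zero, ← map_sub, IsLocalRing.residue_eq_zero_iff, IsLocalRing.mem_maximalIdeal,
    mem_nonunits_iff, isUnit_iff_norm_eq_one]
  have h : ‖((x - y : ringOfIntegers p K) : K)‖ ≤ 1 := (mem_ringOfIntegers p K _).1 (Subtype.mem _)
  rw [← ne_eq, ← lt_iff_le_and_ne.trans (and_iff_right h)]
  rfl

open Metric in
-- Representatives of the residue classes, scaled by ϖ^k, cut the ball into n disjoint translates of
-- the next smaller ball.
theorem measure_closedBall_succ [MeasurableSpace K] [BorelSpace K] (μ : Measure K)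
    [μ.IsAddHaarMeasure] {n : ℕ} (hn0 : n ≠ 0)
    (hn : Nat.card (IsLocalRing.ResidueField (ringOfIntegers p K)) = n)
    {ϖ : ringOfIntegers p K} (hϖ : Irreducible ϖ) (k : ℤ) :
    μ (closedBall 0 (‖(ϖ : K)‖ ^ k)) = n * μ (closedBall 0 (‖(ϖ : K)‖ ^ (k + 1))) := by
  have := isUltrametricDist p K
  set r := ‖(ϖ : K)‖ with hr
  have h0 : 0 < r := norm_pos_of_irreducible hϖ
  have hne : (ϖ : K) ≠ 0 := norm_pos_iff.1 h0
  -- `Nat.card` of an infinite type is 0, so a nonzero cardinality already gives finiteness.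
  have hfin : Finite (IsLocalRing.ResidueField (ringOfIntegers p K)) :=
    Nat.finite_of_card_ne_zero (hn ▸ hn0)
  have := Fintype.ofFinite (IsLocalRing.ResidueField (ringOfIntegers p K))
  choose g hg using IsLocalRing.residue_surjective (R := ringOfIntegers p K)
  have hcover : closedBall (0 : K) (r ^ k) =
      ⋃ a, closedBall ((ϖ : K) ^ k * g a) (r ^ (k + 1)) := by
    ext x
    simp only [Set.mem_iUnion, mem_closedBall, dist_eq_norm, sub_zero]
    constructor
    · intro hx
      have hx1 : ‖x / (ϖ : K) ^ k‖ ≤ 1 := by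
        rw [norm_div, norm_zpow, div_le_one (zpow_pos h0 _)]
        exact hx
      refine ⟨IsLocalRing.residue _ ⟨x / (ϖ : K) ^ k, (mem_ringOfIntegers p K _).2 hx1⟩, ?_⟩
      set a := IsLocalRing.residue (ringOfIntegers p K)
        ⟨x / (ϖ : K) ^ k, (mem_ringOfIntegers p K _).2 hx1⟩ with ha
      have h1 := norm_le_of_irreducible hϖ ((residue_eq_iff _ _).1 (ha.symm.trans (hg a).symm))
      have h2 : x - (ϖ : K) ^ k * g a = (ϖ : K) ^ k * (x / (ϖ : K) ^ k - g a) := by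
        field_simp
      rw [h2, norm_mul, norm_zpow, zpow_add_one₀ h0.ne']
      gcongr
    · rintro ⟨a, ha⟩
      have h1 : ‖(ϖ : K) ^ k * g a‖ ≤ r ^ k := by
        rw [norm_mul, norm_zpow]
        exact mul_le_of_le_one_right (zpow_pos h0 _).le ((mem_ringOfIntegers p K _).1 (g a).2)
      have h2 : r ^ (k + 1) ≤ r ^ k := by
        rw [zpow_add_one₀ h0.ne']
        exact mul_le_of_le_one_right (zpow_pos h0 _).le (norm_lt_one_of_irreducible hϖ).le
      have h3 : x = (x - (ϖ : K) ^ k * g a) + (ϖ : K) ^ k * g a := by ring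
      rw [h3]
      exact (IsUltrametricDist.norm_add_le_max _ _).trans (max_le (ha.trans h2) h1)
  have hdisj : Pairwise (Function.onFun Disjoint
      fun a => closedBall ((ϖ : K) ^ k * (g a : K)) (r ^ (k + 1))) := by
    intro a b hab
    rw [Function.onFun, Set.disjoint_left]
    intro x hxa hxb
    apply hab
    rw [← hg a, ← hg b, residue_eq_iff]
    have h1 : ‖(ϖ : K) ^ k * ((g a : K) - g b)‖ ≤ r ^ (k + 1) := by
      have h2 : (ϖ : K) ^ k * ((g a : K) - g b) =
          (x - (ϖ : K) ^ k * g b) - (x - (ϖ : K) ^ k * g a) := by ring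
      rw [mem_closedBall, dist_eq_norm] at hxa hxb
      rw [h2, sub_eq_add_neg]
      refine (IsUltrametricDist.norm_add_le_max _ _).trans (max_le hxb ?_)
      rwa [norm_neg]
    rw [norm_mul, norm_zpow, zpow_add_one₀ h0.ne', ← hr, mul_le_mul_iff_right₀ (zpow_pos h0 _)] at h1
    exact h1.trans_lt (norm_lt_one_of_irreducible hϖ)
  rw [hcover, measure_iUnion hdisj fun a => measurableSet_closedBall, tsum_fintype]
  have htrans : ∀ a, μ (closedBall ((ϖ : K) ^ k * (g a : K)) (r ^ (k + 1))) =
      μ (closedBall 0 (r ^ (k + 1))) := by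
    intro a
    rw [← measure_preimage_add_right μ (-((ϖ : K) ^ k * (g a : K))) (closedBall 0 (r ^ (k + 1)))]
    congr 1
    ext x
    simp [dist_eq_norm, sub_eq_add_neg]
  rw [Finset.sum_congr rfl fun a _ => htrans a]
  simp [← hn, Nat.card_eq_fintype_card]

end Foundations

/-! ### Valuation, absolute value and measure of a local field -/

theorem valK_sub_comm {K : Type*} [NormedField K] (π x y : K) :
    valK π (x - y) = valK π (y - x) := by
  unfold valK
  rw [norm_sub_rev x y]

/-- The normalized valuation, absolute value and Haar measure of a local field whose residue
field has `q = p ^ f` elements, with respect to the uniformizer `π`. -/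
structure LocalField (p f : ℕ) {K : Type*} [NormedField K] [MeasurableSpace K] (π : K)
    (μ : Measure K) (q : ℝ) : Prop where
  ultra : IsUltrametricDist K
  q_eq : (p : ℝ) ^ f = q
  two_le : 2 ≤ q
  pi_pos : 0 < ‖π‖
  pi_lt : ‖π‖ < 1
  norm_eq : ∀ x : K, x ≠ 0 → ‖x‖ = ‖π‖ ^ valK π x
  measure_closedBall : ∀ (c : K) (k : ℤ),
    μ (Metric.closedBall c (‖π‖ ^ k)) = ENNReal.ofReal (q ^ (-k))

open Metric in
-- The unit ball has measure 1 and consecutive radii scale by q, so induction in both directions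
-- gives all balls around 0; translation gives the other centres. The analysis of D rests on the
-- resulting structure.
theorem localField_of_irreducible (p : ℕ) [Fact p.Prime] (K : Type*) [NormedField K]
    [NormedAlgebra ℚ_[p] K] [MeasurableSpace K] [BorelSpace K]
    (f : ℕ) (hf : Nat.card (IsLocalRing.ResidueField (ringOfIntegers p K)) = p ^ f)
    (ϖ : ringOfIntegers p K) (hϖ : Irreducible ϖ)
    (μ : Measure K) [μ.IsAddHaarMeasure] (hμ : μ (ringOfIntegers p K : Set K) = 1) :
    LocalField p f (ϖ : K) μ ((p : ℝ) ^ f) := by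
  have hp : p ≠ 0 := (Fact.out : p.Prime).ne_zero
  have hn0 : p ^ f ≠ 0 := pow_ne_zero _ hp
  have h0 := norm_pos_of_irreducible hϖ
  have hq0 : (0 : ℝ) < (p : ℝ) ^ f := by positivity
  have hfin : Finite (IsLocalRing.ResidueField (ringOfIntegers p K)) :=
    Nat.finite_of_card_ne_zero (hf ▸ hn0)
  -- A field has at least two elements, which rules out f = 0.
  have htwo : 2 ≤ p ^ f := hf ▸ (Finite.one_lt_card : 1 < Nat.card (IsLocalRing.ResidueField _))
  have hball : ∀ k : ℤ, μ (closedBall 0 (‖(ϖ : K)‖ ^ k)) =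
      ENNReal.ofReal (((p : ℝ) ^ f) ^ (-k)) := by
    have hstep : ∀ k : ℤ, μ (closedBall 0 (‖(ϖ : K)‖ ^ k)) =
        ENNReal.ofReal ((p : ℝ) ^ f) * μ (closedBall 0 (‖(ϖ : K)‖ ^ (k + 1))) := by
      intro k
      rw [measure_closedBall_succ μ hn0 hf hϖ k]
      congr 1
      rw [← Nat.cast_pow, ENNReal.ofReal_natCast]
    have hone : μ (closedBall 0 (‖(ϖ : K)‖ ^ (0 : ℤ))) = 1 := by
      rw [← hμ]
      congr 1
      ext x
      simp [mem_ringOfIntegers]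
    intro k
    induction k using Int.induction_on with
    | zero => simpa using hone
    | succ i ih =>
      have h := hstep i
      rw [ih] at h
      have h1 : ENNReal.ofReal ((p : ℝ) ^ f) ≠ 0 := (ENNReal.ofReal_pos.2 hq0).ne'
      rw [← ENNReal.mul_right_inj h1 ENNReal.ofReal_ne_top, ← h, ← ENNReal.ofReal_mul hq0.le,
        ← zpow_one_add₀ hq0.ne']
      congr 2
      ring
    | pred i ih =>
      rw [hstep, sub_add_cancel, ih, ← ENNReal.ofReal_mul hq0.le, ← zpow_one_add₀ hq0.ne']
      congr 2
      ring
  refine ⟨isUltrametricDist p K, rfl, by exact_mod_cast htwo, h0, norm_lt_one_of_irreducible hϖ,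
    fun x hx => ?_, fun c k => ?_⟩
  · have h := exists_norm_eq_zpow hϖ hx
    rw [valK, dif_pos h]
    exact h.choose_spec
  · rw [← hball, ← measure_preimage_add_right μ (-c) (closedBall 0 (‖(ϖ : K)‖ ^ k))]
    congr 1
    ext x
    simp [dist_eq_norm, sub_eq_add_neg]

namespace LocalField

variable {p f : ℕ} {K : Type*} [NormedField K] [MeasurableSpace K] {π : K} {μ : Measure K} {q : ℝ}

theorem q_pos (L : LocalField p f π μ q) : 0 < q := by linarith [L.two_le]

theorem one_lt_q (L : LocalField p f π μ q) : 1 < q := by linarith [L.two_le]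

theorem norm_le_iff (L : LocalField p f π μ q) {x : K} (hx : x ≠ 0) (k : ℤ) :
    ‖x‖ ≤ ‖π‖ ^ k ↔ k ≤ valK π x := by
  rw [L.norm_eq x hx, zpow_le_zpow_iff_right_of_lt_one₀ L.pi_pos L.pi_lt]

theorem valK_eq_of_norm (L : LocalField p f π μ q) {x : K} {k : ℤ} (h : ‖x‖ = ‖π‖ ^ k) :
    valK π x = k := by
  have hx : x ≠ 0 := norm_pos_iff.1 (h ▸ zpow_pos L.pi_pos k)
  rw [L.norm_eq x hx] at h
  exact zpow_right_injective₀ L.pi_pos L.pi_lt.ne h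

theorem valK_congr (L : LocalField p f π μ q) {x y : K} (hx : x ≠ 0) (h : ‖x‖ = ‖y‖) :
    valK π x = valK π y :=
  (L.valK_eq_of_norm (h ▸ L.norm_eq x hx)).symm

theorem absK_of_ne (L : LocalField p f π μ q) {x : K} (hx : x ≠ 0) :
    absK p f π x = q ^ (-valK π x) := by
  rw [absK, if_neg hx, ← L.q_eq, ← zpow_natCast (p : ℝ) f, ← zpow_mul, mul_neg]

theorem absK_nonneg (L : LocalField p f π μ q) (x : K) : 0 ≤ absK p f π x := by
  by_cases hx : x = 0
  · simp [absK, hx]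
  · rw [L.absK_of_ne hx]
    exact (zpow_pos L.q_pos _).le

/-- The strong triangle inequality in terms of valuations. -/
theorem le_valK_add (L : LocalField p f π μ q) {x y : K} {k : ℤ} (hxy : x + y ≠ 0)
    (hx : x ≠ 0 → k ≤ valK π x) (hy : y ≠ 0 → k ≤ valK π y) : k ≤ valK π (x + y) := by
  have := L.ultra
  rw [← L.norm_le_iff hxy]
  refine (IsUltrametricDist.norm_add_le_max x y).trans (max_le ?_ ?_)
  · by_cases h : x = 0
    · rw [h, norm_zero]
      exact (zpow_pos L.pi_pos k).le
    · exact (L.norm_le_iff h k).2 (hx h)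
  · by_cases h : y = 0
    · rw [h, norm_zero]
      exact (zpow_pos L.pi_pos k).le
    · exact (L.norm_le_iff h k).2 (hy h)

/-- The sum of two elements of different valuations. -/
theorem valK_add_eq (L : LocalField p f π μ q) {x y : K} (hx : x ≠ 0)
    (h : y ≠ 0 → valK π x < valK π y) : x + y ≠ 0 ∧ valK π (x + y) = valK π x := by
  have := L.ultra
  have hlt : ‖y‖ < ‖x‖ := by
    by_cases hy : y = 0
    · rw [hy, norm_zero]
      exact norm_pos_iff.2 hx
    · rw [L.norm_eq x hx, L.norm_eq y hy, zpow_lt_zpow_iff_right_of_lt_one₀ L.pi_pos L.pi_lt]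
      exact h hy
  have hn : ‖x + y‖ = ‖x‖ := by
    rw [IsUltrametricDist.norm_add_eq_max_of_norm_ne_norm hlt.ne', max_eq_left hlt.le]
  exact ⟨norm_pos_iff.1 (hn ▸ norm_pos_iff.2 hx), (L.valK_congr hx hn.symm).symm⟩

theorem mem_domainE [Fact p.Prime] [NormedAlgebra ℚ_[p] K] (L : LocalField p f π μ q) {m : ℕ}
    {x : K} : x ∈ domainE p π m ↔ x ≠ 0 ∧ 0 ≤ valK π x ∧ valK π x < m := by
  have hπ : π ≠ 0 := norm_pos_iff.1 L.pi_pos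
  constructor
  · rintro ⟨s, hs, u, rfl⟩
    have h1 := (isUnit_iff_norm_eq_one (u : ringOfIntegers p K)).1 u.isUnit
    have h2 : valK π (π ^ s * ((u : ringOfIntegers p K) : K)) = s := by
      apply L.valK_eq_of_norm
      rw [norm_mul, h1, norm_pow, mul_one, zpow_natCast]
    refine ⟨mul_ne_zero (pow_ne_zero _ hπ) ?_, by rw [h2]; positivity, by rw [h2]; exact_mod_cast hs⟩
    exact norm_pos_iff.1 (h1 ▸ one_pos)
  · rintro ⟨hx, h1, h2⟩
    have hnorm := L.norm_eq x hx
    lift valK π x to ℕ using h1 with s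
    have hu : ‖x / π ^ s‖ = 1 := by
      rw [norm_div, norm_pow, hnorm, zpow_natCast, div_self (pow_pos L.pi_pos _).ne']
    obtain ⟨u, hu'⟩ := (isUnit_iff_norm_eq_one
      (⟨x / π ^ s, (mem_ringOfIntegers p K _).2 hu.le⟩ : ringOfIntegers p K)).2 hu
    refine ⟨s, by exact_mod_cast h2, u, ?_⟩
    rw [hu']
    field_simp

end LocalField

end TateGreen

/-! ### Spheres, the relative valuation and radial integrals -/

namespace TateGreen

/-- This is the exponent of |x| / |z - x|² when v(z) = j, v(x) = a and v(z - x) = min j a. The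
volume of the sphere of valuation j absorbs q^j, which leaves the kernel q^(-|j-a|). -/
theorem two_mul_min_sub (j a : ℤ) : 2 * min j a - a = j - |j - a| := by
  rcases le_total j a with h | h
  · rw [min_eq_left h, abs_of_nonpos (by lia)]; ring
  · rw [min_eq_right h, abs_of_nonneg (by lia)]; ring

theorem integral_of_const_on_pieces {X ι : Type*} [MeasurableSpace X] {μ : Measure X}
    (t : Finset ι) (P : ι → Set X) (hm : ∀ i ∈ t, MeasurableSet (P i))
    (hd : Set.Pairwise (↑t) (Function.onFun Disjoint P)) (hfin : ∀ i ∈ t, μ (P i) ≠ ⊤)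
    (g : X → ℝ) (c : ι → ℝ) (hg : ∀ i ∈ t, ∀ z ∈ P i, g z = c i) :
    IntegrableOn g (⋃ i ∈ t, P i) μ ∧ ∫ z in ⋃ i ∈ t, P i, g z ∂μ = ∑ i ∈ t, c i * μ.real (P i) := by
  have hint : ∀ i ∈ t, IntegrableOn g (P i) μ := fun i hi =>
    (integrableOn_congr_fun (hg i hi) (hm i hi)).2 (integrableOn_const (hfin i hi))
  refine ⟨integrableOn_finset_iUnion.2 hint, ?_⟩
  rw [integral_biUnion_finset t hm hd hint]
  refine Finset.sum_congr rfl fun i hi => ?_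
  rw [setIntegral_congr_fun (hm i hi) (hg i hi), setIntegral_const, smul_eq_mul, mul_comm]

/-- The sphere of points `z` with `v_K (z - c) = j`. -/
def shell {K : Type*} [NormedField K] (π c : K) (j : ℤ) : Set K :=
  {z | z ≠ c ∧ valK π (z - c) = j}

theorem disjoint_shell {K : Type*} [NormedField K] (π c : K) {i j : ℤ} (h : i ≠ j) :
    Disjoint (shell π c i) (shell π c j) :=
  Set.disjoint_left.2 fun _ hi hj => h (hi.2.symm.trans hj.2)

/-- The exponent `l` in `d(x,y) = q ^ (-l)`. -/
noncomputable def relVal {K : Type*} [NormedField K] (π x y : K) : ℕ := (valK π (x - y) - valK π y).toNat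

/-- The kernel sum `∑_{j < m} q ^ (-|j - s|)`. -/
noncomputable def kerSum (q : ℝ) (m : ℕ) (s : ℤ) : ℝ := ∑ j ∈ Finset.range m, q ^ (-|(j : ℤ) - s|)

theorem lapIntegrand_eq_zero {p f : ℕ} {K : Type*} [NormedField K] {π : K} (φ : K → ℝ) {x z : K}
    (h : φ z = φ x) : lapIntegrand p f π φ x z = 0 := by
  simp [lapIntegrand, h]

namespace LocalField

open Metric

variable {p f : ℕ} {K : Type*} [NormedField K] [MeasurableSpace K] {π : K} {μ : Measure K} {q : ℝ}

theorem mem_closedBall_iff (L : LocalField p f π μ q) {z c : K} (hz : z ≠ c) (k : ℤ) :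
    z ∈ closedBall c (‖π‖ ^ k) ↔ k ≤ valK π (z - c) := by
  rw [mem_closedBall, dist_eq_norm, L.norm_le_iff (sub_ne_zero.2 hz)]

theorem shell_eq (L : LocalField p f π μ q) (c : K) (j : ℤ) :
    shell π c j = closedBall c (‖π‖ ^ j) \ closedBall c (‖π‖ ^ (j + 1)) := by
  ext z
  by_cases hz : z = c
  · have := (zpow_pos L.pi_pos (j + 1)).le
    simp [shell, hz, this]
  · simp only [shell, Set.mem_ofPred_eq, Set.mem_sdiff, L.mem_closedBall_iff hz, hz, ne_eq,
      not_false_eq_true, true_and]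
    lia

theorem measurableSet_shell [BorelSpace K] (L : LocalField p f π μ q) (c : K) (j : ℤ) :
    MeasurableSet (shell π c j) := by
  rw [L.shell_eq]
  exact measurableSet_closedBall.diff measurableSet_closedBall

theorem measureReal_closedBall (L : LocalField p f π μ q) (c : K) (k : ℤ) :
    μ.real (closedBall c (‖π‖ ^ k)) = q ^ (-k) := by
  rw [measureReal_def, L.measure_closedBall, ENNReal.toReal_ofReal (zpow_pos L.q_pos _).le]

theorem measure_closedBall_ne_top (L : LocalField p f π μ q) (c : K) (k : ℤ) :
    μ (closedBall c (‖π‖ ^ k)) ≠ ⊤ := by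
  rw [L.measure_closedBall]
  exact ENNReal.ofReal_ne_top

theorem closedBall_subset (L : LocalField p f π μ q) (c : K) {j k : ℤ} (h : j ≤ k) :
    closedBall c (‖π‖ ^ k) ⊆ closedBall c (‖π‖ ^ j) :=
  closedBall_subset_closedBall ((zpow_le_zpow_iff_right_of_lt_one₀ L.pi_pos L.pi_lt).2 h)

theorem measure_shell_ne_top (L : LocalField p f π μ q) (c : K) (j : ℤ) :
    μ (shell π c j) ≠ ⊤ := by
  rw [L.shell_eq]
  exact measure_ne_top_of_subset Set.sdiff_subset (L.measure_closedBall_ne_top c j)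

theorem measureReal_shell [BorelSpace K] (L : LocalField p f π μ q) (c : K) (j : ℤ) :
    μ.real (shell π c j) = q ^ (-j) * (1 - q⁻¹) := by
  have hq := L.q_pos.ne'
  rw [L.shell_eq, measureReal_sdiff (L.closedBall_subset c (by lia)) measurableSet_closedBall
    (L.measure_closedBall_ne_top _ _), L.measureReal_closedBall, L.measureReal_closedBall, neg_add,
    zpow_add₀ hq, zpow_neg_one]
  ring

theorem measure_singleton (L : LocalField p f π μ q) (c : K) : μ {c} = 0 := by
  have h : ∀ n : ℕ, μ {c} ≤ ENNReal.ofReal ((q⁻¹) ^ n) := by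
    intro n
    have := L.measure_closedBall c n
    rw [zpow_neg, zpow_natCast q, ← inv_pow] at this
    rw [← this]
    exact measure_mono (Set.singleton_subset_iff.2 (mem_closedBall_self (zpow_pos L.pi_pos _).le))
  have hlim : Filter.Tendsto (fun n : ℕ => ENNReal.ofReal ((q⁻¹) ^ n)) Filter.atTop (nhds 0) := by
    rw [← ENNReal.ofReal_zero]
    exact ENNReal.tendsto_ofReal (tendsto_pow_atTop_nhds_zero_of_lt_one
      (inv_nonneg.2 L.q_pos.le) (inv_lt_one_of_one_lt₀ L.one_lt_q))
  exact le_antisymm (ge_of_tendsto' hlim h) zero_le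

/-- The integral of a radial function over a ball. -/
theorem integral_radial [BorelSpace K] (L : LocalField p f π μ q) (c : K) (k : ℤ) (g : K → ℝ)
    (F : ℕ → ℝ) (hF : Summable fun l => |F l| * (q ^ l)⁻¹)
    (hg : ∀ z, z ≠ c → k ≤ valK π (z - c) → g z = F (valK π (z - c) - k).toNat) :
    IntegrableOn g (closedBall c (‖π‖ ^ k)) μ ∧
      ∫ z in closedBall c (‖π‖ ^ k), g z ∂μ =
        q ^ (-k) * (1 - q⁻¹) * ∑' l, F l * (q ^ l)⁻¹ := by
  have hq := L.q_pos
  set P : ℕ → Set K := fun l => shell π c (k + l) with hP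
  have hm : ∀ l, MeasurableSet (P l) := fun l => L.measurableSet_shell c _
  have hd : Pairwise (Function.onFun Disjoint P) :=
    fun i j hij => disjoint_shell π c (by simpa using hij)
  have hU : (⋃ l, P l) = closedBall c (‖π‖ ^ k) \ {c} := by
    ext z
    by_cases hz : z = c
    · simp [hP, shell, hz]
    · simp only [hP, shell, Set.mem_iUnion, Set.mem_ofPred_eq, Set.mem_sdiff, Set.mem_singleton_iff,
        L.mem_closedBall_iff hz, hz, ne_eq, not_false_eq_true, true_and, and_true]
      constructor
      · rintro ⟨i, hi⟩
        lia
      · intro h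
        exact ⟨(valK π (z - c) - k).toNat, by lia⟩
  -- The spheres miss only the centre, which has measure zero.
  have hae : (⋃ l, P l) =ᵐ[μ] closedBall c (‖π‖ ^ k) := by
    rw [hU]
    exact sdiff_null_ae_eq_self (L.measure_singleton c)
  have hval : ∀ l, ∀ z ∈ P l, g z = F l := by
    rintro l z ⟨hz, hv⟩
    rw [hg z hz (by lia), hv]
    congr 1
    lia
  have hint : ∀ l, IntegrableOn g (P l) μ := fun l =>
    (integrableOn_congr_fun (hval l) (hm l)).2 (integrableOn_const (L.measure_shell_ne_top _ _))
  have hmeas : ∀ l, μ.real (P l) = q ^ (-k) * (1 - q⁻¹) * (q ^ l)⁻¹ := by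
    intro l
    rw [hP, L.measureReal_shell, neg_add, zpow_add₀ hq.ne', zpow_neg q (l : ℤ), zpow_natCast]
    ring
  have hIU : IntegrableOn g (⋃ l, P l) μ := by
    refine integrableOn_iUnion_of_summable_integral_norm hint ?_
    have : (fun l => ∫ z in P l, ‖g z‖ ∂μ) =
        fun l => q ^ (-k) * (1 - q⁻¹) * (|F l| * (q ^ l)⁻¹) := by
      funext l
      rw [setIntegral_congr_fun (g := fun _ => |F l|) (hm l) fun z hz => by
        simp only [hval l z hz, Real.norm_eq_abs], setIntegral_const, hmeas, smul_eq_mul]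
      ring
    rw [this]
    exact hF.mul_left _
  refine ⟨hIU.congr_set_ae hae.symm, ?_⟩
  rw [← setIntegral_congr_set hae, integral_iUnion hm hd hIU, ← tsum_mul_left]
  congr 1
  funext l
  rw [setIntegral_congr_fun (hm l) (hval l), setIntegral_const, hmeas, smul_eq_mul]
  ring

theorem lapIntegrand_eq (L : LocalField p f π μ q) (φ : K → ℝ) {x z : K} (hx : x ≠ 0)
    (hz : z ≠ x) :
    lapIntegrand p f π φ x z = (φ z - φ x) * q ^ (2 * valK π (z - x) - valK π x) := by
  have hq := L.q_pos.ne'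
  rw [lapIntegrand, L.absK_of_ne (sub_ne_zero.2 hz), L.absK_of_ne hx, sub_eq_add_neg (2 * _),
    zpow_add₀ hq, two_mul, zpow_add₀ hq, zpow_neg q (valK π (z - x))]
  field_simp

/-- If `v x < v (z - x)` then `v z = v x`. -/
theorem valK_of_lt (L : LocalField p f π μ q) {x z : K} (hx : x ≠ 0)
    (h : z ≠ x → valK π x < valK π (z - x)) : z ≠ 0 ∧ valK π z = valK π x := by
  have := L.valK_add_eq hx (y := z - x) fun h' => h (sub_ne_zero.1 h')
  simpa using this

/-- Isosceles principle: among the three differences the two largest have equal size. It makes the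
kernel constant on balls not containing the evaluation point. -/
theorem valK_sub_of_lt (L : LocalField p f π μ q) {x y z : K} (hxy : x ≠ y)
    (h : z ≠ y → valK π (x - y) < valK π (z - y)) :
    z ≠ x ∧ valK π (z - x) = valK π (x - y) := by
  have := L.valK_add_eq (x := y - x) (y := z - y) (sub_ne_zero.2 hxy.symm) fun h' => by
    rw [valK_sub_comm]
    exact h (sub_ne_zero.1 h')
  rw [show y - x + (z - y) = z - x by ring, valK_sub_comm π y x] at this
  exact ⟨sub_ne_zero.1 this.1, this.2⟩

theorem valK_sub_eq_min (L : LocalField p f π μ q) {x z : K} (hx : x ≠ 0) (hz : z ≠ 0)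
    (h : valK π z ≠ valK π x) : z ≠ x ∧ valK π (z - x) = min (valK π z) (valK π x) := by
  refine ⟨fun h' => h (h' ▸ rfl), ?_⟩
  rcases h.lt_or_gt with h | h
  · have := L.valK_sub_of_lt (x := z) (y := 0) (z := x) hz fun _ => by simpa using h
    rw [min_eq_left h.le, valK_sub_comm, this.2, sub_zero]
  · have := L.valK_sub_of_lt (x := x) (y := 0) (z := z) hx fun _ => by simpa using h
    rw [min_eq_right h.le, this.2, sub_zero]

theorem le_valK_sub (L : LocalField p f π μ q) {x z : K} {k : ℤ} (hxz : z ≠ x)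
    (hz : z ≠ 0 → k ≤ valK π z) (hx : x ≠ 0 → k ≤ valK π x) : k ≤ valK π (z - x) := by
  have := L.le_valK_add (x := z) (y := -x) (k := k) (by rwa [← sub_eq_add_neg, sub_ne_zero]) hz
    fun h => by
      rw [← zero_sub, valK_sub_comm, sub_zero]
      exact hx (neg_ne_zero.1 h)
  rwa [← sub_eq_add_neg] at this

theorem dist01_eq (L : LocalField p f π μ q) {x y : K} (hx : x ≠ 0) (hy : y ≠ 0) (hxy : x ≠ y) :
    dist01 p f π x y = (q ^ relVal π x y)⁻¹ := by
  have hq := L.q_pos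
  have hmono : ∀ a b : ℤ, max (q ^ (-a)) (q ^ (-b)) = q ^ (-min a b) := by
    intro a b
    rcases le_total a b with h | h
    · rw [min_eq_left h, max_eq_left (zpow_le_zpow_right₀ L.one_lt_q.le (by lia))]
    · rw [min_eq_right h, max_eq_right (zpow_le_zpow_right₀ L.one_lt_q.le (by lia))]
  rw [dist01, L.absK_of_ne (sub_ne_zero.2 hxy), L.absK_of_ne hx, L.absK_of_ne hy, hmono,
    ← zpow_sub₀ hq.ne', ← zpow_natCast, ← zpow_neg]
  congr 1
  rw [relVal]
  -- For unequal valuations d = 1. The difference v(x - y) - v(y) is then zero or negative, and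
  -- `toNat` returns 0 in both cases.
  by_cases h : valK π x = valK π y
  · have := L.le_valK_sub hxy (fun _ => h.ge) fun _ => le_rfl
    lia
  · have := (L.valK_sub_eq_min hy hx h).2
    lia

/-- The ball of relative radius `< 1` around `y ∈ E` is contained in `E`. -/
theorem closedBall_subset_domainE [Fact p.Prime] [NormedAlgebra ℚ_[p] K]
    (L : LocalField p f π μ q) {m : ℕ} {y : K} (hy : y ∈ domainE p π m) {k : ℤ}
    (hk : valK π y < k) : closedBall y (‖π‖ ^ k) ⊆ domainE p π m := by
  intro z hz
  rw [L.mem_domainE] at hy ⊢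
  have := L.valK_of_lt (x := y) (z := z) hy.1 fun h =>
    hk.trans_le ((L.mem_closedBall_iff h k).1 hz)
  rw [this.2]
  exact ⟨this.1, hy.2⟩

theorem domainE_eq_iUnion [Fact p.Prime] [NormedAlgebra ℚ_[p] K]
    (L : LocalField p f π μ q) (m : ℕ) :
    domainE p π m = ⋃ j ∈ Finset.range m, shell π 0 (j : ℤ) := by
  ext z
  simp only [L.mem_domainE, Set.mem_iUnion, shell, Set.mem_ofPred_eq, sub_zero, Finset.mem_range]
  constructor
  · rintro ⟨hz, h0, hm⟩
    exact ⟨(valK π z).toNat, by lia, hz, by lia⟩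
  · rintro ⟨j, hj, hz, hv⟩
    exact ⟨hz, by lia, by lia⟩

theorem measurableSet_domainE [Fact p.Prime] [NormedAlgebra ℚ_[p] K] [BorelSpace K]
    (L : LocalField p f π μ q) (m : ℕ) : MeasurableSet (domainE p π m) := by
  rw [L.domainE_eq_iUnion]
  exact Finset.measurableSet_biUnion _ fun j _ => L.measurableSet_shell 0 j

theorem summable_geom (L : LocalField p f π μ q) : Summable fun l : ℕ => (q ^ l)⁻¹ := by
  simp_rw [← inv_pow]
  exact summable_geometric_of_lt_one (inv_nonneg.2 L.q_pos.le) (inv_lt_one_of_one_lt₀ L.one_lt_q)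

/-- Passing to a smaller ball shifts Ψ, and D subtracts its value at the evaluation point; neither
operation affects convergence. -/
theorem summable_shift (L : LocalField p f π μ q) {Ψ : ℕ → ℝ}
    (hΨ : Summable fun l => |Ψ l| * (q ^ l)⁻¹) (k : ℕ) (c : ℝ) :
    Summable fun l => |Ψ (l + k) - c| * (q ^ l)⁻¹ := by
  have hq := L.q_pos
  have h1 := (((summable_nat_add_iff k).2 hΨ).mul_left (q ^ k)).add (L.summable_geom.mul_left |c|)
  refine Summable.of_nonneg_of_le (fun l => by positivity) (fun l => ?_) h1
  calc |Ψ (l + k) - c| * (q ^ l)⁻¹ ≤ (|Ψ (l + k)| + |c|) * (q ^ l)⁻¹ := by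
        gcongr
        exact abs_sub _ _
    _ = q ^ k * (|Ψ (l + k)| * (q ^ (l + k))⁻¹) + |c| * (q ^ l)⁻¹ := by
        rw [pow_add]
        field_simp

/-! ### The Laplacian of functions of the distance and of the valuation -/

section Laplacian

variable [Fact p.Prime] [NormedAlgebra ℚ_[p] K] [BorelSpace K] {m : ℕ}

/-- The integral over `E` of a function supported near `y` and depending on `d(·,y)` only. -/
theorem integral_domainE_radial (L : LocalField p f π μ q) {y : K} (hy : y ∈ domainE p π m)
    {Ψ : ℕ → ℝ} (hΨ : Summable fun l => |Ψ l| * (q ^ l)⁻¹) (h0 : Ψ 0 = 0) {g : K → ℝ} (W : ℝ)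
    (hg : ∀ z ∈ domainE p π m, z ≠ y → g z = W * Ψ (relVal π z y)) :
    IntegrableOn g (domainE p π m) μ ∧ ∫ z in domainE p π m, g z ∂μ =
      W * q ^ (-valK π y) * (1 - q⁻¹) * ∑' l, Ψ (l + 1) * (q ^ (l + 1))⁻¹ := by
  have hq := L.q_pos
  set B := closedBall y (‖π‖ ^ (valK π y + 1)) with hB
  have hBE : B ⊆ domainE p π m := L.closedBall_subset_domainE hy (by lia)
  have hzero : ∀ z ∈ domainE p π m \ B, g z = 0 := by
    rintro z ⟨hz, hzB⟩
    have hzy : z ≠ y := fun h => hzB (h ▸ mem_closedBall_self (zpow_pos L.pi_pos _).le)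
    rw [hB, L.mem_closedBall_iff hzy] at hzB
    rw [hg z hz hzy, relVal, show (valK π (z - y) - valK π y).toNat = 0 by lia, h0, mul_zero]
  have hs := (L.summable_shift hΨ 1 0).mul_left |W|
  have hrad := L.integral_radial y (valK π y + 1) g (fun l => W * Ψ (l + 1))
    (by simpa [abs_mul, mul_assoc] using hs) (fun z hz hk => by
      rw [hg z (hBE ((L.mem_closedBall_iff hz _).2 hk)) hz, relVal]
      congr 2
      lia)
  refine ⟨hrad.1.of_forall_sdiff_eq_zero (L.measurableSet_domainE m) hzero, ?_⟩
  rw [setIntegral_eq_of_subset_of_forall_sdiff_eq_zero (L.measurableSet_domainE m) hBE hzero, hrad.2,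
    ← tsum_mul_left, ← tsum_mul_left]
  congr 1
  funext l
  rw [neg_add, zpow_add₀ hq.ne', zpow_neg_one, pow_succ]
  field_simp

/-- The value of the Laplacian at points `x` with `d(x,y) = 1`. -/
theorem lap_of_relVal_eq_zero (L : LocalField p f π μ q) {x y : K} (hx : x ∈ domainE p π m)
    (hy : y ∈ domainE p π m) (hxy : x ≠ y) (h : relVal π x y = 0) {Ψ : ℕ → ℝ}
    (hΨ : Summable fun l => |Ψ l| * (q ^ l)⁻¹) {F : K → ℝ}
    (hF : ∀ z ∈ domainE p π m, z ≠ y → F z = Ψ (relVal π z y)) :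
    IntegrableOn (lapIntegrand p f π F x) (domainE p π m) μ ∧ lap p f μ π m F x =
      q ^ (-|valK π x - valK π y|) *
        ((1 - q⁻¹) * ∑' l, (Ψ (l + 1) - Ψ 0) * (q ^ (l + 1))⁻¹) := by
  have hq := L.q_pos
  have hx0 := (L.mem_domainE.1 hx).1
  have hy0 := (L.mem_domainE.1 hy).1
  have hle : valK π (x - y) ≤ valK π y := by
    rw [relVal] at h
    lia
  have hmin : valK π (x - y) = min (valK π x) (valK π y) := by
    by_cases hv : valK π x = valK π y
    · have := L.le_valK_sub hxy (fun _ => hv.ge) fun _ => le_rfl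
      lia
    · exact (L.valK_sub_eq_min hy0 hx0 hv).2
  have hs := L.summable_shift hΨ 0 (Ψ 0)
  -- Points z with d(z,y) = 1 contribute nothing, since the function takes the same value there as
  -- at x. Every other z satisfies |z - x| = |x - y|, so the weight |x| / |x - y|² is a constant.
  have key := L.integral_domainE_radial hy (Ψ := fun l => Ψ l - Ψ 0) hs (sub_self _)
    (g := lapIntegrand p f π F x) (q ^ (valK π y - |valK π x - valK π y|)) fun z hz hzy => by
      by_cases hr : relVal π z y = 0
      · rw [hr, sub_self, mul_zero]
        exact lapIntegrand_eq_zero _ (by rw [hF z hz hzy, hF x hx hxy, h, hr])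
      · rw [relVal] at hr
        have hlt := L.valK_sub_of_lt (z := z) hxy fun _ => by lia
        rw [L.lapIntegrand_eq F hx0 hlt.1, hF z hz hzy, hF x hx hxy, h, mul_comm, hlt.2, hmin,
          min_comm, two_mul_min_sub, abs_sub_comm]
  refine ⟨key.1, ?_⟩
  rw [lap, key.2, sub_eq_add_neg, zpow_add₀ hq.ne', zpow_neg q (valK π y)]
  have := zpow_pos hq (valK π y)
  field_simp

/-- The Laplacian of a function of the valuation. -/
theorem lap_comp_valK (L : LocalField p f π μ q) {x : K} (hx : x ∈ domainE p π m) (c : ℤ → ℝ) :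
    IntegrableOn (lapIntegrand p f π (fun z => c (valK π z)) x) (domainE p π m) μ ∧
      lap p f μ π m (fun z => c (valK π z)) x =
        (1 - q⁻¹) * ∑ j ∈ Finset.range m, (c j - c (valK π x)) * q ^ (-|(j : ℤ) - valK π x|) := by
  have hq := L.q_pos
  have hx0 := (L.mem_domainE.1 hx).1
  have key := integral_of_const_on_pieces (μ := μ) (Finset.range m) (fun j : ℕ => shell π 0 (j : ℤ))
    (fun j _ => L.measurableSet_shell 0 j) (fun i _ j _ hij => disjoint_shell π 0 (by simpa using hij))
    (fun j _ => L.measure_shell_ne_top 0 j) (lapIntegrand p f π (fun z => c (valK π z)) x)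
    (fun j => (c j - c (valK π x)) * q ^ ((j : ℤ) - |(j : ℤ) - valK π x|)) (by
      rintro j - z ⟨hz, hv⟩
      rw [sub_zero] at hv
      by_cases hjx : (j : ℤ) = valK π x
      · rw [lapIntegrand_eq_zero _ (by rw [hv, hjx]), hjx, sub_self, zero_mul]
      · have hmin := L.valK_sub_eq_min hx0 hz (by lia)
        rw [L.lapIntegrand_eq _ hx0 hmin.1, hmin.2, two_mul_min_sub, hv])
  rw [lap, L.domainE_eq_iUnion]
  refine ⟨key.1, ?_⟩
  rw [key.2, Finset.mul_sum]
  refine Finset.sum_congr rfl fun j _ => ?_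
  rw [L.measureReal_shell, sub_eq_add_neg (j : ℤ), zpow_add₀ hq.ne', zpow_neg q (j : ℤ)]
  have := zpow_pos hq (j : ℤ)
  field_simp

/-- The value of the Laplacian at points `x` with `d(x,y) = q ^ (-k) < 1`. -/
theorem lap_of_relVal_pos (L : LocalField p f π μ q) {x y : K} (hx : x ∈ domainE p π m)
    (hy : y ∈ domainE p π m) (hxy : x ≠ y) {k : ℕ} (hk : relVal π x y = k) (hk0 : 0 < k) {Ψ : ℕ → ℝ}
    (hΨ : Summable fun l => |Ψ l| * (q ^ l)⁻¹) {F : K → ℝ}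
    (hF : ∀ z ∈ domainE p π m, z ≠ y → F z = Ψ (relVal π z y)) :
    IntegrableOn (lapIntegrand p f π F x) (domainE p π m) μ ∧ lap p f μ π m F x =
      (Ψ 0 - Ψ k) * ((1 - q⁻¹) * (kerSum q m (valK π y) - 1) - q⁻¹) +
        (1 - q⁻¹) * ∑ j ∈ Finset.range k, (Ψ j - Ψ k) * q ^ j +
        (1 - q⁻¹) * (q ^ k * ∑' l, (Ψ (l + k) - Ψ k) * (q ^ l)⁻¹) := by
  have hq := L.q_pos
  obtain ⟨hx0, hx1, hx2⟩ := L.mem_domainE.1 hx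
  obtain ⟨hy0, hy1, hy2⟩ := L.mem_domainE.1 hy
  have hkv : valK π (x - y) = valK π y + k := by
    rw [relVal] at hk
    lia
  have hvx : valK π x = valK π y := (L.valK_of_lt hy0 fun _ => by lia).2
  set s := valK π y with hs
  set g := lapIntegrand p f π F x with hg
  have hball : ∀ j : ℤ, x ∈ closedBall x (‖π‖ ^ j) :=
    fun j => mem_closedBall_self (zpow_pos L.pi_pos _).le
  have hgF : ∀ z ∈ domainE p π m, z ≠ x → z ≠ y →
      g z = (Ψ (relVal π z y) - Ψ k) * q ^ (2 * valK π (z - x) - s) := by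
    intro z hz hzx hzy
    rw [hg, L.lapIntegrand_eq F hx0 hzx, hF z hz hzy, hF x hx hxy, hk, hvx]
  have hBE : closedBall x (‖π‖ ^ (s + 1)) ⊆ domainE p π m :=
    L.closedBall_subset_domainE hx (by lia)
  have hfar : ∀ z, z ≠ x → valK π (z - x) < s + k → z ≠ y ∧ valK π (z - y) = valK π (z - x) := by
    intro z hzx hlt
    have := L.valK_sub_of_lt (x := z) (y := x) (z := y) hzx fun _ => by
      rw [valK_sub_comm π y x, hkv]
      exact hlt
    exact ⟨this.1.symm, by rw [valK_sub_comm, this.2]⟩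
  -- The domain splits into three regions. First: points z with d(z,x) = 1, where also d(z,y) = 1
  -- and the integrand depends only on v(z).
  have hA := integral_of_const_on_pieces (μ := μ) (Finset.range m)
    (fun j : ℕ => shell π 0 (j : ℤ) \ closedBall x (‖π‖ ^ (s + 1)))
    (fun j _ => (L.measurableSet_shell 0 j).diff measurableSet_closedBall)
    (fun i _ j _ hij => (disjoint_shell π 0 (by simpa using hij)).mono Set.sdiff_subset
      Set.sdiff_subset)
    (fun j _ => measure_ne_top_of_subset Set.sdiff_subset (L.measure_shell_ne_top 0 j)) g
    (fun j => (Ψ 0 - Ψ k) * q ^ ((j : ℤ) - |(j : ℤ) - s|)) (by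
      rintro j hj z ⟨⟨hz, hv⟩, hzB⟩
      have hzE : z ∈ domainE p π m := by
        rw [L.domainE_eq_iUnion]
        exact Set.mem_biUnion hj ⟨hz, hv⟩
      rw [sub_zero] at hv
      have hzx : z ≠ x := fun h => hzB (h ▸ hball _)
      rw [L.mem_closedBall_iff hzx] at hzB
      have hmin : valK π (z - x) = min (j : ℤ) s := by
        by_cases hjs : (j : ℤ) = s
        · have := L.le_valK_sub (k := s) hzx (fun _ => by lia) fun _ => by lia
          lia
        · rw [(L.valK_sub_eq_min hx0 hz (by lia)).2, hv, hvx]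
      have h2 := hfar z hzx (by lia)
      rw [hgF z hzE hzx h2.1, hmin, two_mul_min_sub, relVal, h2.2, hmin,
        show (min (j : ℤ) s - valK π y).toNat = 0 by lia])
  -- Second: the intermediate spheres, where z is farther from x than y is and hence equidistant
  -- from x and y.
  have hC := integral_of_const_on_pieces (μ := μ) (Finset.Ico 1 k)
    (fun j : ℕ => shell π x (s + j))
    (fun j _ => L.measurableSet_shell x _)
    (fun i _ j _ hij => disjoint_shell π x (by simpa using hij))
    (fun j _ => L.measure_shell_ne_top x _) g
    (fun j => (Ψ j - Ψ k) * q ^ (s + 2 * j)) (by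
      rintro j hj z ⟨hzx, hv⟩
      rw [Finset.mem_Ico] at hj
      have hzE : z ∈ domainE p π m := hBE ((L.mem_closedBall_iff hzx _).2 (by lia))
      have h2 := hfar z hzx (by lia)
      rw [hgF z hzE hzx h2.1, relVal, h2.2, hv, show (s + j - valK π y).toNat = j by lia]
      congr 2
      ring)
  -- Third: the smallest ball containing x and y. Centring it at y makes the integrand radial: on
  -- the sphere through x the difference of Ψ vanishes, whatever |z - x| is, and inside that sphere
  -- |z - x| is constant.
  have hB := L.integral_radial y (s + k) g (fun l => (Ψ (l + k) - Ψ k) * q ^ (s + 2 * k))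
    (by
      have := (L.summable_shift hΨ k (Ψ k)).mul_left (q ^ (s + 2 * k))
      refine this.congr fun l => ?_
      rw [abs_mul, abs_of_pos (zpow_pos hq (s + 2 * (k : ℤ)))]
      ring) (by
      intro z hzy hle
      by_cases hzx : z = x
      · rw [hzx, hg, lapIntegrand_eq_zero F rfl, hkv, sub_self]
        simp
      have hle' : s + k ≤ valK π (z - x) := by
        have := L.le_valK_sub (x := x - y) (z := z - y) (k := s + k) (by simpa using hzx)
          (fun _ => hle) fun _ => hkv.ge
        rwa [sub_sub_sub_cancel_right] at this
      have hzE : z ∈ domainE p π m := hBE ((L.mem_closedBall_iff hzx _).2 (by lia))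
      rw [hgF z hzE hzx hzy, relVal,
        show (valK π (z - y) - valK π y).toNat = (valK π (z - y) - (s + k)).toNat + k by lia]
      by_cases heq : valK π (z - y) = s + k
      · rw [heq, sub_self]
        simp
      · have := L.valK_sub_of_lt (z := z) hxy fun _ => by lia
        rw [this.2, hkv]
        congr 2
        ring)
  set A : Set K := ⋃ j ∈ Finset.range m, shell π 0 (j : ℤ) \ closedBall x (‖π‖ ^ (s + 1)) with hAdef
  set C : Set K := ⋃ j ∈ Finset.Ico 1 k, shell π x (s + j) with hCdef
  have hxyball : closedBall y (‖π‖ ^ (s + k)) = closedBall x (‖π‖ ^ (s + k)) := by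
    have := L.ultra
    refine IsUltrametricDist.closedBall_eq_of_mem ?_
    rw [L.mem_closedBall_iff hxy, hkv]
  rw [hxyball] at hB
  have hAe : A = domainE p π m \ closedBall x (‖π‖ ^ (s + 1)) := by
    simp_rw [hAdef, L.domainE_eq_iUnion, Set.iUnion_sdiff]
  have hCe : C = closedBall x (‖π‖ ^ (s + 1)) \ closedBall x (‖π‖ ^ (s + k)) := by
    ext z
    by_cases hzx : z = x
    · simp [hCdef, shell, hzx, (zpow_pos L.pi_pos (s + (k : ℤ))).le]
    · simp only [hCdef, Set.mem_iUnion, shell, Set.mem_ofPred_eq, Set.mem_sdiff,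
        L.mem_closedBall_iff hzx, Finset.mem_Ico]
      constructor
      · rintro ⟨j, hj, -, hv⟩
        lia
      · intro h
        exact ⟨(valK π (z - x) - s).toNat, by lia, hzx, by lia⟩
  have hsub : closedBall x (‖π‖ ^ (s + k)) ⊆ closedBall x (‖π‖ ^ (s + 1)) :=
    L.closedBall_subset x (by lia)
  have hE : domainE p π m = A ∪ (C ∪ closedBall x (‖π‖ ^ (s + k))) := by
    rw [hAe, hCe, Set.sdiff_union_of_subset hsub, Set.sdiff_union_of_subset hBE]
  have hCm : MeasurableSet (C ∪ closedBall x (‖π‖ ^ (s + k))) := by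
    rw [hCe, Set.sdiff_union_of_subset hsub]
    exact measurableSet_closedBall
  have hCB := hC.1.union hB.1
  rw [lap, hE]
  refine ⟨hA.1.union hCB, ?_⟩
  have hd1 : Disjoint A (C ∪ closedBall x (‖π‖ ^ (s + k))) := by
    rw [hAe, hCe, Set.sdiff_union_of_subset hsub]
    exact Set.disjoint_sdiff_left
  have hd2 : Disjoint C (closedBall x (‖π‖ ^ (s + k))) := by
    rw [hCe]
    exact Set.disjoint_sdiff_left
  rw [setIntegral_union hd1 hCm hA.1 hCB, setIntegral_union hd2 measurableSet_closedBall hC.1 hB.1,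
    hA.2, hC.2, hB.2]
  -- The removed ball lies entirely in the sphere of valuation s, so only the term j = s loses
  -- volume.
  have hAm : ∀ j ∈ Finset.range m, μ.real (shell π 0 (j : ℤ) \ closedBall x (‖π‖ ^ (s + 1))) =
      q ^ (-(j : ℤ)) * (1 - q⁻¹) - if (j : ℤ) = s then q ^ (-(j : ℤ)) * q⁻¹ else 0 := by
    intro j _
    have hsh : ∀ z ∈ closedBall x (‖π‖ ^ (s + 1)), z ≠ 0 ∧ valK π z = s := fun z hz => by
      rw [← hvx]
      exact L.valK_of_lt hx0 fun h => by
        rw [L.mem_closedBall_iff h] at hz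
        lia
    split_ifs with hjs
    · have hss : closedBall x (‖π‖ ^ (s + 1)) ⊆ shell π 0 (j : ℤ) := fun z hz => by
        rw [shell, Set.mem_ofPred_eq, sub_zero, hjs]
        exact hsh z hz
      rw [measureReal_sdiff hss measurableSet_closedBall (L.measure_shell_ne_top _ _),
        L.measureReal_shell, L.measureReal_closedBall, neg_add, zpow_add₀ hq.ne', zpow_neg_one, hjs]
    · rw [Disjoint.sdiff_eq_left (Set.disjoint_left.2 fun z hz hzB => ?_), L.measureReal_shell,
        sub_zero]
      have := (hsh z hzB).2
      rw [shell, Set.mem_ofPred_eq, sub_zero] at hz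
      lia
  have hAsum : ∑ j ∈ Finset.range m, (Ψ 0 - Ψ k) * q ^ ((j : ℤ) - |(j : ℤ) - s|) *
      μ.real (shell π 0 (j : ℤ) \ closedBall x (‖π‖ ^ (s + 1))) =
      (Ψ 0 - Ψ k) * ((1 - q⁻¹) * kerSum q m s - q⁻¹) := by
    have hterm : ∀ j ∈ Finset.range m, (Ψ 0 - Ψ k) * q ^ ((j : ℤ) - |(j : ℤ) - s|) *
        μ.real (shell π 0 (j : ℤ) \ closedBall x (‖π‖ ^ (s + 1))) =
        (Ψ 0 - Ψ k) * ((1 - q⁻¹) * q ^ (-|(j : ℤ) - s|)) -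
          if j = s.toNat then (Ψ 0 - Ψ k) * q⁻¹ else 0 := by
      intro j hj
      have hj' := zpow_pos hq (j : ℤ)
      rw [hAm j hj, sub_eq_add_neg (j : ℤ), zpow_add₀ hq.ne', zpow_neg q (j : ℤ)]
      by_cases hjs : (j : ℤ) = s
      · rw [if_pos hjs, if_pos (by lia), hjs, sub_self, abs_zero, neg_zero, zpow_zero]
        rw [hjs] at hj'
        field_simp
      · rw [if_neg hjs, if_neg (by lia)]
        field_simp
        ring
    rw [Finset.sum_congr rfl hterm, Finset.sum_sub_distrib, Finset.sum_ite_eq', if_pos (by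
      rw [Finset.mem_range]
      lia), ← Finset.mul_sum, ← Finset.mul_sum, kerSum]
    ring
  have hCsum : ∑ j ∈ Finset.Ico 1 k, (Ψ j - Ψ k) * q ^ (s + 2 * (j : ℤ)) *
      μ.real (shell π x (s + j)) =
      (1 - q⁻¹) * (∑ j ∈ Finset.range k, (Ψ j - Ψ k) * q ^ j) - (1 - q⁻¹) * (Ψ 0 - Ψ k) := by
    -- Extending the sum to j = 0 makes it uniform in k; the added term is subtracted and later
    -- merges with the first region.
    rw [Finset.range_eq_Ico, Finset.sum_eq_sum_Ico_succ_bot hk0, pow_zero, mul_one, mul_add,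
      add_sub_cancel_left, Finset.mul_sum]
    refine Finset.sum_congr rfl fun j _ => ?_
    rw [L.measureReal_shell, show s + 2 * (j : ℤ) = (s + j) + j by ring, zpow_add₀ hq.ne' _ (j : ℤ),
      zpow_neg, zpow_natCast]
    have := zpow_pos hq (s + j : ℤ)
    field_simp
  rw [hAsum, hCsum]
  have hBsum : q ^ (-(s + (k : ℤ))) * (1 - q⁻¹) *
      ∑' l, (Ψ (l + k) - Ψ k) * q ^ (s + 2 * (k : ℤ)) * (q ^ l)⁻¹ =
      (1 - q⁻¹) * (q ^ k * ∑' l, (Ψ (l + k) - Ψ k) * (q ^ l)⁻¹) := by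
    simp_rw [← tsum_mul_left]
    congr 1
    funext l
    rw [show s + 2 * (k : ℤ) = (s + k) + k by ring, zpow_add₀ hq.ne' _ (k : ℤ), zpow_neg,
      zpow_natCast q k]
    have := zpow_pos hq (s + k : ℤ)
    field_simp
  rw [hBsum]
  ring

end Laplacian

end LocalField

end TateGreen

namespace TateGreen

/-! ### The Laplacian on logarithmic power series -/

section Sequences

/-- The Laplacian of a function `Ψ` of the relative valuation, at points of relative valuation
`k`. -/
noncomputable def seqLap (q U : ℝ) (Ψ : ℕ → ℝ) (k : ℕ) : ℝ :=
  (Ψ 0 - Ψ k) * ((1 - U) * q⁻¹) + (1 - q⁻¹) * ∑ j ∈ Finset.range k, (Ψ j - Ψ k) * q ^ j +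
    (1 - q⁻¹) * (q ^ k * ∑' l, (Ψ (l + k) - Ψ k) * (q ^ l)⁻¹)

/-- The logarithmic series as a function of the relative valuation. -/
noncomputable def seqLog (q A lam0 : ℝ) (lam : ℕ → ℝ) (l : ℕ) : ℝ :=
  A - lam0 * l + ∑' n, lam n * ((q ^ l)⁻¹) ^ (n + 1)

/-- The integral of `(d ^ (n + 1) - 1)` over the unit ball, up to normalization. -/
noncomputable def tailMono (q : ℝ) (n : ℕ) : ℝ := q ^ (n + 2) / (q ^ (n + 2) - 1) - q / (q - 1)

/-- The Laplacian of the monomial `d ^ (n + 1)`. -/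
noncomputable def monoLap (q U : ℝ) (n k : ℕ) : ℝ :=
  (1 - ((q ^ k)⁻¹) ^ (n + 1)) * ((1 - U) * q⁻¹) +
    (1 - q⁻¹) * ∑ j ∈ Finset.range k, (((q ^ j)⁻¹) ^ (n + 1) - ((q ^ k)⁻¹) ^ (n + 1)) * q ^ j +
    (1 - q⁻¹) * (q ^ k * (((q ^ k)⁻¹) ^ (n + 1) * tailMono q n))

/-- The coefficient of `d ^ (n + 1)` in the Laplacian of `-d ^ (n + 2)`. -/
noncomputable def lapCoeff (q : ℝ) (n : ℕ) : ℝ :=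
  ((q + 1) + (q - 1) / (q ^ (n + 1) - 1) - (q - 1) / (q ^ (n + 3) - 1)) * q⁻¹

variable {q : ℝ}

theorem pow_sub_one_pos (hq : 1 < q) (n : ℕ) : 0 < q ^ (n + 1) - 1 :=
  sub_pos.2 (one_lt_pow₀ hq n.succ_ne_zero)

theorem inv_pow_le_one (hq : 1 < q) (l : ℕ) : (q ^ l)⁻¹ ≤ 1 := inv_le_one_of_one_le₀ (one_le_pow₀ hq.le)

theorem hasSum_inv_pow (hq : 1 < q) : HasSum (fun l : ℕ => (q ^ l)⁻¹) (q / (q - 1)) := by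
  have h := hasSum_geometric_of_lt_one (inv_nonneg.2 (by linarith : (0 : ℝ) ≤ q))
    (inv_lt_one_of_one_lt₀ hq)
  have hq1 : q - 1 ≠ 0 := by linarith
  convert! h using 1
  · funext l
    rw [inv_pow]
  · field_simp

theorem hasSum_tailMono (hq : 1 < q) (n : ℕ) :
    HasSum (fun l : ℕ => (((q ^ l)⁻¹) ^ (n + 1) - 1) * (q ^ l)⁻¹) (tailMono q n) := by
  have h := (hasSum_inv_pow (one_lt_pow₀ hq (n + 1).succ_ne_zero)).sub (hasSum_inv_pow hq)
  refine h.congr_fun fun l => ?_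
  rw [sub_mul, one_mul, ← pow_succ, inv_pow, ← pow_mul, ← pow_mul, mul_comm]

theorem hasSum_mul_inv_pow (hq : 1 < q) : HasSum (fun l : ℕ => (l : ℝ) * (q ^ l)⁻¹)
    (q / (q - 1) ^ 2) := by
  have h := hasSum_coe_mul_geometric_of_norm_lt_one (𝕜 := ℝ) (r := q⁻¹) (by
    rw [Real.norm_of_nonneg (inv_nonneg.2 (by linarith))]
    exact inv_lt_one_of_one_lt₀ hq)
  have hq1 : q - 1 ≠ 0 := by linarith
  convert! h using 1
  · funext l
    rw [inv_pow]
  · field_simp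

theorem summable_lam_mul (hq : 1 < q) {lam : ℕ → ℝ} (hl : Summable fun n => |lam n|) (l : ℕ) :
    Summable fun n => lam n * ((q ^ l)⁻¹) ^ (n + 1) := by
  have hq0 : 0 < q := by linarith
  refine Summable.of_norm_bounded hl fun n => ?_
  rw [norm_mul, Real.norm_eq_abs, Real.norm_of_nonneg (by positivity)]
  exact mul_le_of_le_one_right (abs_nonneg _) (pow_le_one₀ (by positivity) (inv_pow_le_one hq l))

theorem summable_seqLog (hq : 1 < q) (A lam0 : ℝ) {lam : ℕ → ℝ} (hl : Summable fun n => |lam n|) :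
    Summable fun l => |seqLog q A lam0 lam l| * (q ^ l)⁻¹ := by
  have hq0 : 0 < q := by linarith
  have h := (((hasSum_inv_pow hq).summable.mul_left |A|).add
    ((hasSum_mul_inv_pow hq).summable.mul_left |lam0|)).add
    ((hasSum_inv_pow hq).summable.mul_left (∑' n, |lam n|))
  refine Summable.of_nonneg_of_le (fun l => by positivity) (fun l => ?_) h
  have h1 : |∑' n, lam n * ((q ^ l)⁻¹) ^ (n + 1)| ≤ ∑' n, |lam n| := by
    rw [← Real.norm_eq_abs]
    refine tsum_of_norm_bounded hl.hasSum fun n => ?_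
    rw [norm_mul, Real.norm_eq_abs, Real.norm_of_nonneg (by positivity)]
    exact mul_le_of_le_one_right (abs_nonneg _) (pow_le_one₀ (by positivity) (inv_pow_le_one hq l))
  have h2 : |seqLog q A lam0 lam l| ≤ |A| + |lam0| * l + ∑' n, |lam n| := by
    refine (abs_add_le _ _).trans (add_le_add ((abs_sub _ _).trans ?_) h1)
    rw [abs_mul, Nat.abs_cast]
  calc |seqLog q A lam0 lam l| * (q ^ l)⁻¹ ≤ (|A| + |lam0| * l + ∑' n, |lam n|) * (q ^ l)⁻¹ := by
        gcongr
    _ = _ := by ring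

/-- The double family over degree n and depth l is dominated by |λ_n| q^(-l), so the sums may be
interchanged. The logarithm is not part of the power series; its contribution is the separate term
with `lam0`. -/
theorem hasSum_tail (hq : 1 < q) (A lam0 : ℝ) {lam : ℕ → ℝ} (hl : Summable fun n => |lam n|)
    (k : ℕ) : HasSum (fun n => lam n * (((q ^ k)⁻¹) ^ (n + 1) * tailMono q n))
      ((∑' l, (seqLog q A lam0 lam (l + k) - seqLog q A lam0 lam k) * (q ^ l)⁻¹) +
        lam0 * (q / (q - 1) ^ 2)) := by
  have hq0 : 0 < q := by linarith
  set G : ℕ × ℕ → ℝ := fun x => lam x.1 *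
    ((((q ^ k)⁻¹) ^ (x.1 + 1) * (((q ^ x.2)⁻¹) ^ (x.1 + 1) - 1)) * (q ^ x.2)⁻¹) with hG
  have hGs : Summable G := by
    have := hl.mul_of_nonneg (hasSum_inv_pow hq).summable (fun n => abs_nonneg _)
      fun l => by positivity
    refine Summable.of_norm_bounded this fun x => ?_
    rw [hG, norm_mul, norm_mul, norm_mul, Real.norm_eq_abs, Real.norm_of_nonneg (by positivity :
      0 ≤ ((q ^ k)⁻¹) ^ (x.1 + 1)), Real.norm_of_nonneg (by positivity : 0 ≤ (q ^ x.2)⁻¹)]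
    have h1 : ((q ^ k)⁻¹) ^ (x.1 + 1) ≤ 1 := pow_le_one₀ (by positivity) (inv_pow_le_one hq k)
    have h2 : ‖((q ^ x.2)⁻¹) ^ (x.1 + 1) - 1‖ ≤ 1 := by
      have h3 : ((q ^ x.2)⁻¹) ^ (x.1 + 1) ≤ 1 := pow_le_one₀ (by positivity) (inv_pow_le_one hq _)
      have h4 : 0 ≤ ((q ^ x.2)⁻¹) ^ (x.1 + 1) := by positivity
      rw [Real.norm_eq_abs, abs_le]
      constructor <;> linarith
    have h5 : ((q ^ k)⁻¹) ^ (x.1 + 1) * ‖((q ^ x.2)⁻¹) ^ (x.1 + 1) - 1‖ ≤ 1 :=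
      mul_le_one₀ h1 (norm_nonneg _) h2
    gcongr
    exact mul_le_of_le_one_left (by positivity) h5
  have hin : ∀ n, HasSum (fun l => G (n, l)) (lam n * (((q ^ k)⁻¹) ^ (n + 1) * tailMono q n)) := by
    intro n
    refine (((hasSum_tailMono hq n).mul_left (((q ^ k)⁻¹) ^ (n + 1))).mul_left (lam n)).congr_fun
      fun l => ?_
    simp only [hG]
    ring
  have hin' : ∀ l, HasSum (fun n => G (n, l))
      ((seqLog q A lam0 lam (l + k) - seqLog q A lam0 lam k) * (q ^ l)⁻¹ +
        lam0 * (l * (q ^ l)⁻¹)) := by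
    intro l
    have h := ((summable_lam_mul hq hl (l + k)).hasSum.sub
      (summable_lam_mul hq hl k).hasSum).mul_right ((q ^ l)⁻¹)
    convert! h using 1
    · funext n
      simp only [hG]
      rw [pow_add q l k, mul_inv, mul_pow]
      ring
    · rw [seqLog, seqLog]
      push_cast
      ring
  have h1 := hGs.hasSum.prod_fiberwise hin
  have h2 := ((Equiv.prodComm ℕ ℕ).hasSum_iff.2 hGs.hasSum).prod_fiberwise hin'
  have h3 := (h2.sub ((hasSum_mul_inv_pow hq).mul_left lam0)).tsum_eq
  simp only [add_sub_cancel_right] at h3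
  rw [h3, sub_add_cancel]
  exact h1

theorem sum_sub_mul_pow (hq : 1 < q) (k : ℕ) :
    ∑ j ∈ Finset.range k, ((j : ℝ) - k) * q ^ j = (q + k * (q - 1) - q ^ (k + 1)) / (q - 1) ^ 2 := by
  have hq1 : q - 1 ≠ 0 := by linarith
  induction k with
  | zero => simp
  | succ k ih =>
    have h : ∀ j ∈ Finset.range (k + 1), ((j : ℝ) - (k + 1 : ℕ)) * q ^ j =
        ((j : ℝ) - k) * q ^ j - q ^ j := fun j _ => by
      push_cast
      ring
    rw [Finset.sum_congr rfl h, Finset.sum_sub_distrib, Finset.sum_range_succ, ih,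
      geom_sum_eq hq.ne']
    field_simp
    push_cast
    ring

/-- The Laplacian of the logarithmic series, term by term. -/
theorem hasSum_monoLap (hq : 1 < q) (U A lam0 : ℝ) {lam : ℕ → ℝ} (hl : Summable fun n => |lam n|)
    (k : ℕ) : HasSum (fun n => lam n * monoLap q U n k)
      (seqLap q U (seqLog q A lam0 lam) k + lam0 * ((q - 1)⁻¹ + k * U * q⁻¹)) := by
  have hq0 : 0 < q := by linarith
  have hq1 : q - 1 ≠ 0 := by linarith
  set Ψ := seqLog q A lam0 lam with hΨ
  have hdiff : ∀ j, HasSum (fun n => lam n * (((q ^ j)⁻¹) ^ (n + 1) - ((q ^ k)⁻¹) ^ (n + 1)))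
      (Ψ j - Ψ k + lam0 * ((j : ℝ) - k)) := by
    intro j
    have h := (summable_lam_mul hq hl j).hasSum.sub (summable_lam_mul hq hl k).hasSum
    convert! h using 1
    · funext n
      ring
    · rw [hΨ, seqLog, seqLog]
      ring
  have h1 := (hdiff 0).mul_right ((1 - U) * q⁻¹)
  have h2 := (hasSum_sum (s := Finset.range k) fun j _ => (hdiff j).mul_right (q ^ j)).mul_left
    (1 - q⁻¹)
  have h3 := ((hasSum_tail hq A lam0 hl k).mul_left (q ^ k)).mul_left (1 - q⁻¹)
  convert! (h1.add h2).add h3 using 1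
  · funext n
    simp only [monoLap, pow_zero, inv_one, one_pow, mul_add]
    congr 1
    · congr 1
      · ring
      · rw [mul_left_comm, Finset.mul_sum]
        congr 1
        refine Finset.sum_congr rfl fun j _ => by ring
    · ring
  · rw [seqLap]
    simp only [add_mul, Finset.sum_add_distrib, mul_assoc, ← Finset.mul_sum]
    rw [sum_sub_mul_pow hq]
    simp only [Nat.cast_zero]
    field_simp
    ring

/-- The bottom of the triangular structure: the term below degree one is k = -log_q d. Comparing it
with the image of the logarithm links λ₁ to λ₀. -/
theorem monoLap_zero_sub (hq : 1 < q) (U : ℝ) (k : ℕ) :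
    monoLap q U 0 k - monoLap q U 0 0 = U * q⁻¹ * ((q ^ k)⁻¹ - 1) + (1 - q⁻¹) * k := by
  have hq0 : 0 < q := by linarith
  have hq1 : q - 1 ≠ 0 := by linarith
  have hk : q ^ k ≠ 0 := by positivity
  have hS : ∑ j ∈ Finset.range k, (((q ^ j)⁻¹) ^ (0 + 1) - ((q ^ k)⁻¹) ^ (0 + 1)) * q ^ j =
      k - (q ^ k)⁻¹ * ((q ^ k - 1) / (q - 1)) := by
    have h1 : ∀ j ∈ Finset.range k, (((q ^ j)⁻¹) ^ (0 + 1) - ((q ^ k)⁻¹) ^ (0 + 1)) * q ^ j =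
        1 - (q ^ k)⁻¹ * q ^ j := fun j _ => by
      rw [zero_add, pow_one, pow_one, sub_mul, inv_mul_cancel₀ (by positivity)]
    rw [Finset.sum_congr rfl h1, Finset.sum_sub_distrib, ← Finset.mul_sum, geom_sum_eq hq.ne']
    simp
  rw [monoLap, hS, monoLap]
  simp
  field_simp
  ring

/-- Only d^(n+2) and d^(n+1) survive: the geometric sum over intermediate spheres supplies the lower
degree, and every other contribution is of the top degree or constant. -/
theorem monoLap_succ_sub (hq : 1 < q) (U : ℝ) (n k : ℕ) :
    monoLap q U (n + 1) k - monoLap q U (n + 1) 0 =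
      U * q⁻¹ * (((q ^ k)⁻¹) ^ (n + 2) - 1) - lapCoeff q n * (((q ^ k)⁻¹) ^ (n + 1) - 1) := by
  have hq0 : 0 < q := by linarith
  have hq1 : q - 1 ≠ 0 := by linarith
  have hk : q ^ k ≠ 0 := by positivity
  have hn1 := (pow_sub_one_pos hq n).ne'
  have hn3 := (pow_sub_one_pos hq (n + 2)).ne'
  have hS : ∑ j ∈ Finset.range k, (((q ^ j)⁻¹) ^ (n + 1 + 1) - ((q ^ k)⁻¹) ^ (n + 1 + 1)) * q ^ j =
      (1 - ((q ^ k)⁻¹) ^ (n + 1)) * (q ^ (n + 1) / (q ^ (n + 1) - 1)) -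
        ((q ^ k)⁻¹) ^ (n + 2) * ((q ^ k - 1) / (q - 1)) := by
    have hne : (q ^ (n + 1))⁻¹ ≠ 1 := by
      rw [ne_eq, inv_eq_one]
      linarith [pow_sub_one_pos hq n]
    have h1 : ∑ j ∈ Finset.range k, ((q ^ (n + 1))⁻¹) ^ j =
        (1 - ((q ^ k)⁻¹) ^ (n + 1)) * (q ^ (n + 1) / (q ^ (n + 1) - 1)) := by
      rw [geom_sum_eq hne]
      have : ((q ^ (n + 1))⁻¹) ^ k = ((q ^ k)⁻¹) ^ (n + 1) := by
        rw [inv_pow, inv_pow, ← pow_mul, ← pow_mul, mul_comm]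
      rw [this]
      have h2 : (q ^ (n + 1))⁻¹ - 1 ≠ 0 := sub_ne_zero.2 hne
      have h3 : (q ^ (n + 1))⁻¹ - 1 = - ((q ^ (n + 1) - 1) / q ^ (n + 1)) := by
        field_simp
        ring
      rw [h3]
      field_simp
      ring
    rw [← h1, ← geom_sum_eq hq.ne', Finset.mul_sum, ← Finset.sum_sub_distrib]
    refine Finset.sum_congr rfl fun j _ => ?_
    rw [sub_mul, pow_succ ((q ^ j)⁻¹) (n + 1), mul_assoc, inv_mul_cancel₀ (by positivity), mul_one,
      inv_pow, inv_pow _ j, ← pow_mul, ← pow_mul, mul_comm j]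
  rw [monoLap, hS, monoLap, tailMono, lapCoeff]
  simp only [pow_zero, inv_one, one_pow, sub_self, zero_mul, Finset.range_zero, Finset.sum_empty,
    mul_zero, zero_add, one_mul]
  -- With q^(-k), q^(n+1) and q^(-k(n+1)) treated as independent letters, the claim is an identity
  -- of rational functions.
  have hr : q ^ k = ((q ^ k)⁻¹)⁻¹ := (inv_inv _).symm
  have hr0 : (q ^ k)⁻¹ ≠ 0 := inv_ne_zero hk
  rw [hr, inv_inv]
  generalize (q ^ k)⁻¹ = r at hr0
  rw [show n + 1 + 2 = (n + 1) + 2 by ring, show n + 3 = (n + 1) + 2 by ring,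
    show n + 1 + 1 = (n + 1) + 1 by ring, show n + 2 = (n + 1) + 1 by ring, pow_succ r (n + 1),
    pow_add q (n + 1) 2] at *
  generalize q ^ (n + 1) = Q at *
  generalize r ^ (n + 1) = R at *
  have hn4 : q ^ 2 * Q - 1 ≠ 0 := by rwa [mul_comm]
  field_simp
  ring

theorem lapCoeff_eq (hq : 1 < q) (n : ℕ) : lapCoeff q n =
    (q + 1) * (q ^ (n + 2) - 1) ^ 2 / (q * ((q ^ (n + 1) - 1) * (q ^ (n + 3) - 1))) := by
  have hq0 : 0 < q := by linarith
  have hn1 := (pow_sub_one_pos hq n).ne'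
  have hn3 := (pow_sub_one_pos hq (n + 2)).ne'
  rw [lapCoeff]
  field_simp
  ring

theorem abs_lapCoeff_le (hq : 1 < q) (n : ℕ) : |lapCoeff q n| ≤ (q + 2) * q⁻¹ := by
  have hq0 : 0 < q := by linarith
  have hn1 := pow_sub_one_pos hq n
  have hn3 := pow_sub_one_pos hq (n + 2)
  have h1 : (q - 1) / (q ^ (n + 1) - 1) ≤ 1 := by
    rw [div_le_one hn1]
    linarith [le_self_pow₀ hq.le (by lia : n + 1 ≠ 0)]
  have h2 : (q - 1) / (q ^ (n + 3) - 1) ≤ 1 := by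
    rw [div_le_one hn3]
    linarith [le_self_pow₀ hq.le (by lia : n + 3 ≠ 0)]
  have h3 : 0 ≤ (q - 1) / (q ^ (n + 1) - 1) := div_nonneg (by linarith) hn1.le
  have h4 : 0 ≤ (q - 1) / (q ^ (n + 3) - 1) := div_nonneg (by linarith) hn3.le
  rw [lapCoeff, abs_mul, abs_of_pos (inv_pos.2 hq0)]
  gcongr
  rw [abs_le]
  constructor <;> linarith

theorem summable_coeff (hq : 1 < q) (U : ℝ) {lam : ℕ → ℝ} (hl : Summable fun n => |lam n|) :
    Summable fun n => |U * q⁻¹ * lam n - lapCoeff q n * lam (n + 1)| := by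
  have h := (hl.mul_left |U * q⁻¹|).add (((summable_nat_add_iff 1).2 hl).mul_left ((q + 2) * q⁻¹))
  refine Summable.of_nonneg_of_le (fun _ => abs_nonneg _) (fun n => (abs_sub _ _).trans ?_) h
  rw [abs_mul, abs_mul (lapCoeff q n)]
  gcongr
  exact abs_lapCoeff_le hq n

/-- The dependence of the Laplacian of the logarithmic series on the distance. -/
theorem hasSum_seqLap_sub (hq : 1 < q) (U A lam0 : ℝ) {lam : ℕ → ℝ}
    (hl : Summable fun n => |lam n|) (k : ℕ) :
    HasSum (fun n => (U * q⁻¹ * lam n - lapCoeff q n * lam (n + 1)) * (((q ^ k)⁻¹) ^ (n + 1) - 1))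
      (seqLap q U (seqLog q A lam0 lam) k - seqLap q U (seqLog q A lam0 lam) 0 -
        k * ((1 - q⁻¹) * lam 0 - U * q⁻¹ * lam0)) := by
  have hq0 : 0 < q := by linarith
  have h := (hasSum_monoLap hq U A lam0 hl k).sub (hasSum_monoLap hq U A lam0 hl 0)
  have h1 := (hasSum_nat_add_iff' 1).2 h
  -- Each coefficient combines the diagonal term of one degree with the lowering term of the next.
  -- Removing the diagonal part from the shifted series and adding it back unshifted aligns the two.
  have hU : HasSum (fun n => U * q⁻¹ * (lam n * (((q ^ k)⁻¹) ^ (n + 1) - 1)))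
      (∑' n, U * q⁻¹ * (lam n * (((q ^ k)⁻¹) ^ (n + 1) - 1))) := by
    have := (summable_lam_mul hq hl k).sub hl.of_abs
    exact (this.mul_left (U * q⁻¹)).congr (fun n => by ring) |>.hasSum
  have hU1 := (hasSum_nat_add_iff' 1).2 hU
  have h2 := (h1.sub hU1).add hU
  convert! h2 using 1
  · funext n
    have := monoLap_succ_sub hq U n k
    linear_combination -lam (n + 1) * this
  · have := monoLap_zero_sub hq U k
    simp only [Finset.range_one, Finset.sum_singleton]
    push_cast
    linear_combination lam 0 * this

/-- A power series that vanishes at all `q ^ (-k)`, `k ≥ 1`, is zero. -/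
theorem coeff_eq_zero_of_tsum_eq_zero (hq : 1 < q) (n : ℕ) : ∀ c : ℕ → ℝ,
    (Summable fun n => |c n|) → (∀ k : ℕ, 1 ≤ k → ∑' n, c n * ((q ^ k)⁻¹) ^ n = 0) → c n = 0 := by
  have hq0 : 0 < q := by linarith
  -- The limit k → ∞ isolates the constant coefficient by dominated convergence; dividing by q^(-k)
  -- then lowers the index for the induction.
  have hzero : ∀ c : ℕ → ℝ, (Summable fun n => |c n|) →
      (∀ k : ℕ, 1 ≤ k → ∑' n, c n * ((q ^ k)⁻¹) ^ n = 0) → c 0 = 0 := by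
    intro c hc h
    have hlim : Filter.Tendsto (fun k : ℕ => (q ^ k)⁻¹) Filter.atTop (nhds 0) := by
      simp_rw [← inv_pow]
      exact tendsto_pow_atTop_nhds_zero_of_lt_one (by positivity) (inv_lt_one_of_one_lt₀ hq)
    have h1 : Filter.Tendsto (fun k : ℕ => ∑' n, c n * ((q ^ k)⁻¹) ^ n) Filter.atTop
        (nhds (∑' n, c n * 0 ^ n)) := by
      refine tendsto_tsum_of_dominated_convergence hc (fun n => (hlim.pow n).const_mul _)
        (Filter.Eventually.of_forall fun k n => ?_)
      rw [norm_mul, Real.norm_eq_abs, Real.norm_of_nonneg (by positivity)]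
      exact mul_le_of_le_one_right (abs_nonneg _)
        (pow_le_one₀ (by positivity) (inv_pow_le_one hq k))
    rw [tsum_eq_single 0 fun n hn => by rw [zero_pow hn, mul_zero], pow_zero, mul_one] at h1
    refine tendsto_nhds_unique (h1.congr' ?_) tendsto_const_nhds
    filter_upwards [Filter.eventually_ge_atTop 1] with k hk using h k hk
  induction n with
  | zero => exact hzero
  | succ n ih =>
    intro c hc h
    have h0 := hzero c hc h
    refine ih (fun n => c (n + 1)) ((summable_nat_add_iff 1).2 hc) fun k hk => ?_
    have hk0 : (q ^ k)⁻¹ ≠ 0 := by positivity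
    have hs : Summable fun n => c n * ((q ^ k)⁻¹) ^ n := by
      refine Summable.of_norm_bounded hc fun n => ?_
      rw [norm_mul, Real.norm_eq_abs, Real.norm_of_nonneg (by positivity)]
      exact mul_le_of_le_one_right (abs_nonneg _)
        (pow_le_one₀ (by positivity) (inv_pow_le_one hq k))
    have h1 := h k hk
    rw [hs.tsum_eq_zero_add, h0, zero_mul, zero_add] at h1
    have h2 : ∑' n, c (n + 1) * ((q ^ k)⁻¹) ^ (n + 1) =
        (∑' n, c (n + 1) * ((q ^ k)⁻¹) ^ n) * (q ^ k)⁻¹ := by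
      rw [← tsum_mul_right]
      congr 1
      funext n
      ring
    rw [h2] at h1
    exact (mul_eq_zero.1 h1).resolve_right hk0

/-- The series is bounded uniformly in k, so linear growth forces a = 0. What remains is a power
series relation at all q^(-k) with k ≥ 1. -/
theorem coeff_eq_zero_of_const (hq : 1 < q) {a κ : ℝ} {c : ℕ → ℝ} (hc : Summable fun n => |c n|)
    (h : ∀ k : ℕ, 1 ≤ k → HasSum (fun n => c n * (((q ^ k)⁻¹) ^ (n + 1) - 1)) (κ - k * a)) :
    a = 0 ∧ ∀ n, c n = 0 := by
  have hq0 : 0 < q := by linarith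
  have hbound : ∀ k : ℕ, 1 ≤ k → |κ - k * a| ≤ ∑' n, |c n| := by
    intro k hk
    rw [← (h k hk).tsum_eq, ← Real.norm_eq_abs]
    refine tsum_of_norm_bounded hc.hasSum fun n => ?_
    rw [norm_mul, Real.norm_eq_abs]
    refine mul_le_of_le_one_right (abs_nonneg _) ?_
    have h3 : ((q ^ k)⁻¹) ^ (n + 1) ≤ 1 := pow_le_one₀ (by positivity) (inv_pow_le_one hq _)
    have h4 : 0 ≤ ((q ^ k)⁻¹) ^ (n + 1) := by positivity
    rw [Real.norm_eq_abs, abs_le]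
    constructor <;> linarith
  have ha : a = 0 := by
    by_contra ha
    obtain ⟨k, hk⟩ := exists_nat_gt ((∑' n, |c n| + |κ|) / |a|)
    rw [div_lt_iff₀ (abs_pos.2 ha)] at hk
    have h1 := hbound (k + 1) (by lia)
    have h2 : |((k + 1 : ℕ) : ℝ) * a| ≤ |κ - (k + 1 : ℕ) * a| + |κ| := by
      have := abs_sub κ (κ - (k + 1 : ℕ) * a)
      rw [sub_sub_cancel] at this
      linarith
    rw [abs_mul, Nat.abs_cast] at h2
    push_cast at h1 h2
    nlinarith [abs_nonneg a]
  refine ⟨ha, fun n => ?_⟩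
  -- The subtracted ones and κ are collected into a coefficient of degree zero, so the remaining
  -- coefficients are those of c shifted by one.
  set c' : ℕ → ℝ := fun n => Nat.casesOn n (-(κ + ∑' n, c n)) c with hc'
  refine coeff_eq_zero_of_tsum_eq_zero hq (n + 1) c' ((summable_nat_add_iff 1).1 hc) fun k hk => ?_
  have h1 := (h k hk).add hc.of_abs.hasSum
  rw [ha] at h1
  have h2 : HasSum (fun n => c' (n + 1) * ((q ^ k)⁻¹) ^ (n + 1)) (κ + ∑' n, c n) := by
    convert! h1 using 1
    · funext n
      simp only [hc']
      ring
    · ring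
  have h3 := (hasSum_nat_add_iff (f := fun n => c' n * ((q ^ k)⁻¹) ^ n) 1).1 h2
  rw [h3.tsum_eq]
  simp [hc']

/-- The coefficients `λ_{n+1}`. -/
noncomputable def lamSeq (q U lam0 : ℝ) (n : ℕ) : ℝ :=
  U ^ (n + 1) * ((q ^ (n + 2) - 1) / ((q - 1) * (q + 1) ^ (n + 1) * (q ^ (n + 1) - 1))) * lam0

theorem lamSeq_zero (hq : 1 < q) (U lam0 : ℝ) :
    (1 - q⁻¹) * lamSeq q U lam0 0 = U * q⁻¹ * lam0 := by
  have hq1 : q - 1 ≠ 0 := by linarith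
  have hq2 : q + 1 ≠ 0 := by linarith
  rw [lamSeq]
  simp only [zero_add, pow_one]
  field_simp
  ring

theorem lamSeq_succ (hq : 1 < q) (U lam0 : ℝ) (n : ℕ) :
    U * q⁻¹ * lamSeq q U lam0 n = lapCoeff q n * lamSeq q U lam0 (n + 1) := by
  have hq0 : 0 < q := by linarith
  have hq1 : q - 1 ≠ 0 := by linarith
  have hq2 : q + 1 ≠ 0 := by linarith
  have hn1 := (pow_sub_one_pos hq n).ne'
  have hn2 := (pow_sub_one_pos hq (n + 1)).ne'
  have hn3 := (pow_sub_one_pos hq (n + 2)).ne'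
  rw [lapCoeff_eq hq, lamSeq, lamSeq]
  simp only [add_assoc, Nat.reduceAdd] at *
  generalize q ^ (n + 1) - 1 = a at *
  generalize q ^ (n + 2) - 1 = b at *
  generalize q ^ (n + 3) - 1 = c at *
  field_simp
  ring

theorem lapCoeff_ne_zero (hq : 1 < q) (n : ℕ) : lapCoeff q n ≠ 0 := by
  have hq0 : 0 < q := by linarith
  have hn1 := pow_sub_one_pos hq n
  have hn2 := pow_sub_one_pos hq (n + 1)
  have hn3 := pow_sub_one_pos hq (n + 2)
  rw [lapCoeff_eq hq]
  exact (div_pos (by positivity) (by positivity)).ne'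

/-- The leading coefficients 1 - q⁻¹ and `lapCoeff q n` never vanish, so the recursion has exactly
one solution for given `lam0`. -/
theorem eq_lamSeq_iff (hq : 1 < q) (U lam0 : ℝ) (lam : ℕ → ℝ) :
    ((1 - q⁻¹) * lam 0 - U * q⁻¹ * lam0 = 0 ∧
      ∀ n, U * q⁻¹ * lam n - lapCoeff q n * lam (n + 1) = 0) ↔ lam = lamSeq q U lam0 := by
  constructor
  · rintro ⟨h0, h1⟩
    funext n
    induction n with
    | zero =>
      have h2 := lamSeq_zero hq U lam0
      have h3 : 1 - q⁻¹ ≠ 0 := (sub_pos.2 (inv_lt_one_of_one_lt₀ hq)).ne'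
      exact mul_left_cancel₀ h3 (by linarith)
    | succ n ih =>
      have h2 := lamSeq_succ hq U lam0 n
      have h3 := h1 n
      rw [ih] at h3
      exact mul_left_cancel₀ (lapCoeff_ne_zero hq n) (by linarith)
  · rintro rfl
    exact ⟨sub_eq_zero.2 (lamSeq_zero hq U lam0), fun n => sub_eq_zero.2 (lamSeq_succ hq U lam0 n)⟩

/-- Comparison with the geometric series of ratio U / (q + 1); the remaining factor is bounded in n.
-/
theorem summable_lamSeq (hq : 1 < q) {U : ℝ} (hU : 0 ≤ U) (hU' : U < q + 1) (lam0 : ℝ) :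
    Summable fun n => |lamSeq q U lam0 n| := by
  have hq0 : 0 < q := by linarith
  have hx1 : U / (q + 1) < 1 := (div_lt_one (by linarith)).2 hU'
  have hx0 : 0 ≤ U / (q + 1) := by positivity
  have hg := ((summable_geometric_of_lt_one hx0 hx1).mul_left
    (U / (q + 1))).mul_left ((q + 1) / (q - 1) * |lam0|)
  refine Summable.of_nonneg_of_le (fun _ => abs_nonneg _) (fun n => ?_) hg
  have hn1 := pow_sub_one_pos hq n
  have hn2 := pow_sub_one_pos hq (n + 1)
  have hq1 : 0 < q - 1 := by linarith
  have hle : (q ^ (n + 2) - 1) / (q ^ (n + 1) - 1) ≤ q + 1 := by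
    rw [div_le_iff₀ hn1, pow_succ q (n + 1)]
    nlinarith [le_self_pow₀ hq.le (by lia : n + 1 ≠ 0)]
  have heq : lamSeq q U lam0 n = (U / (q + 1) * (U / (q + 1)) ^ n) *
      ((q ^ (n + 2) - 1) / (q ^ (n + 1) - 1)) / (q - 1) * lam0 := by
    rw [lamSeq, ← pow_succ', div_pow]
    field_simp
  rw [heq, abs_mul, abs_of_nonneg (div_nonneg (mul_nonneg (by positivity)
    (div_nonneg hn2.le hn1.le)) hq1.le)]
  calc _ ≤ (U / (q + 1) * (U / (q + 1)) ^ n) * (q + 1) / (q - 1) * |lam0| := by gcongr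
    _ = _ := by ring

/-- The recursion removes the dependence on k, so k = 0 suffices. There the monomial values cancel
the q-factors of λ_n and leave a geometric series in U / (q + 1). -/
theorem seqLap_lamSeq (hq : 1 < q) {U : ℝ} (hU : 0 ≤ U) (hU' : U < q + 1) (A lam0 : ℝ) (k : ℕ) :
    seqLap q U (seqLog q A lam0 (lamSeq q U lam0)) k =
      -lam0 * (1 / (q - 1)) * ((q + 1) / (q + 1 - U)) := by
  have hq0 : 0 < q := by linarith
  have hl := summable_lamSeq hq hU hU' lam0
  have hz := (eq_lamSeq_iff hq U lam0 (lamSeq q U lam0)).2 rfl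
  have h := hasSum_seqLap_sub hq U A lam0 hl k
  simp only [hz.1, hz.2, zero_mul, mul_zero, sub_zero] at h
  rw [sub_eq_zero.1 (h.unique hasSum_zero)]
  have h0 := hasSum_monoLap hq U A lam0 hl 0
  have hx1 : U / (q + 1) < 1 := (div_lt_one (by linarith)).2 hU'
  have hx0 : 0 ≤ U / (q + 1) := by positivity
  have hg := (((hasSum_geometric_of_lt_one hx0 hx1).mul_left (U / (q + 1))).mul_left
    (-lam0 / (q - 1)))
  have heq : (fun n => lamSeq q U lam0 n * monoLap q U n 0) =
      fun n => -lam0 / (q - 1) * (U / (q + 1) * (U / (q + 1)) ^ n) := by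
    funext n
    have hn1 := (pow_sub_one_pos hq n).ne'
    have hn2 := (pow_sub_one_pos hq (n + 1)).ne'
    have hq1 : q - 1 ≠ 0 := by linarith
    have hm : monoLap q U n 0 = -(q ^ (n + 1) - 1) / (q ^ (n + 2) - 1) := by
      simp only [monoLap, tailMono, pow_zero, inv_one, one_pow, sub_self, zero_mul,
        Finset.range_zero, Finset.sum_empty, mul_zero, zero_add, one_mul]
      have hp : q ^ (n + 2) = q ^ (n + 1) * q := pow_succ q (n + 1)
      simp only [add_assoc, Nat.reduceAdd] at hn2
      rw [hp] at hn2 ⊢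
      generalize q ^ (n + 1) = Q at *
      have hn4 : q * Q - 1 ≠ 0 := by rwa [mul_comm]
      field_simp
      ring
    rw [hm, lamSeq, ← pow_succ', div_pow]
    simp only [add_assoc, Nat.reduceAdd] at hn2
    field_simp
  rw [heq] at h0
  have h1 := h0.unique hg
  have hq1 : q - 1 ≠ 0 := by linarith
  have hq2 : q + 1 - U ≠ 0 := by linarith
  have hq3 : q + 1 ≠ 0 := by linarith
  have h2 : 1 - U / (q + 1) = (q + 1 - U) / (q + 1) := by field_simp
  rw [h2] at h1
  simp only [Nat.cast_zero, zero_mul, add_zero] at h1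
  rw [eq_sub_of_add_eq h1]
  field_simp
  ring

end Sequences

end TateGreen

namespace TateGreen

/-! ### Arrays of valuations: from convolution equations to recurrences -/

section Arrays

open Finset

/-- The convolution `∑_{j < m} c_j q ^ (-|j - a|)`. -/
noncomputable def kerConv (q : ℝ) (m : ℕ) (c : ℤ → ℝ) (a : ℤ) : ℝ :=
  ∑ j ∈ range m, c j * q ^ (-|(j : ℤ) - a|)

/-- The equation for one column of the array, with right-hand side `-α + β q ^ (-|a - r|)`. -/
def ColumnEq (q : ℝ) (m : ℕ) (α β : ℝ) (r : ℤ) (c : ℤ → ℝ) : Prop :=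
  ∀ a : ℤ, 0 ≤ a → a ≤ (m : ℤ) - 1 →
    kerConv q m c a - kerSum q m a * c a = -α + β * q ^ (-|a - r|)

/-- The three-term recurrence above the diagonal entry `r` of a column. -/
structure UpperRows (q : ℝ) (m : ℕ) (α : ℝ) (r : ℤ) (c : ℤ → ℝ) : Prop where
  top : r < (m : ℤ) - 1 →
    kerSum q m ((m : ℤ) - 2) * (c ((m : ℤ) - 2) - c ((m : ℤ) - 1)) = -α * (q - 1)
  mid : ∀ a : ℤ, r < a → a < (m : ℤ) - 1 →
    kerSum q m (a - 1) * (c (a - 1) - c a) + kerSum q m (a + 1) * (c (a + 1) - c a) =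
      -α * (q + q⁻¹ - 2)

variable {q : ℝ} {m : ℕ}

/-- On either side of a = j the kernel is a pure power q^(±a), annihilated by this operator; only
the kink at a = j contributes. -/
theorem kernel_second_difference (hq : 1 < q) (j a : ℤ) :
    (q + q⁻¹) * q ^ (-|j - a|) - q ^ (-|j - (a - 1)|) - q ^ (-|j - (a + 1)|) =
      if j = a then q - q⁻¹ else 0 := by
  have hq0 : q ≠ 0 := by linarith
  split_ifs with h
  · subst h
    rw [sub_self, abs_zero, show j - (j - 1) = 1 by ring, show j - (j + 1) = -1 by ring, abs_neg,
      abs_one, neg_zero, zpow_zero, zpow_neg_one]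
    ring
  · rcases lt_or_gt_of_ne h with h | h
    · rw [abs_of_neg (by lia), abs_of_nonpos (by lia), abs_of_neg (by lia),
        show -(-(j - (a - 1))) = -(-(j - a)) + 1 by ring,
        show -(-(j - (a + 1))) = -(-(j - a)) - 1 by ring, zpow_add_one₀ hq0, zpow_sub_one₀ hq0]
      ring
    · rw [abs_of_pos (by lia), abs_of_pos (by lia), abs_of_nonneg (by lia),
        show -(j - (a - 1)) = -(j - a) - 1 by ring,
        show -(j - (a + 1)) = -(j - a) + 1 by ring, zpow_add_one₀ hq0, zpow_sub_one₀ hq0]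
      ring

theorem kerConv_second_difference (hq : 1 < q) (c : ℤ → ℝ) {a : ℤ} (h0 : 0 ≤ a)
    (h1 : a ≤ (m : ℤ) - 1) :
    (q + q⁻¹) * kerConv q m c a - kerConv q m c (a - 1) - kerConv q m c (a + 1) =
      (q - q⁻¹) * c a := by
  rw [kerConv, kerConv, kerConv, mul_sum, ← sum_sub_distrib, ← sum_sub_distrib]
  have h : ∀ j ∈ range m, (q + q⁻¹) * (c j * q ^ (-|(j : ℤ) - a|)) -
      c j * q ^ (-|(j : ℤ) - (a - 1)|) - c j * q ^ (-|(j : ℤ) - (a + 1)|) =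
      if j = a.toNat then (q - q⁻¹) * c a else 0 := by
    intro j _
    have := kernel_second_difference hq j a
    by_cases hj : (j : ℤ) = a
    · subst hj
      rw [if_pos rfl] at this
      rw [if_pos (by lia)]
      linear_combination c j * this
    · rw [if_neg hj] at this
      rw [if_neg (by lia)]
      linear_combination c j * this
  rw [sum_congr rfl h, sum_ite_eq', if_pos (by rw [mem_range]; lia)]

/-- Outside the range every term decays by the same factor, which eliminates the missing neighbour
of the last row and acts as a boundary condition. -/
theorem kerConv_top (hq : 1 < q) (c : ℤ → ℝ) :
    kerConv q m c m = q⁻¹ * kerConv q m c ((m : ℤ) - 1) := by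
  have hq0 : q ≠ 0 := by linarith
  rw [kerConv, kerConv, mul_sum]
  refine sum_congr rfl fun j hj => ?_
  rw [mem_range] at hj
  rw [abs_of_neg (by lia), abs_of_nonpos (by lia),
    show -(-((j : ℤ) - m)) = -(-((j : ℤ) - (m - 1))) - 1 by ring, zpow_sub_one₀ hq0]
  ring

theorem kerSum_eq_kerConv (a : ℤ) : kerSum q m a = kerConv q m (fun _ => 1) a := by
  simp [kerSum, kerConv]

theorem kerSum_pos (hq : 1 < q) (hm : 0 < m) (a : ℤ) : 0 < kerSum q m a :=
  sum_pos (fun _ _ => zpow_pos (by linarith) _) (nonempty_range_iff.2 hm.ne')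

theorem kerSum_eq (hq : 1 < q) {s : ℤ} (h0 : 0 ≤ s) (h1 : s ≤ (m : ℤ) - 1) :
    kerSum q m s = (q + 1 - (q ^ (-s) + q ^ (-((m : ℤ) - 1 - s)))) / (q - 1) := by
  have hq0 : q ≠ 0 := by linarith
  have hq1 : q - 1 ≠ 0 := by linarith
  lift s to ℕ using h0
  obtain ⟨t, rfl⟩ : ∃ t, m = s + 1 + t := ⟨m - (s + 1), by lia⟩
  clear h1
  induction t with
  | zero =>
    have h : ∀ j ∈ range (s + 1 + 0), q ^ (-|(j : ℤ) - s|) = q ^ (-(s : ℤ)) * q ^ j := by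
      intro j hj
      rw [mem_range] at hj
      rw [abs_of_nonpos (by lia), ← zpow_natCast q j, ← zpow_add₀ hq0]
      congr 1
      ring
    rw [kerSum, sum_congr rfl h, ← mul_sum, geom_sum_eq hq.ne', zpow_neg, zpow_natCast, add_zero,
      pow_succ, show (-(((s + 1 : ℕ) : ℤ) - 1 - s)) = 0 by push_cast; ring, zpow_zero]
    field_simp
    ring
  | succ t ih =>
    have h2 : kerSum q (s + 1 + (t + 1)) s = kerSum q (s + 1 + t) s + q ^ (-((t : ℤ) + 1)) := by
      rw [kerSum, ← add_assoc, sum_range_succ, kerSum]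
      congr 2
      rw [abs_of_nonneg (by push_cast; lia)]
      push_cast
      ring
    rw [h2, ih, show -(((s + 1 + (t + 1) : ℕ) : ℤ) - 1 - s) = -((t : ℤ) + 1) by push_cast; ring,
      show -(((s + 1 + t : ℕ) : ℤ) - 1 - s) = -((t : ℤ) + 1) + 1 by push_cast; ring,
      zpow_add_one₀ hq0]
    field_simp
    ring

theorem kerConv_reflect (c : ℤ → ℝ) (a : ℤ) :
    kerConv q m (fun j => c ((m : ℤ) - 1 - j)) a = kerConv q m c ((m : ℤ) - 1 - a) := by
  rw [kerConv, ← sum_range_reflect, kerConv]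
  refine sum_congr rfl fun j hj => ?_
  rw [mem_range] at hj
  have h : ((m - 1 - j : ℕ) : ℤ) = m - 1 - j := by lia
  rw [h, sub_sub_cancel, show (m : ℤ) - 1 - j - a = -(j - (m - 1 - a)) by ring, abs_neg]

theorem kerSum_reflect (a : ℤ) : kerSum q m ((m : ℤ) - 1 - a) = kerSum q m a := by
  rw [kerSum_eq_kerConv, kerSum_eq_kerConv, ← kerConv_reflect]

theorem ColumnEq.reflect {α β : ℝ} {r : ℤ} {c : ℤ → ℝ} (h : ColumnEq q m α β r c) :
    ColumnEq q m α β ((m : ℤ) - 1 - r) fun j => c ((m : ℤ) - 1 - j) := by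
  intro a h0 h1
  have := h ((m : ℤ) - 1 - a) (by lia) (by lia)
  rw [kerSum_reflect] at this
  rw [kerConv_reflect, this, show a - ((m : ℤ) - 1 - r) = -((m : ℤ) - 1 - a - r) by ring, abs_neg]

/-- The difference between the two sides of the column equation. -/
noncomputable def residual (q : ℝ) (m : ℕ) (α β : ℝ) (r : ℤ) (c : ℤ → ℝ) (a : ℤ) : ℝ :=
  kerConv q m c a - kerSum q m a * c a - (-α + β * q ^ (-|a - r|))

/-- The second difference makes both convolutions local and annihilates the β-term because a ≠ r; of
the right-hand side only the constant survives. -/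
theorem residual_mid (hq : 1 < q) (α β : ℝ) (c : ℤ → ℝ) {r a : ℤ} (hr : 0 ≤ r) (h0 : r < a)
    (h1 : a < (m : ℤ) - 1) :
    (q + q⁻¹) * residual q m α β r c a - residual q m α β r c (a - 1) -
        residual q m α β r c (a + 1) =
      kerSum q m (a - 1) * (c (a - 1) - c a) +
        kerSum q m (a + 1) * (c (a + 1) - c a) + α * (q + q⁻¹ - 2) := by
  have e1 := kerConv_second_difference (m := m) hq c (a := a) (by lia) (by lia)
  have e2 := kerConv_second_difference (m := m) hq (fun _ => 1) (a := a) (by lia) (by lia)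
  simp only [← kerSum_eq_kerConv] at e2
  have e3 := kernel_second_difference hq r a
  rw [if_neg h0.ne, abs_sub_comm r, abs_sub_comm r, abs_sub_comm r] at e3
  simp only [residual]
  linear_combination e1 - c a * e2 - β * e3

theorem residual_top (hq : 1 < q) (α β : ℝ) (c : ℤ → ℝ) {r : ℤ} (hr : 0 ≤ r)
    (h0 : r < (m : ℤ) - 1) :
    q * residual q m α β r c ((m : ℤ) - 1) - residual q m α β r c ((m : ℤ) - 2) =
      kerSum q m ((m : ℤ) - 2) * (c ((m : ℤ) - 2) - c ((m : ℤ) - 1)) + α * (q - 1) := by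
  have hq0 : q ≠ 0 := by linarith
  have e1 := kerConv_second_difference (m := m) hq c (a := (m : ℤ) - 1) (by lia) (by lia)
  have e2 := kerConv_second_difference (m := m) hq (fun _ => 1) (a := (m : ℤ) - 1) (by lia)
    (by lia)
  rw [sub_add_cancel, kerConv_top hq, show (m : ℤ) - 1 - 1 = m - 2 by ring] at e1 e2
  simp only [← kerSum_eq_kerConv] at e2
  have e3 : q ^ (-|(m : ℤ) - 2 - r|) = q * q ^ (-|(m : ℤ) - 1 - r|) := by
    rw [← zpow_one_add₀ hq0, abs_of_nonneg (by lia), abs_of_nonneg (by lia)]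
    congr 1
    ring
  simp only [residual]
  rw [e3]
  linear_combination e1 - c ((m : ℤ) - 1) * e2

theorem ColumnEq.upperRows (hq : 1 < q) {α β : ℝ} {r : ℤ} (hr : 0 ≤ r) {c : ℤ → ℝ}
    (h : ColumnEq q m α β r c) : UpperRows q m α r c := by
  have h0 : ∀ a : ℤ, 0 ≤ a → a ≤ (m : ℤ) - 1 → residual q m α β r c a = 0 := fun a h0 h1 =>
    sub_eq_zero.2 (h a h0 h1)
  constructor
  · intro hr1
    have := residual_top hq α β c hr hr1
    rw [h0 _ (by lia) (by lia), h0 _ (by lia) (by lia)] at this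
    linarith
  · intro a h1 h2
    have := residual_mid hq α β c hr h1 h2
    rw [h0 _ (by lia) (by lia), h0 _ (by lia) (by lia), h0 _ (by lia) (by lia)] at this
    linarith

/-- Under the recurrences the residual satisfies the homogeneous equation with solutions q^(±a). The
top row selects the one decaying upwards, and this propagates down to r. -/
theorem UpperRows.residual_pred (hq : 1 < q) {α β : ℝ} {r : ℤ} (hr : 0 ≤ r) {c : ℤ → ℝ}
    (h : UpperRows q m α r c) (i : ℕ) : r < (m : ℤ) - 1 - i →
    q * residual q m α β r c ((m : ℤ) - 1 - i) = residual q m α β r c ((m : ℤ) - 1 - i - 1) := by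
  have hq0 : q ≠ 0 := by linarith
  induction i with
  | zero =>
    intro hi
    have := residual_top (m := m) hq α β c hr (by lia)
    rw [h.top (by lia)] at this
    simp only [Nat.cast_zero, sub_zero]
    rw [show (m : ℤ) - 1 - 1 = m - 2 by ring]
    linarith
  | succ i ih =>
    intro hi
    have h1 := ih (by lia)
    push_cast at hi ⊢
    have h2 := residual_mid (m := m) hq α β c hr hi (by lia)
    have h3 := h.mid _ hi (by lia)
    rw [show (m : ℤ) - 1 - i - 1 = m - 1 - (i + 1) by ring] at h1
    rw [show (m : ℤ) - 1 - (i + 1) + 1 = m - 1 - i by ring] at h2 h3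
    have h4 : q⁻¹ * residual q m α β r c ((m : ℤ) - 1 - (i + 1)) =
        residual q m α β r c ((m : ℤ) - 1 - i) := by
      rw [← h1]
      field_simp
    linarith

theorem UpperRows.residual_eq (hq : 1 < q) {α β : ℝ} {r : ℤ} (hr : 0 ≤ r) {c : ℤ → ℝ}
    (h : UpperRows q m α r c) (i : ℕ) : r + i ≤ (m : ℤ) - 1 →
    residual q m α β r c (r + i) = q ^ (-(i : ℤ)) * residual q m α β r c r := by
  have hq0 : q ≠ 0 := by linarith
  induction i with
  | zero => simp
  | succ i ih =>
    intro hi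
    push_cast at hi
    have h1 := h.residual_pred (β := β) hq hr ((m : ℤ) - 1 - (r + (i + 1))).toNat (by lia)
    rw [show (m : ℤ) - 1 - ((m : ℤ) - 1 - (r + (i + 1))).toNat = r + (i + 1) by lia,
      show r + ((i : ℤ) + 1) - 1 = r + i by ring, ih (by lia)] at h1
    push_cast
    rw [neg_add, zpow_add₀ hq0, zpow_neg_one]
    have h2 : residual q m α β r c (r + (i + 1)) =
        q⁻¹ * (q * residual q m α β r c (r + (i + 1))) := by field_simp
    rw [h2, h1]
    ring

theorem residual_reflect (α β : ℝ) (r : ℤ) (c : ℤ → ℝ) (a : ℤ) :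
    residual q m α β ((m : ℤ) - 1 - r) (fun j => c ((m : ℤ) - 1 - j)) ((m : ℤ) - 1 - a) =
      residual q m α β r c a := by
  simp only [residual]
  rw [kerConv_reflect, kerSum_reflect, sub_sub_cancel,
    show (m : ℤ) - 1 - a - ((m : ℤ) - 1 - r) = -(a - r) by ring, abs_neg]

/-- Conservation law: the kernel is symmetric and the subtracted diagonal consists of its row sums.
-/
theorem sum_kerConv_sub (c : ℤ → ℝ) :
    ∑ a ∈ range m, (kerConv q m c a - kerSum q m a * c a) = 0 := by
  rw [sum_sub_distrib, sub_eq_zero]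
  simp only [kerConv, kerSum]
  rw [sum_comm]
  refine sum_congr rfl fun j _ => ?_
  rw [sum_mul]
  refine sum_congr rfl fun a _ => ?_
  rw [abs_sub_comm, mul_comm]

/-- The recurrences above r, together with the reflected ones below, determine the residual up to
its value at r. The relation `hαβ` makes its total zero, while that total is a positive multiple of
the value at r. No separate equation on the diagonal is needed. -/
theorem columnEq_iff (hq : 1 < q) (hm : 0 < m) {α β : ℝ} {r : ℤ} (hr : 0 ≤ r)
    (hr1 : r ≤ (m : ℤ) - 1) (hαβ : β * kerSum q m r = α * m) (c : ℤ → ℝ) :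
    ColumnEq q m α β r c ↔ UpperRows q m α r c ∧
      UpperRows q m α ((m : ℤ) - 1 - r) fun j => c ((m : ℤ) - 1 - j) := by
  refine ⟨fun h => ⟨h.upperRows hq hr, h.reflect.upperRows hq (by lia)⟩, fun ⟨h1, h2⟩ => ?_⟩
  have hval : ∀ a : ℤ, 0 ≤ a → a ≤ (m : ℤ) - 1 →
      residual q m α β r c a = q ^ (-|a - r|) * residual q m α β r c r := by
    intro a ha0 ha1
    rcases le_total r a with h | h
    · have := h1.residual_eq (β := β) hq hr (a - r).toNat (by lia)
      rw [show ((a - r).toNat : ℤ) = a - r by lia, add_sub_cancel] at this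
      rw [this, abs_of_nonneg (by lia)]
    · have := h2.residual_eq (β := β) hq (by lia) (r - a).toNat (by lia)
      rw [show ((r - a).toNat : ℤ) = r - a by lia,
        show (m : ℤ) - 1 - r + (r - a) = m - 1 - a by ring, residual_reflect, residual_reflect]
        at this
      rw [this, abs_of_nonpos (by lia), neg_neg, neg_sub]
  have hsum : ∑ a ∈ range m, residual q m α β r c a = 0 := by
    simp only [residual]
    rw [sum_sub_distrib, sum_kerConv_sub, sum_add_distrib, ← mul_sum, ← kerSum, hαβ]
    simp
    ring
  have hsum2 : ∑ a ∈ range m, residual q m α β r c a = kerSum q m r * residual q m α β r c r := by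
    rw [kerSum, sum_mul]
    refine sum_congr rfl fun a ha => ?_
    rw [mem_range] at ha
    exact hval a (by lia) (by lia)
  rw [hsum2, mul_eq_zero, or_iff_right (kerSum_pos hq hm r).ne'] at hsum
  intro a ha0 ha1
  have := hval a ha0 ha1
  rw [hsum, mul_zero] at this
  exact sub_eq_zero.1 this

theorem UpperRows.congr {α : ℝ} {r : ℤ} {c c' : ℤ → ℝ} (h : UpperRows q m α r c) (k : ℝ)
    (hcc : ∀ a, r ≤ a → a ≤ (m : ℤ) - 1 → c' a = c a + k) : UpperRows q m α r c' := by
  constructor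
  · intro hr
    rw [hcc _ (by lia) (by lia), hcc _ (by lia) (by lia), add_sub_add_right_eq_sub]
    exact h.top hr
  · intro a h1 h2
    rw [hcc _ (by lia) (by lia), hcc _ (by lia) (by lia), hcc _ (by lia) (by lia),
      add_sub_add_right_eq_sub, add_sub_add_right_eq_sub]
    exact h.mid a h1 h2

theorem UpperRows.mono {α : ℝ} {r s : ℤ} (hrs : r ≤ s) {c : ℤ → ℝ} (h : UpperRows q m α r c) :
    UpperRows q m α s c :=
  ⟨fun h1 => h.top (by lia), fun a h1 h2 => h.mid a (by lia) h2⟩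

/-- The recurrences constrain successive differences only. The top row fixes the first and, the
kernel sums being nonzero, the others follow downwards. -/
theorem UpperRows.sub_eq (hq : 1 < q) (hm : 0 < m) {α : ℝ} {r : ℤ} {c c' : ℤ → ℝ}
    (h : UpperRows q m α r c) (h' : UpperRows q m α r c') {a : ℤ} (ha : r ≤ a)
    (ha1 : a ≤ (m : ℤ) - 1) :
    c a - c ((m : ℤ) - 1) = c' a - c' ((m : ℤ) - 1) := by
  have hw := fun b => (kerSum_pos hq hm b).ne'
  have key : ∀ i : ℕ, r < (m : ℤ) - 1 - i →
      c ((m : ℤ) - 1 - i - 1) - c ((m : ℤ) - 1 - i) =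
        c' ((m : ℤ) - 1 - i - 1) - c' ((m : ℤ) - 1 - i) := by
    intro i
    induction i with
    | zero =>
      intro hi
      simp only [Nat.cast_zero, sub_zero]
      rw [show (m : ℤ) - 1 - 1 = m - 2 by ring]
      exact mul_left_cancel₀ (hw _) ((h.top (by lia)).trans (h'.top (by lia)).symm)
    | succ i ih =>
      intro hi
      have h1 := ih (by lia)
      push_cast at hi ⊢
      have h2 := h.mid _ hi (by lia)
      have h3 := h'.mid _ hi (by lia)
      rw [show (m : ℤ) - 1 - i - 1 = m - 1 - (i + 1) by ring] at h1
      rw [show (m : ℤ) - 1 - (i + 1) + 1 = m - 1 - i by ring] at h2 h3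
      refine mul_left_cancel₀ (hw ((m : ℤ) - 1 - (i + 1) - 1)) ?_
      linear_combination h2 - h3 + kerSum q m ((m : ℤ) - 1 - i) * h1
  have key2 : ∀ i : ℕ, r ≤ (m : ℤ) - 1 - i →
      c ((m : ℤ) - 1 - i) - c ((m : ℤ) - 1) = c' ((m : ℤ) - 1 - i) - c' ((m : ℤ) - 1) := by
    intro i
    induction i with
    | zero => simp
    | succ i ih =>
      intro hi
      have h1 := ih (by lia)
      have h2 := key i (by lia)
      push_cast
      rw [show (m : ℤ) - 1 - (i + 1) = m - 1 - i - 1 by ring]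
      linarith
  have := key2 ((m : ℤ) - 1 - a).toNat (by lia)
  rwa [show (m : ℤ) - 1 - ((m : ℤ) - 1 - a).toNat = a by lia] at this

/-- Characterization of the symmetric arrays all of whose columns satisfy the column equation. -/
theorem symm_columnEq_iff (hq : 1 < q) (hm : 0 < m) {α : ℝ} {β : ℤ → ℝ}
    (hαβ : ∀ r, 0 ≤ r → r ≤ (m : ℤ) - 1 → β r * kerSum q m r = α * m) (C : ℤ → ℤ → ℝ) :
    ((∀ q r : ℤ, 0 ≤ q → q ≤ (m : ℤ) - 1 → 0 ≤ r → r ≤ (m : ℤ) - 1 → C q r = C r q) ∧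
      ∀ r, 0 ≤ r → r ≤ (m : ℤ) - 1 → ColumnEq q m α (β r) r fun a => C a r) ↔
    (UpperRows q m α 0 (fun a => C a 0) ∧
      (∀ q r : ℤ, 0 ≤ r → r ≤ q → q ≤ (m : ℤ) - 1 →
        C q r = C q 0 + C ((m : ℤ) - 1 - r) 0 - C ((m : ℤ) - 1) 0) ∧
      ∀ q r : ℤ, 0 ≤ q → q ≤ r → r ≤ (m : ℤ) - 1 →
        C q r = C ((m : ℤ) - 1 - q) 0 + C r 0 - C ((m : ℤ) - 1) 0) := by
  constructor
  · rintro ⟨hs, hC⟩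
    have hU : ∀ r, 0 ≤ r → r ≤ (m : ℤ) - 1 → _ := fun r h0 h1 =>
      (columnEq_iff hq hm h0 h1 (hαβ r h0 h1) _).1 (hC r h0 h1)
    have hU0 := (hU 0 le_rfl (by lia)).1
    have hlow : ∀ q r : ℤ, 0 ≤ r → r ≤ q → q ≤ (m : ℤ) - 1 →
        C q r = C q 0 + C ((m : ℤ) - 1 - r) 0 - C ((m : ℤ) - 1) 0 := by
      intro a r h0 h1 h2
      -- Column r agrees with column 0 above the diagonal up to a constant. The constant is read off
      -- in the last row, which by symmetry is the last column, and that column reflected again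
      -- satisfies the recurrences of column 0.
      have e1 := (hU r h0 (by lia)).1.sub_eq hq hm (hU0.mono h0) h1 h2
      have e2 := (hU ((m : ℤ) - 1) (by lia) le_rfl).2
      rw [sub_self] at e2
      have e3 := e2.sub_eq hq hm hU0 (a := (m : ℤ) - 1 - r) (by lia) (by lia)
      simp only [sub_sub_cancel, sub_self] at e3
      have e4 := hs ((m : ℤ) - 1) r (by lia) le_rfl h0 (by lia)
      have e5 := hs ((m : ℤ) - 1) 0 (by lia) le_rfl le_rfl (by lia)
      linarith
    refine ⟨hU0, hlow, fun a r h0 h1 h2 => ?_⟩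
    rw [hs a r h0 (by lia) (by lia) h2, hlow r a h0 h1 h2]
    ring
  · rintro ⟨hU, hlow, hup⟩
    refine ⟨fun a r h0 h1 h2 h3 => ?_, fun r h0 h1 => ?_⟩
    · rcases le_total a r with h | h
      · rw [hup a r h0 h h3, hlow r a h0 h h3]
        ring
      · rw [hlow a r h2 h h1, hup r a h2 h h1]
        ring
    · rw [columnEq_iff hq hm h0 h1 (hαβ r h0 h1)]
      constructor
      · refine (hU.mono h0).congr (C ((m : ℤ) - 1 - r) 0 - C ((m : ℤ) - 1) 0) fun a h2 h3 => ?_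
        rw [hlow a r h0 h2 h3]
        ring
      · refine (hU.mono (by lia)).congr (C r 0 - C ((m : ℤ) - 1) 0) fun a h2 h3 => ?_
        rw [hup _ r (by lia) (by lia) h1, sub_sub_cancel]
        ring

end Arrays

/-! ### The recurrence in terms of Λ_q -/

section Recurrence

variable {q : ℝ} {p f m : ℕ}

/-- Summing the two geometric series in the kernel sum identifies it with Λ up to the factor (q - 1)
/ q; positivity of Λ follows from this. -/
theorem Lam_eq (hqe : (p : ℝ) ^ f = q) (hq : 1 < q) {a : ℤ} (h0 : 0 ≤ a) (h1 : a ≤ (m : ℤ) - 1) :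
    q * Lam p f m a = kerSum q m a * (q - 1) := by
  have hq0 : q ≠ 0 := by linarith
  have hq1 : q - 1 ≠ 0 := by linarith
  have hz : ∀ k : ℤ, (p : ℝ) ^ (-((f : ℤ) * k)) = q ^ (-k) := by
    intro k
    rw [← hqe, ← zpow_natCast (p : ℝ) f, ← zpow_mul, mul_neg]
  have hz1 := hz 1
  rw [mul_one] at hz1
  rw [kerSum_eq hq h0 h1, Lam, hz, hz, hz1, div_mul_cancel₀ _ hq1, zpow_neg_one, neg_add,
    zpow_add₀ hq0, zpow_neg_one, show -((m : ℤ) - 1 - a) = -(m - a) + 1 by ring, zpow_add_one₀ hq0]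
  field_simp
  ring

theorem Lam_pos (hqe : (p : ℝ) ^ f = q) (hq : 1 < q) {a : ℤ} (h0 : 0 ≤ a) (h1 : a ≤ (m : ℤ) - 1) :
    0 < Lam p f m a := by
  have h := Lam_eq hqe hq h0 h1
  have h2 := mul_pos (kerSum_pos (m := m) hq (by lia) a) (by linarith : 0 < q - 1)
  rw [← h] at h2
  exact pos_of_mul_pos_right h2 (by linarith)

theorem upperRows_iff (hqe : (p : ℝ) ^ f = q) (hq : 1 < q) (hm : 0 < m) (c : ℤ → ℝ) :
    UpperRows q m (q ^ 2 / (m * (q - 1) ^ 2)) 0 c ↔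
      (2 ≤ m → c ((m : ℤ) - 2) = c ((m : ℤ) - 1) - (p : ℝ) ^ f / (m * Lam p f m ((m : ℤ) - 2))) ∧
      ∀ a : ℤ, 0 ≤ a → a < (m : ℤ) - 2 →
        c a = (Lam p f m a + Lam p f m (a + 2)) / Lam p f m a * c (a + 1) -
          Lam p f m (a + 2) / Lam p f m a * c (a + 2) - ((p : ℝ) ^ f - 1) / (m * Lam p f m a) := by
  have hq0 : q ≠ 0 := by linarith
  have hq1 : q - 1 ≠ 0 := by linarith
  have hm0 : (m : ℝ) ≠ 0 := by positivity
  have hw : ∀ a : ℤ, 0 ≤ a → a ≤ (m : ℤ) - 1 → kerSum q m a = q * Lam p f m a / (q - 1) :=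
    fun a h0 h1 => by
      rw [Lam_eq hqe hq h0 h1]
      field_simp
  have htop : 2 ≤ m → (kerSum q m ((m : ℤ) - 2) * (c ((m : ℤ) - 2) - c ((m : ℤ) - 1)) =
      -(q ^ 2 / (m * (q - 1) ^ 2)) * (q - 1) ↔
      c ((m : ℤ) - 2) = c ((m : ℤ) - 1) - (p : ℝ) ^ f / (m * Lam p f m ((m : ℤ) - 2))) := by
    intro h
    have hL := (Lam_pos (m := m) hqe hq (a := (m : ℤ) - 2) (by lia) (by lia)).ne'
    rw [hw _ (by lia) (by lia), hqe]
    generalize Lam p f m ((m : ℤ) - 2) = l at *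
    constructor
    · intro e
      have : c ((m : ℤ) - 2) - c ((m : ℤ) - 1) = (q - 1) / (q * l) *
        (q * l / (q - 1) * (c ((m : ℤ) - 2) - c ((m : ℤ) - 1))) := by field_simp
      rw [e] at this
      rw [eq_add_of_sub_eq this]
      field_simp
      ring
    · intro e
      rw [e]
      field_simp
      ring
  have hmid : ∀ a : ℤ, 0 ≤ a → a < (m : ℤ) - 2 →
      (kerSum q m a * (c a - c (a + 1)) + kerSum q m (a + 2) * (c (a + 2) - c (a + 1)) =
        -(q ^ 2 / (m * (q - 1) ^ 2)) * (q + q⁻¹ - 2) ↔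
        c a = (Lam p f m a + Lam p f m (a + 2)) / Lam p f m a * c (a + 1) -
          Lam p f m (a + 2) / Lam p f m a * c (a + 2) -
            ((p : ℝ) ^ f - 1) / (m * Lam p f m a)) := by
    intro a h0 h1
    have hL := (Lam_pos (m := m) hqe hq (a := a) (by lia) (by lia)).ne'
    rw [hw _ (by lia) (by lia), hw _ (by lia) (by lia), hqe]
    generalize Lam p f m a = l at *
    generalize Lam p f m (a + 2) = l' at *
    constructor
    · intro e
      have : c a - c (a + 1) = (q - 1) / (q * l) * (q * l / (q - 1) * (c a - c (a + 1)) +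
          q * l' / (q - 1) * (c (a + 2) - c (a + 1))) - l' / l * (c (a + 2) - c (a + 1)) := by
        field_simp
        ring
      rw [e] at this
      rw [eq_add_of_sub_eq this]
      field_simp
      ring
    · intro e
      rw [e]
      field_simp
      ring
  constructor
  · intro h
    refine ⟨fun h2 => (htop h2).1 (h.top (by lia)), fun a h0 h1 => (hmid a h0 h1).1 ?_⟩
    have := h.mid (a + 1) (by lia) (by lia)
    rwa [add_sub_cancel_right, add_assoc, one_add_one_eq_two] at this
  · rintro ⟨h1, h2⟩
    refine ⟨fun h => (htop (by lia)).2 (h1 (by lia)), fun a h3 h4 => ?_⟩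
    have := (hmid (a - 1) (by lia) (by lia)).2 (h2 (a - 1) (by lia) (by lia))
    rwa [sub_add_cancel, show a - 1 + 2 = a + 1 by ring] at this

theorem isRecurrent_iff (hqe : (p : ℝ) ^ f = q) (hq : 1 < q) (hm : 0 < m) {β : ℤ → ℝ}
    (hβ : ∀ r, 0 ≤ r → r ≤ (m : ℤ) - 1 →
      β r * kerSum q m r = q ^ 2 / (m * (q - 1) ^ 2) * m) (C : ℤ → ℤ → ℝ) :
    ((∀ q r : ℤ, 0 ≤ q → q ≤ (m : ℤ) - 1 → 0 ≤ r → r ≤ (m : ℤ) - 1 → C q r = C r q) ∧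
      ∀ r, 0 ≤ r → r ≤ (m : ℤ) - 1 →
        ColumnEq q m (q ^ 2 / (m * (q - 1) ^ 2)) (β r) r fun a => C a r) ↔
    IsRecurrent p f m C := by
  rw [symm_columnEq_iff hq hm hβ, upperRows_iff hqe hq hm]
  exact ⟨fun ⟨⟨h1, h2⟩, h3, h4⟩ => ⟨h1, h2, h3, h4⟩,
    fun h => ⟨⟨h.step_last, h.step⟩, h.lower, h.upper⟩⟩

/-- The first column of the array, from the bottom up. -/
noncomputable def firstColumn (p f m : ℕ) (c : ℝ) : ℕ → ℝ
  | 0 => c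
  | 1 => c - (p : ℝ) ^ f / (m * Lam p f m ((m : ℤ) - 2))
  | i + 2 =>
    (Lam p f m ((m : ℤ) - 3 - i) + Lam p f m ((m : ℤ) - 3 - i + 2)) /
        Lam p f m ((m : ℤ) - 3 - i) * firstColumn p f m c (i + 1) -
      Lam p f m ((m : ℤ) - 3 - i + 2) / Lam p f m ((m : ℤ) - 3 - i) * firstColumn p f m c i -
      ((p : ℝ) ^ f - 1) / (m * Lam p f m ((m : ℤ) - 3 - i))

theorem exists_isRecurrent (hm : 0 < m) (c : ℝ) :
    ∃ C : ℤ → ℤ → ℝ, IsRecurrent p f m C ∧ C ((m : ℤ) - 1) 0 = c := by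
  set g : ℤ → ℝ := fun a => firstColumn p f m c ((m : ℤ) - 1 - a).toNat with hg
  have hgtop : g ((m : ℤ) - 1) = c := by simp [hg, firstColumn]
  set C : ℤ → ℤ → ℝ := fun a r => if r ≤ a then g a + g ((m : ℤ) - 1 - r) - g ((m : ℤ) - 1)
    else g ((m : ℤ) - 1 - a) + g r - g ((m : ℤ) - 1) with hC
  have hC0 : ∀ a, 0 ≤ a → C a 0 = g a := by
    intro a h0
    simp only [hC, if_pos h0, sub_zero, add_sub_cancel_right]
  refine ⟨C, ⟨fun h2 => ?_, fun a h0 h1 => ?_, fun a r h0 h1 h2 => ?_, fun a r h0 h1 h2 => ?_⟩, ?_⟩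
  · rw [hC0 _ (by lia), hC0 _ (by lia), hgtop]
    simp only [hg]
    rw [show ((m : ℤ) - 1 - (m - 2)).toNat = 1 by lia, firstColumn]
  · rw [hC0 _ (by lia), hC0 _ (by lia), hC0 _ (by lia)]
    -- The index of `firstColumn` counts from the last row: i stands for row m - 1 - i, so the
    -- recursive clause at i + 2 is row m - 3 - i.
    obtain ⟨i, rfl⟩ : ∃ i : ℕ, a = (m : ℤ) - 3 - i := ⟨((m : ℤ) - 3 - a).toNat, by lia⟩
    simp only [hg]
    rw [show ((m : ℤ) - 1 - (m - 3 - i)).toNat = i + 2 by lia,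
      show ((m : ℤ) - 1 - (m - 3 - i + 1)).toNat = i + 1 by lia,
      show ((m : ℤ) - 1 - (m - 3 - i + 2)).toNat = i by lia, firstColumn]
  · rw [hC0 _ (by lia), hC0 _ (by lia), hC0 _ (by lia)]
    simp only [hC, if_pos h1]
  · rw [hC0 _ (by lia), hC0 _ (by lia), hC0 _ (by lia)]
    by_cases h : r ≤ a
    · obtain rfl : a = r := le_antisymm h1 h
      simp only [hC, le_refl, if_true]
      ring
    · simp only [hC, if_neg h]
  · rw [hC0 _ (by lia), hgtop]

end Recurrence

end TateGreen

/-! ### The logarithmic series and the array on the curve -/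

namespace TateGreen

namespace LocalField

variable {p f : ℕ} {K : Type*} [NormedField K] [MeasurableSpace K] {π : K} {μ : Measure K} {q : ℝ}
  {m : ℕ}

theorem p_zpow (L : LocalField p f π μ q) (k : ℤ) : (p : ℝ) ^ (-((f : ℤ) * k)) = q ^ (-k) := by
  rw [← L.q_eq, ← zpow_natCast (p : ℝ) f, ← zpow_mul, mul_neg]

theorem UK_eq (L : LocalField p f π μ q) (y : K) :
    UK p f π m y = q ^ (-valK π y) + q ^ (-((m : ℤ) - 1 - valK π y)) := by
  rw [UK, L.p_zpow, L.p_zpow]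

theorem UK_nonneg (L : LocalField p f π μ q) (y : K) : 0 ≤ UK p f π m y := by
  rw [L.UK_eq]
  have h := fun k : ℤ => zpow_pos L.q_pos k
  exact (add_pos (h _) (h _)).le

theorem lambdaK_succ (L : LocalField p f π μ q) (lam0 : ℝ) (n : ℕ) (y : K) :
    lambdaK p f π m lam0 (n + 1) y = lamSeq q (UK p f π m y) lam0 n := by
  rw [lambdaK, lamSeq, pow_mul, pow_mul, L.q_eq]

/-- The absolute value is a power of the norm. -/
theorem absK_eq_rpow (L : LocalField p f π μ q) (x : K) :
    absK p f π x = ‖x‖ ^ (Real.log q / -Real.log ‖π‖) := by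
  have h1 : 0 < Real.log q := Real.log_pos L.one_lt_q
  have h2 : Real.log ‖π‖ < 0 := Real.log_neg L.pi_pos L.pi_lt
  by_cases hx : x = 0
  · rw [hx, absK, if_pos rfl, norm_zero, Real.zero_rpow (div_pos h1 (by linarith)).ne']
  · rw [L.absK_of_ne hx, L.norm_eq x hx, ← Real.rpow_intCast ‖π‖, ← Real.rpow_mul L.pi_pos.le,
      Real.rpow_def_of_pos L.pi_pos, ← Real.rpow_intCast q, Real.rpow_def_of_pos L.q_pos]
    congr 1
    push_cast
    field_simp
    rw [mul_div_assoc, div_self h2.ne, mul_one]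

/-- The valuation is defined by choice, so measurability is taken from the expression as a power of
the norm. -/
theorem measurable_absK [BorelSpace K] (L : LocalField p f π μ q) :
    Measurable (absK p f π) := by
  have : absK p f π = fun x => ‖x‖ ^ (Real.log q / -Real.log ‖π‖) := funext L.absK_eq_rpow
  rw [this]
  fun_prop

theorem measurable_density [BorelSpace K] (L : LocalField p f π μ q) :
    Measurable fun x : K => ENNReal.ofReal (absK p f π x)⁻¹ :=
  L.measurable_absK.inv.ennreal_ofReal

theorem setIntegral_mulMeasure [BorelSpace K] (L : LocalField p f π μ q) (g : K → ℝ) {S : Set K}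
    (hS : MeasurableSet S) :
    ∫ x in S, g x ∂(mulMeasure p f μ π) = ∫ x in S, (absK p f π x)⁻¹ * g x ∂μ := by
  rw [mulMeasure, setIntegral_withDensity_eq_setIntegral_toReal_smul L.measurable_density
    (Filter.Eventually.of_forall fun x => ENNReal.ofReal_lt_top) _ hS]
  refine setIntegral_congr_fun hS fun x _ => ?_
  simp only [ENNReal.toReal_ofReal (inv_nonneg.2 (L.absK_nonneg x)), smul_eq_mul]

/-- The coefficient `β` of the column equation. -/
theorem beta_mul_kerSum (L : LocalField p f π μ q) (hm : 0 < m) (r : ℤ) :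
    q ^ 2 / ((q - 1) ^ 2 * kerSum q m r) * kerSum q m r = q ^ 2 / (m * (q - 1) ^ 2) * m := by
  have hw := (kerSum_pos L.one_lt_q hm r).ne'
  have hq1 : q - 1 ≠ 0 := by linarith [L.two_le]
  have hm0 : (m : ℝ) ≠ 0 := by positivity
  field_simp

/-- An explicit point realizes each relative distance q^(-k) with k ≥ 1. Positivity of k keeps 1 +
π^k a unit. -/
theorem valK_mul_one_add (L : LocalField p f π μ q) {y : K} (hy : y ≠ 0) {k : ℕ} (hk : 0 < k) :
    y * (1 + π ^ k) ≠ y ∧ y * (1 + π ^ k) ≠ 0 ∧ valK π (y * (1 + π ^ k)) = valK π y ∧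
      relVal π (y * (1 + π ^ k)) y = k := by
  have hπ : π ≠ 0 := norm_pos_iff.1 L.pi_pos
  have h1 : y * (1 + π ^ k) - y = y * π ^ k := by ring
  have h2 : y * (1 + π ^ k) - y ≠ 0 := h1 ▸ mul_ne_zero hy (pow_ne_zero _ hπ)
  have h3 : valK π (y * (1 + π ^ k) - y) = valK π y + k := by
    apply L.valK_eq_of_norm
    rw [h1, norm_mul, norm_pow, L.norm_eq y hy, zpow_add₀ L.pi_pos.ne', zpow_natCast]
  have h4 := L.valK_of_lt (x := y) (z := y * (1 + π ^ k)) hy fun _ => by lia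
  exact ⟨sub_ne_zero.1 h2, h4.1, h4.2, by rw [relVal, h3]; lia⟩

section

variable [Fact p.Prime] [NormedAlgebra ℚ_[p] K]

/-- The denominator in the value of D B is a kernel sum. Its positivity gives the convergence
condition U < q + 1. -/
theorem UK_eq_kerSum (L : LocalField p f π μ q) {y : K} (hy : y ∈ domainE p π m) :
    q + 1 - UK p f π m y = kerSum q m (valK π y) * (q - 1) := by
  have hq1 : q - 1 ≠ 0 := by linarith [L.two_le]
  have := L.mem_domainE.1 hy
  rw [kerSum_eq L.one_lt_q this.2.1 (by lia), L.UK_eq, div_mul_cancel₀ _ hq1]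

theorem UK_lt (L : LocalField p f π μ q) {y : K} (hy : y ∈ domainE p π m) :
    UK p f π m y < q + 1 := by
  have hv := L.mem_domainE.1 hy
  have h := L.UK_eq_kerSum hy
  have := mul_pos (kerSum_pos (m := m) L.one_lt_q (by lia) (valK π y))
    (by linarith [L.two_le] : 0 < q - 1)
  linarith

theorem exists_mem_domainE (L : LocalField p f π μ q) {a : ℤ} (h0 : 0 ≤ a)
    (h1 : a ≤ (m : ℤ) - 1) : ∃ x ∈ domainE p π m, valK π x = a := by
  have hπ : π ≠ 0 := norm_pos_iff.1 L.pi_pos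
  have hv : valK π (π ^ a) = a := L.valK_eq_of_norm (norm_zpow _ _)
  exact ⟨π ^ a, L.mem_domainE.2 ⟨zpow_ne_zero _ hπ, by lia, by lia⟩, hv⟩

theorem exists_relVal_eq (L : LocalField p f π μ q) {y : K} (hy : y ∈ domainE p π m) {k : ℕ}
    (hk : 0 < k) : ∃ x ∈ domainE p π m, x ≠ y ∧ valK π x = valK π y ∧ relVal π x y = k := by
  rw [L.mem_domainE] at hy
  obtain ⟨h1, h2, h3, h4⟩ := L.valK_mul_one_add hy.1 hk
  exact ⟨_, L.mem_domainE.2 ⟨h2, by rw [h3]; exact hy.2⟩, h1, h3, h4⟩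

theorem exists_pair (L : LocalField p f π μ q) {a r : ℤ} (h0 : 0 ≤ a)
    (h1 : a ≤ (m : ℤ) - 1) (h2 : 0 ≤ r) (h3 : r ≤ (m : ℤ) - 1) :
    ∃ x ∈ domainE p π m, ∃ y ∈ domainE p π m, x ≠ y ∧ valK π x = a ∧ valK π y = r := by
  obtain ⟨x, hx, hxa⟩ := L.exists_mem_domainE h0 h1
  obtain ⟨y, hy, hyr⟩ := L.exists_mem_domainE h2 h3
  by_cases h : a = r
  · obtain ⟨z, hz, hzy, hv, -⟩ := L.exists_relVal_eq hy one_pos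
    exact ⟨z, hz, y, hy, hzy, by rw [hv, hyr, h], hyr⟩
  · exact ⟨x, hx, y, hy, fun h' => h (by rw [← hxa, h', hyr]), hxa, hyr⟩

theorem logSeries_eq (L : LocalField p f π μ q) (lam0 : ℝ) (A : K → ℝ) (lam : ℕ → K → ℝ) {x y : K}
    (hx : x ∈ domainE p π m) (hy : y ∈ domainE p π m) (hxy : x ≠ y) :
    logSeries p f π lam0 A lam x y =
      seqLog q (A y) lam0 (fun n => lam (n + 1) y) (relVal π x y) := by
  rw [logSeries, seqLog, L.dist01_eq (L.mem_domainE.1 hx).1 (L.mem_domainE.1 hy).1 hxy, L.q_eq,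
    Real.logb_inv, Real.logb_pow, Real.logb_self_eq_one L.one_lt_q]
  ring

theorem summable_lambdaK (L : LocalField p f π μ q) (lam0 : ℝ) {y : K} (hy : y ∈ domainE p π m) :
    Summable fun n : ℕ => |lambdaK p f π m lam0 (n + 1) y| := by
  simp_rw [L.lambdaK_succ]
  exact summable_lamSeq L.one_lt_q (L.UK_nonneg y) (L.UK_lt hy) lam0

theorem lap_add (φ ψ : K → ℝ) {x : K}
    (hφ : IntegrableOn (lapIntegrand p f π φ x) (domainE p π m) μ)
    (hψ : IntegrableOn (lapIntegrand p f π ψ x) (domainE p π m) μ) :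
    IntegrableOn (lapIntegrand p f π (fun z => φ z + ψ z) x) (domainE p π m) μ ∧
      lap p f μ π m (fun z => φ z + ψ z) x = lap p f μ π m φ x + lap p f μ π m ψ x := by
  have h : lapIntegrand p f π (fun z => φ z + ψ z) x =
      fun z => lapIntegrand p f π φ x z + lapIntegrand p f π ψ x z := by
    funext z
    simp only [lapIntegrand]
    ring
  rw [lap, h]
  exact ⟨hφ.add hψ, integral_add hφ hψ⟩

theorem absK_mem (L : LocalField p f π μ q) {x : K} (hx : x ∈ domainE p π m) :
    0 < absK p f π x ∧ absK p f π x ≤ 1 ∧ (absK p f π x)⁻¹ ≤ q ^ m := by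
  obtain ⟨h0, h1, h2⟩ := L.mem_domainE.1 hx
  rw [L.absK_of_ne h0, ← zpow_neg, neg_neg, ← zpow_natCast q m]
  exact ⟨zpow_pos L.q_pos _, zpow_le_one_of_nonpos₀ L.one_lt_q.le (by lia),
    zpow_le_zpow_right₀ L.one_lt_q.le h2.le⟩

theorem integrableOn_const_domainE (L : LocalField p f π μ q) (c : ℝ) :
    IntegrableOn (fun _ => c) (domainE p π m) μ := by
  rw [L.domainE_eq_iUnion]
  exact integrableOn_finset_iUnion.2 fun j _ => integrableOn_const (L.measure_shell_ne_top 0 j)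

variable [BorelSpace K]

/-- One formula covers d = 1 and d < 1: at k = 0 only the tail of `seqLap` remains, and for k > 0
the valuations agree, so the prefactor is 1. -/
theorem lap_eq_seqLap (L : LocalField p f π μ q) {x y : K} (hx : x ∈ domainE p π m)
    (hy : y ∈ domainE p π m) (hxy : x ≠ y) {Ψ : ℕ → ℝ}
    (hΨ : Summable fun l => |Ψ l| * (q ^ l)⁻¹) {F : K → ℝ}
    (hF : ∀ z ∈ domainE p π m, z ≠ y → F z = Ψ (relVal π z y)) :
    IntegrableOn (lapIntegrand p f π F x) (domainE p π m) μ ∧ lap p f μ π m F x =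
      q ^ (-|valK π x - valK π y|) * seqLap q (UK p f π m y) Ψ (relVal π x y) := by
  rcases Nat.eq_zero_or_pos (relVal π x y) with h | h
  · have := L.lap_of_relVal_eq_zero hx hy hxy h hΨ hF
    refine ⟨this.1, ?_⟩
    have hs : Summable fun l => (Ψ (l + 0) - Ψ 0) * (q ^ l)⁻¹ := by
      have := L.summable_shift hΨ 0 (Ψ 0)
      refine Summable.of_norm_bounded this fun l => ?_
      rw [norm_mul, Real.norm_eq_abs, Real.norm_of_nonneg (inv_nonneg.2 (pow_pos L.q_pos l).le)]
    rw [this.2, h, seqLap, hs.tsum_eq_zero_add]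
    simp
  · have := L.lap_of_relVal_pos hx hy hxy rfl h hΨ hF
    refine ⟨this.1, ?_⟩
    have hv : valK π x = valK π y := (L.valK_of_lt (L.mem_domainE.1 hy).1 fun _ => by
      rw [relVal] at h
      lia).2
    have hq := L.q_pos.ne'
    have hU := L.UK_eq_kerSum hy
    have h1 : (1 - q⁻¹) * (kerSum q m (valK π y) - 1) - q⁻¹ = (1 - UK p f π m y) * q⁻¹ := by
      field_simp
      linarith
    rw [this.2, h1, hv, sub_self, abs_zero, neg_zero, zpow_zero, one_mul, seqLap]

theorem lap_logSeries (L : LocalField p f π μ q) (lam0 : ℝ) (A : K → ℝ) {lam : ℕ → K → ℝ} {x y : K}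
    (hx : x ∈ domainE p π m) (hy : y ∈ domainE p π m) (hxy : x ≠ y)
    (hl : Summable fun n => |lam (n + 1) y|) :
    IntegrableOn (lapIntegrand p f π (fun z => logSeries p f π lam0 A lam z y) x)
        (domainE p π m) μ ∧
      lap p f μ π m (fun z => logSeries p f π lam0 A lam z y) x =
        q ^ (-|valK π x - valK π y|) * seqLap q (UK p f π m y)
          (seqLog q (A y) lam0 fun n => lam (n + 1) y) (relVal π x y) :=
  L.lap_eq_seqLap hx hy hxy (summable_seqLog L.one_lt_q (A y) lam0 hl)
    fun _ hz hzy => L.logSeries_eq lam0 A lam hz hy hzy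

theorem lap_logSeries_lamSeq (L : LocalField p f π μ q) (lam0 : ℝ) (A : K → ℝ) {lam : ℕ → K → ℝ}
    {x y : K} (hx : x ∈ domainE p π m) (hy : y ∈ domainE p π m) (hxy : x ≠ y)
    (hl : (fun n => lam (n + 1) y) = lamSeq q (UK p f π m y) lam0) :
    IntegrableOn (lapIntegrand p f π (fun z => logSeries p f π lam0 A lam z y) x)
        (domainE p π m) μ ∧
      lap p f μ π m (fun z => logSeries p f π lam0 A lam z y) x =
        q ^ (-|valK π x - valK π y|) *
          (-lam0 * (1 / (q - 1)) * ((q + 1) / (q + 1 - UK p f π m y))) := by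
  have hs := summable_lamSeq L.one_lt_q (L.UK_nonneg y) (L.UK_lt hy) lam0
  have h := L.lap_logSeries lam0 A (lam := lam) hx hy hxy (by
    rw [← hl] at hs
    exact hs)
  rwa [hl, seqLap_lamSeq L.one_lt_q (L.UK_nonneg y) (L.UK_lt hy)] at h

/-- The coefficients of the series are forced by independence of the distance. -/
theorem eq_lamSeq_of_lap (L : LocalField p f π μ q) (lam0 : ℝ) (A : K → ℝ) {lam : ℕ → K → ℝ}
    {y : K} (hy : y ∈ domainE p π m) (hl : Summable fun n => |lam (n + 1) y|)
    (h : ∀ x ∈ domainE p π m, ∀ x' ∈ domainE p π m, x ≠ y → x' ≠ y → valK π x = valK π x' →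
      lap p f μ π m (fun z => logSeries p f π lam0 A lam z y) x =
        lap p f μ π m (fun z => logSeries p f π lam0 A lam z y) x') :
    (fun n => lam (n + 1) y) = lamSeq q (UK p f π m y) lam0 := by
  set Ψ := seqLog q (A y) lam0 fun n => lam (n + 1) y with hΨ
  -- Only k ≥ 1 is compared: points at those distances share the valuation of y and exist for every
  -- k. Points with d = 1 and that valuation need not exist when q = 2.
  have hconst : ∀ k : ℕ, 1 ≤ k → seqLap q (UK p f π m y) Ψ k = seqLap q (UK p f π m y) Ψ 1 := by
    intro k hk
    obtain ⟨x, hx, hxy, hxv, hxk⟩ := L.exists_relVal_eq hy hk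
    obtain ⟨x', hx', hxy', hxv', hxk'⟩ := L.exists_relVal_eq hy one_pos
    have := h x hx x' hx' hxy hxy' (hxv.trans hxv'.symm)
    rw [(L.lap_logSeries lam0 A hx hy hxy hl).2, (L.lap_logSeries lam0 A hx' hy hxy' hl).2, hxv,
      hxv', hxk, hxk', sub_self, abs_zero, neg_zero, zpow_zero, one_mul, one_mul] at this
    exact this
  rw [← eq_lamSeq_iff L.one_lt_q]
  refine coeff_eq_zero_of_const L.one_lt_q (summable_coeff L.one_lt_q _ hl)
    (κ := seqLap q (UK p f π m y) Ψ 1 - seqLap q (UK p f π m y) Ψ 0) fun k hk => ?_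
  rw [← hconst k hk]
  exact hasSum_seqLap_sub L.one_lt_q _ (A y) lam0 hl k

theorem lap_BKm (L : LocalField p f π μ q) (lam0 : ℝ) {x y : K} (hx : x ∈ domainE p π m)
    (hy : y ∈ domainE p π m) (hxy : x ≠ y) :
    IntegrableOn (lapIntegrand p f π (fun z => BKm p f π m lam0 z y) x) (domainE p π m) μ ∧
      lap p f μ π m (fun z => BKm p f π m lam0 z y) x =
        q ^ (-|valK π x - valK π y|) *
          (-lam0 * (1 / (q - 1)) * ((q + 1) / (q + 1 - UK p f π m y))) :=
  L.lap_logSeries_lamSeq lam0 _ hx hy hxy (funext fun n => L.lambdaK_succ lam0 n y)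

/-- The Laplacian of `B + C`. -/
theorem lap_BKm_add (L : LocalField p f π μ q) (lam0 : ℝ) (C : ℤ → ℤ → ℝ) {x y : K}
    (hx : x ∈ domainE p π m) (hy : y ∈ domainE p π m) (hxy : x ≠ y) :
    IntegrableOn (lapIntegrand p f π
        (fun z => BKm p f π m lam0 z y + C (valK π z) (valK π y)) x) (domainE p π m) μ ∧
      lap p f μ π m (fun z => BKm p f π m lam0 z y + C (valK π z) (valK π y)) x =
        -lam0 * ((q + 1) / ((q - 1) ^ 2 * kerSum q m (valK π y))) *
            q ^ (-|valK π x - valK π y|) +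
          (1 - q⁻¹) * (kerConv q m (fun a => C a (valK π y)) (valK π x) -
            kerSum q m (valK π x) * C (valK π x) (valK π y)) := by
  have h1 := L.lap_BKm lam0 hx hy hxy
  have h2 := L.lap_comp_valK hx (fun a => C a (valK π y))
  have h3 := lap_add _ _ h1.1 h2.1
  refine ⟨h3.1, ?_⟩
  have hw := (kerSum_pos (m := m) L.one_lt_q
    (by have := L.mem_domainE.1 hy; lia) (valK π y)).ne'
  have hq1 : q - 1 ≠ 0 := by linarith [L.two_le]
  rw [h3.2, h1.2, h2.2, L.UK_eq_kerSum hy]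
  congr 1
  · field_simp
  · congr 1
    rw [kerConv, kerSum, Finset.sum_mul, ← Finset.sum_sub_distrib]
    exact Finset.sum_congr rfl fun j _ => by ring

/-- On the fundamental domain the density and its inverse are bounded, by q^m and 1 respectively. -/
theorem integrableOn_mulMeasure_iff (L : LocalField p f π μ q) (g : K → ℝ) :
    IntegrableOn g (domainE p π m) (mulMeasure p f μ π) ↔ IntegrableOn g (domainE p π m) μ := by
  have hE := L.measurableSet_domainE m
  have h1 : IntegrableOn g (domainE p π m) (mulMeasure p f μ π) ↔
      IntegrableOn (fun x => (absK p f π x)⁻¹ * g x) (domainE p π m) μ := by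
    rw [IntegrableOn, mulMeasure, restrict_withDensity hE,
      integrable_withDensity_iff_integrable_smul' L.measurable_density
        (Filter.Eventually.of_forall fun x => ENNReal.ofReal_lt_top), IntegrableOn]
    refine integrable_congr (Filter.Eventually.of_forall fun x => ?_)
    simp only [ENNReal.toReal_ofReal (inv_nonneg.2 (L.absK_nonneg x)), smul_eq_mul]
  rw [h1]
  constructor
  · intro h
    have := Integrable.bdd_mul (c := 1) h (f := absK p f π)
      L.measurable_absK.aestronglyMeasurable (by
        filter_upwards [ae_restrict_mem hE] with x hx
        rw [Real.norm_of_nonneg (L.absK_nonneg x)]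
        exact (L.absK_mem hx).2.1)
    refine this.congr ?_
    filter_upwards [ae_restrict_mem hE] with x hx
    rw [mul_inv_cancel_left₀ (L.absK_mem hx).1.ne']
  · intro h
    refine Integrable.bdd_mul (c := q ^ m) h L.measurable_absK.inv.aestronglyMeasurable ?_
    filter_upwards [ae_restrict_mem hE] with x hx
    rw [Real.norm_of_nonneg (inv_nonneg.2 (L.absK_nonneg x))]
    exact (L.absK_mem hx).2.2

theorem integral_inv_absK (L : LocalField p f π μ q) :
    ∫ x in domainE p π m, (absK p f π x)⁻¹ ∂μ = m * (1 - q⁻¹) := by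
  have hq := L.q_pos
  rw [L.domainE_eq_iUnion, (integral_of_const_on_pieces (μ := μ) (Finset.range m)
    (fun j : ℕ => shell π 0 (j : ℤ)) (fun j _ => L.measurableSet_shell 0 j)
    (fun i _ j _ hij => disjoint_shell π 0 (by simpa using hij))
    (fun j _ => L.measure_shell_ne_top 0 j) (fun x => (absK p f π x)⁻¹) (fun j => q ^ (j : ℤ)) (by
      rintro j - z ⟨hz, hv⟩
      rw [sub_zero] at hv
      rw [L.absK_of_ne hz, hv, zpow_neg, inv_inv])).2]
  have h : ∀ j ∈ Finset.range m, q ^ (j : ℤ) * μ.real (shell π 0 (j : ℤ)) = 1 - q⁻¹ := by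
    intro j _
    rw [L.measureReal_shell, zpow_neg]
    have := zpow_pos hq (j : ℤ)
    field_simp
  rw [Finset.sum_congr rfl h, Finset.sum_const, Finset.card_range, nsmul_eq_mul]

theorem vol_eq (L : LocalField p f π μ q) : vol p f μ π m = m * (1 - q⁻¹) := by
  rw [← L.integral_inv_absK (m := m), vol, ← measureReal_def, ← mul_one (Measure.real _ _),
    ← smul_eq_mul, ← setIntegral_const, L.setIntegral_mulMeasure _ (L.measurableSet_domainE m)]
  simp

/-- The equation for `B + C` in terms of the array `C`. -/
theorem forall_lap_BKm_add_iff (L : LocalField p f π μ q) (lam0 : ℝ) (C : ℤ → ℤ → ℝ) :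
    (∀ x ∈ domainE p π m, ∀ y ∈ domainE p π m, x ≠ y →
      lap p f μ π m (fun z => BKm p f π m lam0 z y + C (valK π z) (valK π y)) x =
        -(1 / vol p f μ π m)) ↔
    ∀ r : ℤ, 0 ≤ r → r ≤ (m : ℤ) - 1 → ∀ a : ℤ, 0 ≤ a → a ≤ (m : ℤ) - 1 →
      -lam0 * ((q + 1) / ((q - 1) ^ 2 * kerSum q m r)) * q ^ (-|a - r|) +
        (1 - q⁻¹) * (kerConv q m (fun a => C a r) a - kerSum q m a * C a r) =
        -(1 / (m * (1 - q⁻¹))) := by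
  rw [← L.vol_eq]
  constructor
  · intro h r h2 h3 a h0 h1
    obtain ⟨x, hx, y, hy, hxy, rfl, rfl⟩ := L.exists_pair h0 h1 h2 h3
    rw [← h x hx y hy hxy, (L.lap_BKm_add lam0 C hx hy hxy).2]
  · intro h x hx y hy hxy
    have hx' := L.mem_domainE.1 hx
    have hy' := L.mem_domainE.1 hy
    rw [(L.lap_BKm_add lam0 C hx hy hxy).2]
    exact h _ hy'.2.1 (by lia) _ hx'.2.1 (by lia)

/-- Dividing by 1 - q⁻¹ normalizes the equation; the value of `lam0` cancels q + 1 and gives the β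
compatible with the zero column sum. -/
theorem forall_lap_iff_columnEq (L : LocalField p f π μ q) (hm : 0 < m) {lam0 : ℝ}
    (h0 : lam0 = q * (q - 1) / (q + 1)) (C : ℤ → ℤ → ℝ) :
    (∀ x ∈ domainE p π m, ∀ y ∈ domainE p π m, x ≠ y →
      lap p f μ π m (fun z => BKm p f π m lam0 z y + C (valK π z) (valK π y)) x =
        -(1 / vol p f μ π m)) ↔
    ∀ r : ℤ, 0 ≤ r → r ≤ (m : ℤ) - 1 → ColumnEq q m (q ^ 2 / (m * (q - 1) ^ 2))
      (q ^ 2 / ((q - 1) ^ 2 * kerSum q m r)) r fun a => C a r := by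
  rw [L.forall_lap_BKm_add_iff]
  refine forall₃_congr fun r _ _ => forall₃_congr fun a _ _ => ?_
  have hq := L.q_pos
  have hq1 : q - 1 ≠ 0 := by linarith [L.two_le]
  have hq2 : q + 1 ≠ 0 := by linarith
  have hw := (kerSum_pos L.one_lt_q hm r).ne'
  have hm0 : (m : ℝ) ≠ 0 := by positivity
  have h1 : 1 - q⁻¹ = (q - 1) / q := by field_simp
  rw [h0, h1]
  generalize q ^ (-|a - r|) = t
  generalize kerConv q m (fun a => C a r) a - kerSum q m a * C a r = X
  generalize kerSum q m r = w at *
  constructor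
  · intro h
    have h2 : X = q / (q - 1) * (-(q * (q - 1) / (q + 1)) * ((q + 1) / ((q - 1) ^ 2 * w)) * t +
        (q - 1) / q * X) + q ^ 2 / ((q - 1) ^ 2 * w) * t := by
      field_simp
      ring
    rw [h] at h2
    rw [h2]
    field_simp
  · intro h
    rw [h]
    field_simp
    ring

theorem lam0_eq (L : LocalField p f π μ q) (hm : 0 < m) {lam0 : ℝ} {C : ℤ → ℤ → ℝ}
    (h : ∀ x ∈ domainE p π m, ∀ y ∈ domainE p π m, x ≠ y →
      lap p f μ π m (fun z => BKm p f π m lam0 z y + C (valK π z) (valK π y)) x =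
        -(1 / vol p f μ π m)) : lam0 = q * (q - 1) / (q + 1) := by
  rw [L.forall_lap_BKm_add_iff] at h
  have hq := L.q_pos
  have hq1 : q - 1 ≠ 0 := by linarith [L.two_le]
  have hq2 : q + 1 ≠ 0 := by linarith
  have hw := (kerSum_pos L.one_lt_q hm 0).ne'
  have hm0 : (m : ℝ) ≠ 0 := by positivity
  -- Summing the column r = 0 removes the unknown array by the conservation law and leaves a linear
  -- equation for `lam0`.
  have hsum : ∑ a ∈ Finset.range m,
      (-lam0 * ((q + 1) / ((q - 1) ^ 2 * kerSum q m 0)) * q ^ (-|(a : ℤ) - 0|) +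
        (1 - q⁻¹) * (kerConv q m (fun a => C a 0) a - kerSum q m a * C a 0)) =
      ∑ a ∈ Finset.range m, -(1 / (m * (1 - q⁻¹))) :=
    Finset.sum_congr rfl fun a ha => h 0 le_rfl (by lia) a (by lia) (by
      rw [Finset.mem_range] at ha
      lia)
  rw [Finset.sum_add_distrib, ← Finset.mul_sum, ← Finset.mul_sum,
    sum_kerConv_sub (fun a => C a 0), ← kerSum, Finset.sum_const, Finset.card_range, nsmul_eq_mul,
    mul_zero, add_zero] at hsum
  have h1 : 1 - q⁻¹ = (q - 1) / q := by field_simp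
  rw [h1] at hsum
  generalize kerSum q m 0 = w at *
  have h2 : lam0 = -((q - 1) ^ 2 / (q + 1)) *
      (-lam0 * ((q + 1) / ((q - 1) ^ 2 * w)) * w) := by field_simp
  rw [h2, hsum]
  field_simp

/-- The arrays `C` of the theorem are exactly the recurrent ones. -/
theorem symm_and_lap_iff_isRecurrent (L : LocalField p f π μ q) (hm : 0 < m) {lam0 : ℝ}
    (h0 : lam0 = q * (q - 1) / (q + 1)) (C : ℤ → ℤ → ℝ) :
    ((∀ q r : ℤ, 0 ≤ q → q ≤ (m : ℤ) - 1 → 0 ≤ r → r ≤ (m : ℤ) - 1 → C q r = C r q) ∧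
      ∀ x ∈ domainE p π m, ∀ y ∈ domainE p π m, x ≠ y →
      lap p f μ π m (fun z => BKm p f π m lam0 z y + C (valK π z) (valK π y)) x =
        -(1 / vol p f μ π m)) ↔ IsRecurrent p f m C := by
  rw [L.forall_lap_iff_columnEq hm h0]
  exact isRecurrent_iff L.q_eq L.one_lt_q hm (fun r _ _ => L.beta_mul_kerSum hm r) C

end

end LocalField

end TateGreen

/-! ### The distribution equation -/

namespace TateGreen

/-- The function `φ` is constant on the balls of radius `‖π‖ ^ N` in `E`. -/
def ConstOnBalls (p : ℕ) [Fact p.Prime] {K : Type*} [NormedField K] [NormedAlgebra ℚ_[p] K] (π : K)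
    (m : ℕ) (N : ℤ) (φ : K → ℝ) : Prop :=
  ∀ x ∈ domainE p π m, ∀ z ∈ domainE p π m, z ∈ Metric.closedBall x (‖π‖ ^ N) → φ z = φ x

open Classical in
/-- The kernel `1 / |z - x|_K ^ 2` of the Laplacian, truncated near the diagonal. -/
noncomputable def truncKernel (p f : ℕ) {K : Type*} [NormedField K] (π : K) (N : ℤ) (x z : K) : ℝ :=
  if dist z x ≤ ‖π‖ ^ N then 0 else (absK p f π (z - x) ^ 2)⁻¹

theorem absK_sub_comm {p f : ℕ} {K : Type*} [NormedField K] (π x y : K) :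
    absK p f π (x - y) = absK p f π (y - x) := by
  by_cases h : x = y
  · rw [h]
  · rw [absK, absK, if_neg (sub_ne_zero.2 h), if_neg (sub_ne_zero.2 (Ne.symm h)), valK_sub_comm]

theorem truncKernel_comm {p f : ℕ} {K : Type*} [NormedField K] {π : K} (N : ℤ) (x z : K) :
    truncKernel p f π N x z = truncKernel p f π N z x := by
  rw [truncKernel, truncKernel, dist_comm, absK_sub_comm]

namespace LocalField

open Metric

variable {p f : ℕ} {K : Type*} [NormedField K] [MeasurableSpace K] {π : K} {μ : Measure K} {q : ℝ}
  {m : ℕ}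

theorem isOpen_closedBall (L : LocalField p f π μ q) (c : K) (N : ℤ) :
    IsOpen (closedBall c (‖π‖ ^ N)) :=
  have := L.ultra
  IsUltrametricDist.isOpen_closedBall _ (zpow_pos L.pi_pos _).ne'

theorem self_mem_closedBall (L : LocalField p f π μ q) (c : K) (N : ℤ) :
    c ∈ closedBall c (‖π‖ ^ N) := mem_closedBall_self (zpow_pos L.pi_pos N).le

theorem norm_truncKernel_le (L : LocalField p f π μ q) (N : ℤ) (x z : K) :
    ‖truncKernel p f π N x z‖ ≤ q ^ (2 * N) := by
  rw [truncKernel]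
  split_ifs with h
  · rw [norm_zero]
    exact (zpow_pos L.q_pos _).le
  · have hzx : z ≠ x := by
      rintro rfl
      rw [dist_self] at h
      exact h (zpow_pos L.pi_pos N).le
    rw [← mem_closedBall, L.mem_closedBall_iff hzx] at h
    rw [L.absK_of_ne (sub_ne_zero.2 hzx), ← zpow_natCast, ← zpow_mul, ← zpow_neg,
      Real.norm_of_nonneg (zpow_pos L.q_pos _).le]
    exact zpow_le_zpow_right₀ L.one_lt_q.le (by push_cast; lia)

theorem measurable_truncKernel [BorelSpace K] [SecondCountableTopology K]
    (L : LocalField p f π μ q) (N : ℤ) :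
    Measurable fun x : K × K => truncKernel p f π N x.1 x.2 := by
  have h1 : Measurable fun x : K × K => absK p f π (x.2 - x.1) :=
    L.measurable_absK.comp (measurable_snd.sub measurable_fst)
  exact Measurable.ite (measurableSet_le (measurable_snd.dist measurable_fst) measurable_const)
    measurable_const (h1.pow_const 2).inv

section

variable [Fact p.Prime] [NormedAlgebra ℚ_[p] K]

theorem closedBall_inter (L : LocalField p f π μ q) {N : ℤ} (hN : (m : ℤ) ≤ N) {x z : K}
    (hx : x ∈ domainE p π m) (hz : z ∈ closedBall x (‖π‖ ^ N)) :
    z ∈ domainE p π m ∧ valK π z = valK π x := by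
  have hx' := L.mem_domainE.1 hx
  refine ⟨L.closedBall_subset_domainE hx (by lia) hz, (L.valK_of_lt hx'.1 fun h => ?_).2⟩
  rw [L.mem_closedBall_iff h] at hz
  lia

theorem isCompact_domainE [ProperSpace K] (L : LocalField p f π μ q) :
    IsCompact (domainE p π m) := by
  have := L.ultra
  rw [L.domainE_eq_iUnion]
  refine (Finset.range m).isCompact_biUnion fun j _ => ?_
  rw [L.shell_eq]
  exact (isCompact_closedBall _ _).diff (IsUltrametricDist.isOpen_closedBall _
    (zpow_pos L.pi_pos _).ne')

theorem ConstOnBalls.continuousOn (L : LocalField p f π μ q) {N : ℤ} {φ : K → ℝ}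
    (h : ConstOnBalls p π m N φ) : ContinuousOn φ (domainE p π m) := by
  intro x hx
  refine ContinuousWithinAt.congr_of_eventuallyEq (f := fun _ => φ x) continuousWithinAt_const ?_ rfl
  filter_upwards [self_mem_nhdsWithin, mem_nhdsWithin_of_mem_nhds
    ((L.isOpen_closedBall x N).mem_nhds (L.self_mem_closedBall x N))] with z hz hzx
  exact h x hx z hz hzx

theorem ConstOnBalls.isLocallyConstant (L : LocalField p f π μ q) {N : ℤ} {φ : K → ℝ}
    (h : ConstOnBalls p π m N φ) : IsLocallyConstant fun x : domainE p π m => φ x := by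
  rw [IsLocallyConstant.iff_eventually_eq]
  intro x
  filter_upwards [((L.isOpen_closedBall (x : K) N).preimage continuous_subtype_val).mem_nhds
    (L.self_mem_closedBall (x : K) N)] with z hz
  exact h x x.2 z z.2 hz

/-- A Lebesgue number for the open cover of the compact domain by the fibres gives a uniform radius.
Taking N ≥ m keeps the balls inside the domain with constant valuation. -/
theorem exists_constOnBalls [ProperSpace K] (L : LocalField p f π μ q) {φ : K → ℝ}
    (h : IsLocallyConstant fun x : domainE p π m => φ x) :
    ∃ N : ℤ, (m : ℤ) ≤ N ∧ ConstOnBalls p π m N φ := by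
  have : CompactSpace (domainE p π m) := isCompact_iff_compactSpace.1 L.isCompact_domainE
  obtain ⟨δ, hδ, hball⟩ := lebesgue_number_lemma_of_metric (s := Set.univ)
    (c := fun t : ℝ => (fun x : domainE p π m => φ x) ⁻¹' {t}) isCompact_univ
    (fun t => h.isOpen_fiber t) (fun x _ => Set.mem_iUnion.2 ⟨φ x, rfl⟩)
  obtain ⟨n, hn⟩ := exists_pow_lt_of_lt_one hδ L.pi_lt
  refine ⟨max n m, by lia, fun x hx z hz hzx => ?_⟩
  obtain ⟨t, ht⟩ := hball ⟨x, hx⟩ (Set.mem_univ _)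
  have h1 : φ x = t := ht (mem_ball_self hδ)
  have h2 : φ z = t := ht (a := ⟨z, hz⟩) (by
    rw [mem_ball, Subtype.dist_eq]
    refine (mem_closedBall.1 hzx).trans_lt (lt_of_le_of_lt ?_ hn)
    rw [← zpow_natCast]
    exact (zpow_le_zpow_iff_right_of_lt_one₀ L.pi_pos L.pi_lt).2 (le_max_left _ _))
  rw [h1, h2]

/-- Where the singular kernel is cut off the function is constant, so truncation costs nothing; the
factor |x| is cancelled by the multiplicative density. -/
theorem lapIntegrand_eq_truncKernel (L : LocalField p f π μ q) {N : ℤ} {φ : K → ℝ} {x z : K}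
    (hx : x ∈ domainE p π m) (h : z ∈ closedBall x (‖π‖ ^ N) → φ z = φ x) :
    (absK p f π x)⁻¹ * lapIntegrand p f π φ x z = (φ z - φ x) * truncKernel p f π N x z := by
  have h0 := (L.absK_mem hx).1.ne'
  rw [truncKernel, lapIntegrand]
  split_ifs with hd
  · rw [h hd]
    simp
  · field_simp

theorem lap_const_sub (φ : K → ℝ) (c : ℝ) :
    lap p f μ π m (fun z => φ z - c) = lap p f μ π m φ := by
  funext x
  simp only [lap, lapIntegrand, sub_sub_sub_cancel_right]

theorem isFiniteMeasure_restrict (L : LocalField p f π μ q) :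
    IsFiniteMeasure (μ.restrict (domainE p π m)) := by
  have := L.integrableOn_const_domainE (m := m) 1
  rwa [IntegrableOn, integrable_const_iff, or_iff_right one_ne_zero] at this

variable [BorelSpace K]

theorem inv_absK_mul_lap (L : LocalField p f π μ q) {N : ℤ} {φ : K → ℝ} {x : K}
    (hx : x ∈ domainE p π m)
    (h : ∀ z ∈ domainE p π m, z ∈ closedBall x (‖π‖ ^ N) → φ z = φ x) :
    (absK p f π x)⁻¹ * lap p f μ π m φ x =
      ∫ z in domainE p π m, (φ z - φ x) * truncKernel p f π N x z ∂μ := by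
  rw [lap, ← integral_const_mul]
  exact setIntegral_congr_fun (L.measurableSet_domainE m)
    fun z hz => L.lapIntegrand_eq_truncKernel hx (h z hz)

theorem ConstOnBalls.exists_bound [ProperSpace K] (L : LocalField p f π μ q) {N : ℤ} {φ : K → ℝ}
    (h : ConstOnBalls p π m N φ) : ∃ M, ∀ᵐ x ∂μ.restrict (domainE p π m), ‖φ x‖ ≤ M := by
  obtain ⟨M, hM⟩ := L.isCompact_domainE.exists_bound_of_continuousOn
    (ConstOnBalls.continuousOn L h)
  refine ⟨M, ?_⟩
  filter_upwards [ae_restrict_mem (L.measurableSet_domainE m)] with x hx using hM x hx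

theorem ConstOnBalls.integrableOn [ProperSpace K] (L : LocalField p f π μ q) {N : ℤ} {φ : K → ℝ}
    (h : ConstOnBalls p π m N φ) : IntegrableOn φ (domainE p π m) μ := by
  have := L.isFiniteMeasure_restrict (m := m)
  obtain ⟨M, hM⟩ := ConstOnBalls.exists_bound L h
  exact Integrable.of_bound ((ConstOnBalls.continuousOn L h).aestronglyMeasurable
    (L.measurableSet_domainE m)) M hM

/-- The Laplacian can be moved from a locally constant function to an integrable one. -/
theorem integral_mul_lap [ProperSpace K] (L : LocalField p f π μ q) {N : ℤ} {φ g : K → ℝ}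
    (hφ : ConstOnBalls p π m N φ) (hg : IntegrableOn g (domainE p π m) μ) :
    ∫ x in domainE p π m, g x * lap p f μ π m φ x ∂(mulMeasure p f μ π) =
      ∫ x in domainE p π m, φ x *
        ∫ z in domainE p π m, (g z - g x) * truncKernel p f π N x z ∂μ ∂μ := by
  have hE := L.measurableSet_domainE m
  set ν := μ.restrict (domainE p π m) with hν
  have hfin : IsFiniteMeasure ν := L.isFiniteMeasure_restrict
  obtain ⟨M, hMae⟩ := ConstOnBalls.exists_bound L hφ
  have hφm : AEStronglyMeasurable φ ν := (ConstOnBalls.continuousOn L hφ).aestronglyMeasurable hE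
  have hφi : Integrable φ ν := ConstOnBalls.integrableOn L hφ
  have hgφ : Integrable (fun x => φ x * g x) ν := Integrable.bdd_mul hg hφm hMae
  set k : K × K → ℝ := fun x => truncKernel p f π N x.1 x.2 with hk
  have hkm : AEStronglyMeasurable k (ν.prod ν) :=
    (L.measurable_truncKernel N).aestronglyMeasurable
  have hkb : ∀ᵐ x ∂(ν.prod ν), ‖k x‖ ≤ q ^ (2 * N) :=
    Filter.Eventually.of_forall fun x => L.norm_truncKernel_le N _ _
  have hA : Integrable (fun x => k x * (g x.1 * φ x.2)) (ν.prod ν) :=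
    Integrable.bdd_mul (Integrable.mul_prod hg hφi) hkm hkb
  have hB : Integrable (fun x => k x * (φ x.1 * g x.1)) (ν.prod ν) :=
    Integrable.bdd_mul (hgφ.comp_fst ν) hkm hkb
  have hC : Integrable (fun x => k x * (φ x.1 * g x.2)) (ν.prod ν) :=
    Integrable.bdd_mul (Integrable.mul_prod hφi hg) hkm hkb
  -- Exchanging the variables in the product integral, with the symmetric kernel, is the
  -- self-adjointness of D.
  have hAC : ∫ x, k x * (g x.1 * φ x.2) ∂(ν.prod ν) = ∫ x, k x * (φ x.1 * g x.2) ∂(ν.prod ν) := by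
    rw [← integral_prod_swap]
    congr 1
    funext x
    simp only [hk, Prod.fst_swap, Prod.snd_swap, truncKernel_comm N x.2]
    ring
  have h1 : ∫ x, (k x * (g x.1 * φ x.2) - k x * (φ x.1 * g x.1)) ∂(ν.prod ν) =
      ∫ x, (k x * (φ x.1 * g x.2) - k x * (φ x.1 * g x.1)) ∂(ν.prod ν) := by
    rw [integral_sub hA hB, integral_sub hC hB, hAC]
  rw [integral_prod (fun x : K × K => k x * (g x.1 * φ x.2) - k x * (φ x.1 * g x.1)) (hA.sub hB),
    integral_prod (fun x : K × K => k x * (φ x.1 * g x.2) - k x * (φ x.1 * g x.1)) (hC.sub hB)]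
    at h1
  rw [L.setIntegral_mulMeasure _ hE]
  refine Eq.trans ?_ (h1.trans ?_)
  · refine setIntegral_congr_fun hE fun x hx => ?_
    simp only
    rw [mul_left_comm, L.inv_absK_mul_lap hx (hφ x hx), ← integral_const_mul]
    congr 1
    funext z
    simp only [hk]
    ring
  · refine integral_congr_ae (Filter.Eventually.of_forall fun x => ?_)
    simp only
    rw [← integral_const_mul]
    congr 1
    funext z
    simp only [hk]
    ring

/-- A function with the right Laplacian off `y` satisfies the distribution equation at `y`. -/
theorem green_of_lap [ProperSpace K] (L : LocalField p f π μ q) (hm : 0 < m) {y : K}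
    (hy : y ∈ domainE p π m) {g : K → ℝ} (hg : IntegrableOn g (domainE p π m) μ)
    (hloc : ∀ N : ℤ, (m : ℤ) ≤ N → ∀ x ∈ domainE p π m, y ∉ closedBall x (‖π‖ ^ N) →
      ∀ z ∈ closedBall x (‖π‖ ^ N), g z = g x)
    (hlap : ∀ x ∈ domainE p π m, x ≠ y → lap p f μ π m g x = -(1 / vol p f μ π m))
    {φ : K → ℝ} (hφ : IsLocallyConstant fun x : domainE p π m => φ x) :
    ∫ x in domainE p π m, g x * lap p f μ π m φ x ∂(mulMeasure p f μ π) =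
      φ y - 1 / vol p f μ π m * ∫ x in domainE p π m, φ x ∂(mulMeasure p f μ π) := by
  have hE := L.measurableSet_domainE m
  obtain ⟨N, hN, hφN⟩ := L.exists_constOnBalls hφ
  have hV : vol p f μ π m ≠ 0 := by
    rw [L.vol_eq]
    have := sub_pos.2 (inv_lt_one_of_one_lt₀ L.one_lt_q)
    positivity
  -- Subtracting φ y leaves D φ unchanged and makes the test function vanish near the pole. Only
  -- points where the truncated integral of g is its true Laplacian then matter, and the subtracted
  -- constant reappears as the point mass.
  have hφN' : ConstOnBalls p π m N fun z => φ z - φ y := fun x hx z hz hzx => by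
    simp only [hφN x hx z hz hzx]
  have h1 := L.integral_mul_lap hφN' hg
  rw [lap_const_sub] at h1
  have h2 : ∀ x ∈ domainE p π m, (φ x - φ y) *
      ∫ z in domainE p π m, (g z - g x) * truncKernel p f π N x z ∂μ =
      -(1 / vol p f μ π m) * ((absK p f π x)⁻¹ * (φ x - φ y)) := by
    intro x hx
    by_cases hyx : y ∈ closedBall x (‖π‖ ^ N)
    · rw [hφN x hx y hy hyx]
      simp
    · have hxy : x ≠ y := fun h => hyx (h ▸ L.self_mem_closedBall x N)
      rw [← L.inv_absK_mul_lap hx fun z _ hz => hloc N hN x hx hyx z hz, hlap x hx hxy]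
      ring
  rw [h1, setIntegral_congr_fun hE h2, integral_const_mul, ← L.setIntegral_mulMeasure _ hE,
    integral_sub]
  · rw [setIntegral_const, smul_eq_mul, measureReal_def, ← vol]
    field_simp
    ring
  · refine (L.integrableOn_mulMeasure_iff φ).2 ?_
    exact ConstOnBalls.integrableOn L hφN
  · exact (L.integrableOn_mulMeasure_iff fun _ => φ y).2 (L.integrableOn_const_domainE _)

end

end LocalField

end TateGreen

/-! ### Existence and uniqueness of the symmetric Green's functions -/

namespace TateGreen

/-- The function `B + C`. -/
noncomputable def greenFn (p f : ℕ) {K : Type*} [NormedField K] (π : K) (m : ℕ) (lam0 : ℝ)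
    (C : ℤ → ℤ → ℝ) (x y : K) : ℝ :=
  BKm p f π m lam0 x y + C (valK π x) (valK π y)

theorem IsRecurrent.symm {p f m : ℕ} {C : ℤ → ℤ → ℝ} (h : IsRecurrent p f m C) {a r : ℤ}
    (h0 : 0 ≤ a) (h1 : a ≤ (m : ℤ) - 1) (h2 : 0 ≤ r) (h3 : r ≤ (m : ℤ) - 1) : C a r = C r a := by
  rcases le_total a r with hle | hle
  · rw [h.upper a r h0 hle h3, h.lower r a h0 hle h3]
    ring
  · rw [h.lower a r h2 hle h1, h.upper r a h2 hle h1]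
    ring

namespace LocalField

open Metric

variable {p f : ℕ} {K : Type*} [NormedField K] [MeasurableSpace K] {π : K} {μ : Measure K} {q : ℝ}
  {m : ℕ}

theorem exists_not_mem_closedBall (L : LocalField p f π μ q) {x y : K} (hxy : x ≠ y) :
    ∃ N : ℤ, (m : ℤ) ≤ N ∧ ∀ N', N ≤ N' → y ∉ closedBall x (‖π‖ ^ N') := by
  refine ⟨max m (valK π (y - x) + 1), by lia, fun N' hN' => ?_⟩
  rw [L.mem_closedBall_iff hxy.symm]
  lia

variable [Fact p.Prime] [NormedAlgebra ℚ_[p] K]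

theorem BKm_eq (L : LocalField p f π μ q) (lam0 : ℝ) {x y : K} (hx : x ∈ domainE p π m)
    (hy : y ∈ domainE p π m) (hxy : x ≠ y) :
    BKm p f π m lam0 x y = seqLog q (-∑' n, lamSeq q (UK p f π m y) lam0 n) lam0
      (lamSeq q (UK p f π m y) lam0) (relVal π x y) := by
  rw [BKm, L.logSeries_eq lam0 _ _ hx hy hxy]
  simp only [L.lambdaK_succ]

theorem relVal_eq_zero (L : LocalField p f π μ q) {x y : K} (hx : x ∈ domainE p π m)
    (hy : y ∈ domainE p π m) (h : valK π x ≠ valK π y) : relVal π x y = 0 := by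
  have := (L.valK_sub_eq_min (L.mem_domainE.1 hy).1 (L.mem_domainE.1 hx).1 h).2
  rw [relVal]
  lia

/-- The additive constant of B makes it vanish at d = 1. Symmetry then concerns only points of equal
valuation, where the coefficients coincide. -/
theorem BKm_eq_zero (L : LocalField p f π μ q) (lam0 : ℝ) {x y : K} (hx : x ∈ domainE p π m)
    (hy : y ∈ domainE p π m) (h : valK π x ≠ valK π y) : BKm p f π m lam0 x y = 0 := by
  rw [L.BKm_eq lam0 hx hy fun h' => h (h' ▸ rfl), L.relVal_eq_zero hx hy h, seqLog]
  simp

theorem BKm_symm (L : LocalField p f π μ q) (lam0 : ℝ) {x y : K} (hx : x ∈ domainE p π m)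
    (hy : y ∈ domainE p π m) : BKm p f π m lam0 x y = BKm p f π m lam0 y x := by
  by_cases hxy : x = y
  · rw [hxy]
  by_cases h : valK π x = valK π y
  · rw [L.BKm_eq lam0 hx hy hxy, L.BKm_eq lam0 hy hx (Ne.symm hxy), L.UK_eq, L.UK_eq, h, relVal,
      relVal, valK_sub_comm, h]
  · rw [L.BKm_eq_zero lam0 hx hy h, L.BKm_eq_zero lam0 hy hx (Ne.symm h)]

theorem greenFn_locally_const (L : LocalField p f π μ q) (lam0 : ℝ) (C : ℤ → ℤ → ℝ) {y : K}
    (hy : y ∈ domainE p π m) {N : ℤ} (hN : (m : ℤ) ≤ N) {x : K} (hx : x ∈ domainE p π m)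
    (hyx : y ∉ closedBall x (‖π‖ ^ N)) {z : K} (hz : z ∈ closedBall x (‖π‖ ^ N)) :
    greenFn p f π m lam0 C z y = greenFn p f π m lam0 C x y := by
  have hxy : y ≠ x := fun h => hyx (h ▸ L.self_mem_closedBall x N)
  rw [L.mem_closedBall_iff hxy] at hyx
  have h1 := L.closedBall_inter hN hx hz
  have h2 := L.valK_sub_of_lt (z := z) hxy fun h => by
    rw [L.mem_closedBall_iff h] at hz
    lia
  rw [greenFn, greenFn, L.BKm_eq lam0 h1.1 hy h2.1, L.BKm_eq lam0 hx hy hxy.symm, h1.2, relVal,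
    relVal, h2.2, valK_sub_comm]

theorem continuousOn_greenFn (L : LocalField p f π μ q) (lam0 : ℝ) (C : ℤ → ℤ → ℝ) {y : K}
    (hy : y ∈ domainE p π m) :
    ContinuousOn (fun x => greenFn p f π m lam0 C x y) (domainE p π m \ {y}) := by
  rintro x ⟨hx, hxy⟩
  obtain ⟨N, hN, hyx⟩ := L.exists_not_mem_closedBall (m := m) hxy
  refine ContinuousWithinAt.congr_of_eventuallyEq (f := fun _ => greenFn p f π m lam0 C x y)
    continuousWithinAt_const ?_ rfl
  filter_upwards [mem_nhdsWithin_of_mem_nhds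
    ((L.isOpen_closedBall x N).mem_nhds (L.self_mem_closedBall x N))] with z hz
  exact L.greenFn_locally_const lam0 C hy hN hx (hyx N le_rfl) hz

theorem ae_ne (L : LocalField p f π μ q) (y : K) :
    ∀ᵐ x ∂(mulMeasure p f μ π).restrict (domainE p π m), x ≠ y := by
  have h : ∀ᵐ x ∂μ, x ≠ y := by
    rw [ae_iff]
    simpa using L.measure_singleton y
  exact ae_restrict_of_ae ((withDensity_absolutelyContinuous _ _).ae_le h)

variable [BorelSpace K]

theorem integrableOn_greenFn (L : LocalField p f π μ q) (lam0 : ℝ) (C : ℤ → ℤ → ℝ) {y : K}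
    (hy : y ∈ domainE p π m) :
    IntegrableOn (fun x => greenFn p f π m lam0 C x y) (domainE p π m) μ := by
  set Ψ := seqLog q (-∑' n, lamSeq q (UK p f π m y) lam0 n) lam0
    (lamSeq q (UK p f π m y) lam0) with hΨ
  have hs : Summable fun l => |Ψ l| * (q ^ l)⁻¹ := summable_seqLog L.one_lt_q _ lam0
    (summable_lamSeq L.one_lt_q (L.UK_nonneg y) (L.UK_lt hy) lam0)
  -- Removing the value at d = 1 localizes B near y, so the radial integrability result applies; the
  -- constant goes with the array.
  have h1 := (L.integral_domainE_radial hy (L.summable_shift hs 0 (Ψ 0)) (sub_self _)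
    (g := fun x => BKm p f π m lam0 x y - Ψ 0) 1 fun z hz hzy => by
      rw [L.BKm_eq lam0 hz hy hzy, one_mul, add_zero]).1
  have h2 := (integral_of_const_on_pieces (μ := μ) (Finset.range m)
    (fun j : ℕ => shell π 0 (j : ℤ)) (fun j _ => L.measurableSet_shell 0 j)
    (fun i _ j _ hij => disjoint_shell π 0 (by simpa using hij))
    (fun j _ => L.measure_shell_ne_top 0 j) (fun x => C (valK π x) (valK π y) + Ψ 0)
    (fun j => C j (valK π y) + Ψ 0) (by
      rintro j - z ⟨-, hv⟩
      rw [sub_zero] at hv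
      rw [hv])).1
  rw [← L.domainE_eq_iUnion] at h2
  refine (h1.add h2).congr (Filter.Eventually.of_forall fun x => ?_)
  simp only [Pi.add_apply, greenFn]
  ring

theorem IsSymmGreen.congr (L : LocalField p f π μ q) {G G' : K → K → ℝ}
    (h : IsSymmGreen p f μ π m G)
    (hG : ∀ x ∈ domainE p π m, ∀ y ∈ domainE p π m, x ≠ y → G' x y = G x y) :
    IsSymmGreen p f μ π m G' := by
  have hE := L.measurableSet_domainE m
  have hae : ∀ y ∈ domainE p π m,
      ∀ᵐ x ∂(mulMeasure p f μ π).restrict (domainE p π m), G' x y = G x y := by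
    intro y hy
    filter_upwards [L.ae_ne y, ae_restrict_mem hE] with x hxy hx using hG x hx y hy hxy
  refine ⟨fun x hx y hy => ?_, fun y hy => ?_, fun y hy => ?_, fun y hy φ hφ => ?_⟩
  · by_cases hxy : x = y
    · rw [hxy]
    · rw [hG x hx y hy hxy, hG y hy x hx (Ne.symm hxy), h.symm x hx y hy]
  · exact (h.continuousOn y hy).congr fun x hx => hG x hx.1 y hy hx.2
  · exact (h.integrableOn y hy).congr ((hae y hy).mono fun x hx => hx.symm)
  · rw [← h.green y hy φ hφ]
    exact integral_congr_ae ((hae y hy).mono fun x hx => by simp only [hx])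

theorem lap_greenFn (L : LocalField p f π μ q) (hm : 0 < m) {lam0 : ℝ}
    (h0 : lam0 = q * (q - 1) / (q + 1)) {C : ℤ → ℤ → ℝ} (hC : IsRecurrent p f m C) {x y : K}
    (hx : x ∈ domainE p π m) (hy : y ∈ domainE p π m) (hxy : x ≠ y) :
    lap p f μ π m (fun z => greenFn p f π m lam0 C z y) x = -(1 / vol p f μ π m) :=
  ((L.symm_and_lap_iff_isRecurrent hm h0 C).2 hC).2 x hx y hy hxy

theorem isSymmGreen_greenFn [ProperSpace K] (L : LocalField p f π μ q) (hm : 0 < m) {lam0 : ℝ}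
    (h0 : lam0 = q * (q - 1) / (q + 1)) {C : ℤ → ℤ → ℝ} (hC : IsRecurrent p f m C) :
    IsSymmGreen p f μ π m (greenFn p f π m lam0 C) := by
  refine ⟨fun x hx y hy => ?_, fun y hy => L.continuousOn_greenFn lam0 C hy,
    fun y hy => (L.integrableOn_mulMeasure_iff _).2 (L.integrableOn_greenFn lam0 C hy),
    fun y hy φ hφ => ?_⟩
  · have hx' := (L.mem_domainE.1 hx).2
    have hy' := (L.mem_domainE.1 hy).2
    rw [greenFn, greenFn, L.BKm_symm lam0 hx hy,
      hC.symm hx'.1 (by lia) hy'.1 (by lia)]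
  · exact L.green_of_lap hm hy (L.integrableOn_greenFn lam0 C hy)
      (fun N hN x hx hyx z hz => L.greenFn_locally_const lam0 C hy hN hx hyx hz)
      (fun x hx hxy => L.lap_greenFn hm h0 hC hx hy hxy) hφ

theorem measureReal_mulMeasure_closedBall (L : LocalField p f π μ q) {N : ℤ} (hN : (m : ℤ) ≤ N)
    {c : K} (hc : c ∈ domainE p π m) :
    (mulMeasure p f μ π).real (closedBall c (‖π‖ ^ N)) = q ^ (valK π c - N) := by
  have h := L.setIntegral_mulMeasure (fun _ => 1)
    (measurableSet_closedBall (x := c) (ε := ‖π‖ ^ N))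
  rw [setIntegral_const, smul_eq_mul, mul_one] at h
  rw [h, setIntegral_congr_fun (g := fun _ => q ^ valK π c) measurableSet_closedBall fun z hz => ?_,
    setIntegral_const, L.measureReal_closedBall, smul_eq_mul, ← zpow_add₀ L.q_pos.ne']
  · congr 1
    ring
  · have := L.closedBall_inter hN hc hz
    simp only [mul_one]
    rw [L.absK_of_ne (L.mem_domainE.1 this.1).1, this.2, zpow_neg, inv_inv]

/-- A locally constant function whose Laplacian is, up to a constant, the normalized indicator of
a ball. -/
theorem exists_lap_eq_indicator [ProperSpace K] (L : LocalField p f π μ q) (hm : 0 < m) {c : K}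
    (hc : c ∈ domainE p π m) {N : ℤ} (hN : (m : ℤ) ≤ N) :
    ∃ φ : K → ℝ, (IsLocallyConstant fun x : domainE p π m => φ x) ∧ ∀ x ∈ domainE p π m,
      lap p f μ π m φ x = -(1 / vol p f μ π m) + (closedBall c (‖π‖ ^ N)).indicator
        (fun _ => 1 / (mulMeasure p f μ π).real (closedBall c (‖π‖ ^ N))) x := by
  classical
  have hE := L.measurableSet_domainE m
  obtain ⟨C, hC, -⟩ := exists_isRecurrent (p := p) (f := f) hm 0
  set g : K → ℝ := fun x => greenFn p f π m (q * (q - 1) / (q + 1)) C x c with hg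
  set B := closedBall c (‖π‖ ^ N) with hB
  have hBm : MeasurableSet B := measurableSet_closedBall
  have hcB : c ∈ B := L.self_mem_closedBall c N
  have hBE : B ⊆ domainE p π m := fun z hz => (L.closedBall_inter hN hc hz).1
  have hball : ∀ x z, z ∈ closedBall x (‖π‖ ^ N) → (z ∈ B ↔ x ∈ B) := by
    intro x z hz
    have := L.ultra
    rw [hB, mem_closedBall_comm (x := z), mem_closedBall_comm (x := x),
      IsUltrametricDist.closedBall_eq_of_mem hz]
  -- The singular function is replaced on the ball around its pole by its average there, which makes
  -- it locally constant.
  set φ : K → ℝ := fun x => if x ∈ B then (μ.real B)⁻¹ * ∫ z in B, g z ∂μ else g x with hφ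
  have hφB : ∀ x ∈ B, φ x = (μ.real B)⁻¹ * ∫ z in B, g z ∂μ := fun x hx => if_pos hx
  have hφ' : ∀ x, x ∉ B → φ x = g x := fun x hx => if_neg hx
  have hconst : ConstOnBalls p π m N φ := by
    intro x hx z hz hzx
    by_cases hxB : x ∈ B
    · rw [hφB x hxB, hφB z ((hball x z hzx).2 hxB)]
    · rw [hφ' x hxB, hφ' z fun h => hxB ((hball x z hzx).1 h)]
      exact L.greenFn_locally_const _ C hc hN hx
        (fun h => hxB (mem_closedBall_comm.1 h)) hzx
  have hμB : μ.real B ≠ 0 := by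
    rw [hB, L.measureReal_closedBall]
    exact (zpow_pos L.q_pos _).ne'
  have hlap1 : ∀ x ∈ domainE p π m, x ∉ B →
      lap p f μ π m φ x = -(1 / vol p f μ π m) := by
    intro x hx hxB
    have hxc : x ≠ c := fun h => hxB (h ▸ hcB)
    rw [← L.lap_greenFn hm rfl hC hx hc hxc]
    have hint : IntegrableOn (lapIntegrand p f π g x) (domainE p π m) μ :=
      (L.lap_BKm_add _ C hx hc hxc).1
    have hcongr : ∀ z ∈ domainE p π m \ B,
        lapIntegrand p f π φ x z = lapIntegrand p f π g x z := fun z hz => by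
      simp only [lapIntegrand, hφ' z hz.2, hφ' x hxB]
    -- Seen from outside B the kernel is constant on B, so the average suffices and the Laplacian
    -- outside is unchanged.
    have hconstB : ∀ ψ : K → ℝ, ∀ z ∈ B, lapIntegrand p f π ψ x z =
        (ψ z - ψ x) * q ^ (2 * valK π (c - x) - valK π x) := by
      intro ψ z hz
      have hxB' := hxB
      rw [hB, L.mem_closedBall_iff hxc] at hxB'
      have h1 := L.valK_sub_of_lt (z := z) hxc fun h => by
        rw [hB, L.mem_closedBall_iff h] at hz
        lia
      rw [L.lapIntegrand_eq ψ (L.mem_domainE.1 hx).1 h1.1, h1.2, valK_sub_comm π x c]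
    have hgB : IntegrableOn g B μ := (L.integrableOn_greenFn _ C hc).mono_set hBE
    have hconstint : ∀ k : ℝ, IntegrableOn (fun _ => k) B μ :=
      fun k => (L.integrableOn_const_domainE k).mono_set hBE
    have hφint : IntegrableOn (lapIntegrand p f π φ x) B μ := by
      refine (integrableOn_congr_fun (fun z hz => ?_) hBm).2
        (hconstint (((μ.real B)⁻¹ * (∫ z in B, g z ∂μ) - φ x) *
          q ^ (2 * valK π (c - x) - valK π x)))
      rw [hconstB φ z hz, hφB z hz]
    have hφint' : IntegrableOn (lapIntegrand p f π φ x) (domainE p π m \ B) μ :=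
      (integrableOn_congr_fun hcongr (hE.diff hBm)).2 (hint.mono_set Set.sdiff_subset)
    rw [lap, lap, ← Set.sdiff_union_of_subset hBE, setIntegral_union Set.disjoint_sdiff_left hBm
      hφint' hφint, setIntegral_union Set.disjoint_sdiff_left hBm
      (hint.mono_set Set.sdiff_subset) (hint.mono_set hBE),
      setIntegral_congr_fun (hE.diff hBm) hcongr]
    congr 1
    rw [setIntegral_congr_fun hBm (hconstB φ), setIntegral_congr_fun hBm (hconstB g),
      integral_mul_const, integral_mul_const, integral_sub hgB (hconstint _),
      setIntegral_congr_fun (g := fun _ => (μ.real B)⁻¹ * (∫ z in B, g z ∂μ) - g x) hBm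
        fun z hz => by simp only [hφB z hz, hφ' x hxB],
      setIntegral_const, setIntegral_const, smul_eq_mul, smul_eq_mul]
    field_simp
  -- Inside B the function is constant, and all points of B are at the same distance from any given
  -- outside point.
  have hlap2 : ∀ x ∈ B, lap p f μ π m φ x = lap p f μ π m φ c := by
    intro x hxB
    have hx := hBE hxB
    refine setIntegral_congr_fun hE fun z hz => ?_
    by_cases hzB : z ∈ B
    · simp only [lapIntegrand, hφB z hzB, hφB x hxB, hφB c hcB, sub_self, zero_div, zero_mul]
    · have hzc : z ≠ c := fun h => hzB (h ▸ hcB)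
      have hzB' := hzB
      rw [hB, L.mem_closedBall_iff hzc] at hzB'
      have h1 := L.valK_sub_of_lt (z := x) hzc fun h => by
        rw [hB, L.mem_closedBall_iff h] at hxB
        lia
      have h2 := (L.closedBall_inter hN hc hxB).2
      rw [L.lapIntegrand_eq φ (L.mem_domainE.1 hx).1 h1.1.symm,
        L.lapIntegrand_eq φ (L.mem_domainE.1 hc).1 hzc, h2, valK_sub_comm π z x, h1.2, hφB x hxB,
        hφB c hcB]
  have hV : vol p f μ π m ≠ 0 := by
    rw [L.vol_eq]
    have := sub_pos.2 (inv_lt_one_of_one_lt₀ L.one_lt_q)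
    positivity
  have hW : (mulMeasure p f μ π).real B ≠ 0 := by
    rw [hB, L.measureReal_mulMeasure_closedBall hN hc]
    exact (zpow_pos L.q_pos _).ne'
  have hlap : ∀ x ∈ domainE p π m, lap p f μ π m φ x = -(1 / vol p f μ π m) +
      B.indicator (fun _ => lap p f μ π m φ c + 1 / vol p f μ π m) x := by
    intro x hx
    by_cases hxB : x ∈ B
    · rw [Set.indicator_of_mem hxB, hlap2 x hxB]
      ring
    · rw [Set.indicator_of_notMem hxB, hlap1 x hx hxB, add_zero]
  have hmul : ∀ k : ℝ, IntegrableOn (fun _ => k) (domainE p π m) (mulMeasure p f μ π) :=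
    fun k => (L.integrableOn_mulMeasure_iff _).2 (L.integrableOn_const_domainE k)
  -- Pairing with the constant 1 gives total integral zero, which determines the height of the
  -- indicator.
  have hzero : ∫ x in domainE p π m, lap p f μ π m φ x ∂(mulMeasure p f μ π) = 0 := by
    have := L.integral_mul_lap hconst (L.integrableOn_const_domainE 1)
    simpa using this
  rw [setIntegral_congr_fun hE hlap, integral_add (hmul _) ((hmul _).indicator hBm),
    setIntegral_indicator hBm, Set.inter_eq_right.2 hBE, setIntegral_const, setIntegral_const,
    smul_eq_mul, smul_eq_mul, measureReal_def, ← vol] at hzero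
  refine ⟨φ, ConstOnBalls.isLocallyConstant L hconst, fun x hx => ?_⟩
  rw [hlap x hx]
  congr 3
  funext _
  rw [eq_div_iff hW]
  have : vol p f μ π m * -(1 / vol p f μ π m) = -1 := by field_simp
  linarith

/-- A function whose distributional Laplacian vanishes equals its mean value. -/
theorem sub_eq_mean [ProperSpace K] (L : LocalField p f π μ q) (hm : 0 < m) {h : K → ℝ} {y c : K}
    (hint : IntegrableOn h (domainE p π m) (mulMeasure p f μ π))
    (hcont : ContinuousOn h (domainE p π m \ {y})) (hc : c ∈ domainE p π m) (hcy : c ≠ y)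
    (hlap : ∀ φ : K → ℝ, (IsLocallyConstant fun x : domainE p π m => φ x) →
      (∀ g : K → ℝ, IntegrableOn g (domainE p π m) (mulMeasure p f μ π) →
        IntegrableOn (fun x => g x * lap p f μ π m φ x) (domainE p π m) (mulMeasure p f μ π)) →
      ∫ x in domainE p π m, h x * lap p f μ π m φ x ∂(mulMeasure p f μ π) = 0) :
    h c = 1 / vol p f μ π m * ∫ x in domainE p π m, h x ∂(mulMeasure p f μ π) := by
  have hE := L.measurableSet_domainE m
  obtain ⟨N₀, hN₀, hy⟩ := L.exists_not_mem_closedBall (m := m) hcy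
  refine eq_of_abs_sub_le_all fun ε hε => ?_
  obtain ⟨δ, hδ, hδε⟩ := Metric.continuousWithinAt_iff.1 (hcont c ⟨hc, hcy⟩) ε hε
  obtain ⟨n, hn⟩ := exists_pow_lt_of_lt_one hδ L.pi_lt
  set N : ℤ := max n N₀ with hN
  have hmN : (m : ℤ) ≤ N := by lia
  set B := closedBall c (‖π‖ ^ N) with hB
  have hBm : MeasurableSet B := measurableSet_closedBall
  have hBE : B ⊆ domainE p π m := fun z hz => (L.closedBall_inter hmN hc hz).1
  have hclose : ∀ z ∈ B, ‖h z - h c‖ ≤ ε := by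
    intro z hz
    rw [← dist_eq_norm]
    refine (hδε ⟨hBE hz, ?_⟩ ?_).le
    · rintro rfl
      exact hy N (le_max_right _ _) hz
    · refine (mem_closedBall.1 hz).trans_lt (lt_of_le_of_lt ?_ hn)
      rw [← zpow_natCast]
      exact (zpow_le_zpow_iff_right_of_lt_one₀ L.pi_pos L.pi_lt).2 (le_max_left _ _)
  obtain ⟨φ, hφ, hφlap⟩ := L.exists_lap_eq_indicator hm hc hmN
  have hW : 0 < (mulMeasure p f μ π).real B := by
    rw [hB, L.measureReal_mulMeasure_closedBall hmN hc]
    exact zpow_pos L.q_pos _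
  set W := (mulMeasure p f μ π).real B with hWdef
  have h2 : ∀ g : K → ℝ, ∀ x ∈ domainE p π m, g x * lap p f μ π m φ x =
      g x * -(1 / vol p f μ π m) + B.indicator (fun x => g x * (1 / W)) x := by
    intro g x hx
    rw [hφlap x hx, mul_add]
    congr 1
    by_cases hxB : x ∈ B
    · rw [Set.indicator_of_mem hxB, Set.indicator_of_mem hxB]
    · rw [Set.indicator_of_notMem hxB, Set.indicator_of_notMem hxB, mul_zero]
  -- Multiplication by D φ preserves integrability because D φ is a constant plus a multiple of an
  -- indicator. The test says that the mean of h over B equals its mean over the whole domain;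
  -- continuity at c then gives the value there as B shrinks.
  have h1 := hlap φ hφ fun g hg => (integrableOn_congr_fun (h2 g) hE).2
    ((hg.mul_const _).add ((hg.mul_const _).indicator hBm))
  rw [setIntegral_congr_fun hE (h2 h), integral_add (hint.mul_const _)
    ((hint.mul_const _).indicator hBm), setIntegral_indicator hBm, Set.inter_eq_right.2 hBE,
    integral_mul_const, integral_mul_const] at h1
  have hBtop : mulMeasure p f μ π B ≠ ⊤ := by
    intro htop
    rw [hWdef, measureReal_def, htop] at hW
    exact lt_irrefl _ hW
  have h3 : ∫ x in B, (h x - h c) ∂(mulMeasure p f μ π) =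
      (∫ x in B, h x ∂(mulMeasure p f μ π)) - W * h c := by
    rw [integral_sub (hint.mono_set hBE) (integrableOn_const hBtop), setIntegral_const,
      smul_eq_mul]
  have h4 := norm_setIntegral_le_of_norm_le_const (μ := mulMeasure p f μ π) (s := B)
    (f := fun x => h x - h c) (lt_top_iff_ne_top.2 hBtop) hclose
  rw [h3, ← hWdef, Real.norm_eq_abs] at h4
  have h5 : 1 / vol p f μ π m * ∫ x in domainE p π m, h x ∂(mulMeasure p f μ π) =
      (∫ x in B, h x ∂(mulMeasure p f μ π)) * (1 / W) := by linarith
  rw [h5, abs_sub_comm]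
  have h6 : (∫ x in B, h x ∂(mulMeasure p f μ π)) * (1 / W) - h c =
      ((∫ x in B, h x ∂(mulMeasure p f μ π)) - W * h c) / W := by
    field_simp
  rw [h6, abs_div, abs_of_pos hW, div_le_iff₀ hW]
  exact h4

end LocalField

end TateGreen

namespace TateGreen

/-- In each formula the coefficients of the entries of C on the right sum to 1, so adding a constant
to the array is harmless once the Λ in the denominator is nonzero. -/
theorem IsRecurrent.add_const {p f m : ℕ} (hL : ∀ a : ℤ, 0 ≤ a → a < (m : ℤ) - 2 → Lam p f m a ≠ 0)
    {C : ℤ → ℤ → ℝ} (h : IsRecurrent p f m C) (k : ℝ) :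
    IsRecurrent p f m fun a r => C a r + k := by
  refine ⟨fun h2 => ?_, fun a h0 h1 => ?_, fun a r h0 h1 h2 => ?_, fun a r h0 h1 h2 => ?_⟩
  · rw [h.step_last h2]
    ring
  · have := hL a h0 h1
    rw [h.step a h0 h1]
    field_simp
    ring
  · rw [h.lower a r h0 h1 h2]
    ring
  · rw [h.upper a r h0 h1 h2]
    ring

namespace LocalField

variable {p f : ℕ} {K : Type*} [NormedField K] [MeasurableSpace K] {π : K} {μ : Measure K} {q : ℝ}
  {m : ℕ} [Fact p.Prime] [NormedAlgebra ℚ_[p] K] [BorelSpace K]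

/-- Symmetric Green's functions are unique up to an additive constant. -/
theorem exists_eq_add_of_isSymmGreen [ProperSpace K] (L : LocalField p f π μ q) (hm : 0 < m)
    {G G₀ : K → K → ℝ} (hG : IsSymmGreen p f μ π m G) (hG₀ : IsSymmGreen p f μ π m G₀) :
    ∃ k : ℝ, ∀ x ∈ domainE p π m, ∀ y ∈ domainE p π m, x ≠ y → G x y = G₀ x y + k := by
  set κ : K → ℝ := fun y => 1 / vol p f μ π m *
    ∫ x in domainE p π m, (G x y - G₀ x y) ∂(mulMeasure p f μ π) with hκ
  have hmean : ∀ c ∈ domainE p π m, ∀ y ∈ domainE p π m, c ≠ y → G c y - G₀ c y = κ y := by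
    intro c hc y hy hcy
    refine L.sub_eq_mean (h := fun x => G x y - G₀ x y) hm
      ((hG.integrableOn y hy).sub (hG₀.integrableOn y hy))
      ((hG.continuousOn y hy).sub (hG₀.continuousOn y hy)) hc hcy fun φ hφ hint => ?_
    simp only [sub_mul]
    rw [integral_sub (hint _ (hG.integrableOn y hy)) (hint _ (hG₀.integrableOn y hy)),
      hG.green y hy φ hφ, hG₀.green y hy φ hφ, sub_self]
  have h1 : (1 : K) ∈ domainE p π m := ⟨0, hm, 1, by simp⟩
  refine ⟨κ 1, fun x hx y hy hxy => ?_⟩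
  -- The constant attached to y is the difference evaluated at (1, y), and the constant attached to
  -- 1 is the same difference at (y, 1); symmetry equates them.
  have h2 : κ y = κ 1 := by
    by_cases hy1 : y = 1
    · rw [hy1]
    · rw [← hmean 1 h1 y hy (Ne.symm hy1), ← hmean y hy 1 h1 hy1, hG.symm 1 h1 y hy,
        hG₀.symm 1 h1 y hy]
  linarith [hmean x hx y hy hxy]

theorem isSymmGreen_iff [ProperSpace K] (L : LocalField p f π μ q) (hm : 0 < m) {lam0 : ℝ}
    (h0 : lam0 = q * (q - 1) / (q + 1)) (G : K → K → ℝ) :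
    IsSymmGreen p f μ π m G ↔ ∃ C : ℤ → ℤ → ℝ, IsRecurrent p f m C ∧
      ∀ x ∈ domainE p π m, ∀ y ∈ domainE p π m, x ≠ y →
        G x y = BKm p f π m lam0 x y + C (valK π x) (valK π y) := by
  constructor
  · intro hG
    obtain ⟨C, hC, -⟩ := exists_isRecurrent (p := p) (f := f) hm 0
    obtain ⟨k, hk⟩ := L.exists_eq_add_of_isSymmGreen hm hG (L.isSymmGreen_greenFn hm h0 hC)
    refine ⟨fun a r => C a r + k, hC.add_const (fun a ha ha' => ?_) k, fun x hx y hy hxy => ?_⟩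
    · exact (Lam_pos L.q_eq L.one_lt_q ha (by lia)).ne'
    · rw [hk x hx y hy hxy, greenFn, add_assoc]
  · rintro ⟨C, hC, h⟩
    exact IsSymmGreen.congr L (L.isSymmGreen_greenFn hm h0 hC) h

end LocalField

end TateGreen

/-! ### The main theorem -/

theorem mainTheorem6 (p : ℕ) [Fact p.Prime] (K : Type*) [NormedField K] [NormedAlgebra ℚ_[p] K]
    [FiniteDimensional ℚ_[p] K] [MeasurableSpace K] [BorelSpace K]
    (f : ℕ) (hf : Nat.card (IsLocalRing.ResidueField (TateGreen.ringOfIntegers p K)) = p ^ f)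
    (ϖ : TateGreen.ringOfIntegers p K) (hϖ : Irreducible ϖ)
    (μ : Measure K) [μ.IsAddHaarMeasure] (hμ : μ (TateGreen.ringOfIntegers p K : Set K) = 1)
    (m : ℕ) (hm : 0 < m) :
    -- the coefficients of the series are forced by independence of `|x - y|`
    (∀ (lam0 : ℝ) (A : K → ℝ) (lam : ℕ → K → ℝ),
      (∀ y ∈ TateGreen.domainE p (ϖ : K) m, Summable fun n : ℕ => |lam (n + 1) y|) →
      ((∀ x ∈ TateGreen.domainE p (ϖ : K) m, ∀ y ∈ TateGreen.domainE p (ϖ : K) m,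
          ∀ x' ∈ TateGreen.domainE p (ϖ : K) m, ∀ y' ∈ TateGreen.domainE p (ϖ : K) m,
          x ≠ y → x' ≠ y' → TateGreen.valK (ϖ : K) x = TateGreen.valK (ϖ : K) x' →
          TateGreen.valK (ϖ : K) y = TateGreen.valK (ϖ : K) y' →
          TateGreen.lap p f μ (ϖ : K) m
              (fun z => TateGreen.logSeries p f (ϖ : K) lam0 A lam z y) x =
            TateGreen.lap p f μ (ϖ : K) m
              (fun z => TateGreen.logSeries p f (ϖ : K) lam0 A lam z y') x') ↔
        ∀ y ∈ TateGreen.domainE p (ϖ : K) m, ∀ n : ℕ, 1 ≤ n →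
          lam n y = TateGreen.UK p f (ϖ : K) m y ^ n *
            (((p : ℝ) ^ (f * (n + 1)) - 1) /
              (((p : ℝ) ^ f - 1) * ((p : ℝ) ^ f + 1) ^ n * ((p : ℝ) ^ (f * n) - 1))) * lam0)) ∧
    -- these coefficients are summable, and the value of `D B` off the diagonal
    (∀ lam0 : ℝ, ∀ y ∈ TateGreen.domainE p (ϖ : K) m,
      (Summable fun n : ℕ => |TateGreen.lambdaK p f (ϖ : K) m lam0 (n + 1) y|) ∧
      ∀ x ∈ TateGreen.domainE p (ϖ : K) m, x ≠ y →
        IntegrableOn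
          (TateGreen.lapIntegrand p f (ϖ : K)
            (fun z => TateGreen.BKm p f (ϖ : K) m lam0 z y) x)
          (TateGreen.domainE p (ϖ : K) m) μ ∧
        TateGreen.lap p f μ (ϖ : K) m (fun z => TateGreen.BKm p f (ϖ : K) m lam0 z y) x =
          -lam0 *
            ((p : ℝ) ^ (-((f : ℤ) * |TateGreen.valK (ϖ : K) x - TateGreen.valK (ϖ : K) y|)) /
              ((p : ℝ) ^ f - 1)) *
            (((p : ℝ) ^ f + 1) / ((p : ℝ) ^ f + 1 - TateGreen.UK p f (ϖ : K) m y))) ∧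
    -- the value of `λ₀`
    (∀ lam0 : ℝ,
      (∃ C : ℤ → ℤ → ℝ, ∀ x ∈ TateGreen.domainE p (ϖ : K) m,
        ∀ y ∈ TateGreen.domainE p (ϖ : K) m, x ≠ y →
          TateGreen.lap p f μ (ϖ : K) m
              (fun z => TateGreen.BKm p f (ϖ : K) m lam0 z y +
                C (TateGreen.valK (ϖ : K) z) (TateGreen.valK (ϖ : K) y)) x =
            -(1 / TateGreen.vol p f μ (ϖ : K) m)) ↔
      lam0 = (p : ℝ) ^ f * ((p : ℝ) ^ f - 1) / ((p : ℝ) ^ f + 1)) ∧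
    (∀ lam0 : ℝ, lam0 = (p : ℝ) ^ f * ((p : ℝ) ^ f - 1) / ((p : ℝ) ^ f + 1) →
      -- the symmetrized `C` is exactly the one given by the recurrence
      (∀ C : ℤ → ℤ → ℝ,
        ((∀ q r : ℤ, 0 ≤ q → q ≤ (m : ℤ) - 1 → 0 ≤ r → r ≤ (m : ℤ) - 1 → C q r = C r q) ∧
          (∀ x ∈ TateGreen.domainE p (ϖ : K) m, ∀ y ∈ TateGreen.domainE p (ϖ : K) m, x ≠ y →
            TateGreen.lap p f μ (ϖ : K) m
                (fun z => TateGreen.BKm p f (ϖ : K) m lam0 z y +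
                  C (TateGreen.valK (ϖ : K) z) (TateGreen.valK (ϖ : K) y)) x =
              -(1 / TateGreen.vol p f μ (ϖ : K) m))) ↔
        TateGreen.IsRecurrent p f m C) ∧
      -- the value `C (m - 1) 0` is arbitrary
      (∀ c : ℝ, ∃ C : ℤ → ℤ → ℝ, TateGreen.IsRecurrent p f m C ∧ C ((m : ℤ) - 1) 0 = c) ∧
      -- the symmetric Green's functions are exactly the functions `B + C`
      (∀ G : K → K → ℝ,
        (TateGreen.IsSymmGreen p f μ (ϖ : K) m G ↔
          ∃ C : ℤ → ℤ → ℝ, TateGreen.IsRecurrent p f m C ∧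
            ∀ x ∈ TateGreen.domainE p (ϖ : K) m, ∀ y ∈ TateGreen.domainE p (ϖ : K) m, x ≠ y →
              G x y = TateGreen.BKm p f (ϖ : K) m lam0 x y +
                C (TateGreen.valK (ϖ : K) x) (TateGreen.valK (ϖ : K) y)))) := by
  -- Local compactness of K makes the fundamental domain compact, as the treatment of locally
  -- constant test functions requires.
  have : ProperSpace K := FiniteDimensional.proper ℚ_[p] K
  have L := TateGreen.localField_of_irreducible p K f hf ϖ hϖ μ hμ
  refine ⟨fun lam0 A lam hlam => ⟨fun h y hy n hn => ?_, fun h x hx y hy x' hx' y' hy' hxy hxy'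
    hvx hvy => ?_⟩, fun lam0 y hy => ⟨L.summable_lambdaK lam0 hy, fun x hx hxy => ?_⟩,
    fun lam0 => ⟨fun ⟨C, hC⟩ => L.lam0_eq hm hC, fun h0 => ?_⟩,
    fun lam0 h0 => ⟨L.symm_and_lap_iff_isRecurrent hm h0, TateGreen.exists_isRecurrent hm,
      L.isSymmGreen_iff hm h0⟩⟩
  · have h1 := congrFun (L.eq_lamSeq_of_lap lam0 A hy (hlam y hy) fun x hx x' hx' hxy hxy' hv =>
      h x hx y hy x' hx' y hy hxy hxy' hv rfl) (n - 1)
    obtain ⟨n, rfl⟩ := Nat.exists_eq_add_of_le' hn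
    simpa only [Nat.add_sub_cancel, TateGreen.lamSeq, ← pow_mul] using h1
  · have h1 : ∀ y ∈ TateGreen.domainE p (ϖ : K) m, (fun n => lam (n + 1) y) =
        TateGreen.lamSeq ((p : ℝ) ^ f) (TateGreen.UK p f (ϖ : K) m y) lam0 := fun y hy =>
      funext fun n => by
        rw [h y hy (n + 1) (by lia), TateGreen.lamSeq]
        simp only [← pow_mul]
    rw [(L.lap_logSeries_lamSeq lam0 A hx hy hxy (h1 y hy)).2,
      (L.lap_logSeries_lamSeq lam0 A hx' hy' hxy' (h1 y' hy')).2, L.UK_eq, L.UK_eq, hvx, hvy]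
  · refine ⟨(L.lap_BKm lam0 hx hy hxy).1, ?_⟩
    rw [(L.lap_BKm lam0 hx hy hxy).2, L.p_zpow]
    ring
  · obtain ⟨C, hC, -⟩ := TateGreen.exists_isRecurrent (p := p) (f := f) hm 0
    exact ⟨C, ((L.symm_and_lap_iff_isRecurrent hm h0 C).2 hC).2⟩
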